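/- **Setting.** Let $X$ and $A\neq\emptyset$ be finite sets, $L\ge 1$ and $T\ge 2$. Let $X$ be the disjoint union of layers $X_0,\dots,X_L$ with $X_0=\{x_0\}$ and $X_L=\{x_L\}$, and let $k(x)$ be the index of the layer of $x$. Let $P(x'\mid x,a)$ be a transition function for which $P(\cdot\mid x,a)$ is a probability distribution on $X_{k(x)+1}$ for all $x\notin X_L$ and $a\in A$. Let $\ell_1,\dots,\ell_T:X\times A\times X\to[0,1]$ be an arbitrary fixed sequence of loss functions. In each episode $t=1,\dots,T$ a learner, who does not know $P$, chooses a stochastic policy $\pi_t(a\mid x)$ from the past trajectories and past loss functions. It then traverses a trajectory $U_t=(x_0,a_0,x_1,\dots,a_{L-1},x_L)$ with $a_k\sim\pi_t(\cdot\mid x_k)$ and $x_{k+1}\sim P(\cdot\mid x_k,a_k)$, after which $\ell_t$ is revealed. The regret for the total expected loss is $$\hat R_{1:T}=\sum_{t=1}^T\sum_{k=0}^{L-1}\mathbb E\big[\ell_t(x_k,a_k,x_{k+1})\mid P,\pi_t\big]-\min_{\pi}\sum_{t=1}^T\sum_{k=0}^{L-1}\mathbb E\big[\ell_t(x_k,a_k,x_{k+1})\mid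 P,\pi\big],$$ where the minimum is over all stationary stochastic policies. **Algorithm (UC-O-REPS for the total expected loss, with parameters $\eta,\delta$).** Functions $q$ below live on the triples $(x,a,x')\in X_k\times A\times X_{k+1}$, $0\le k<L$ (and vanish on all other triples). Start with $\pi_1(a\mid x)=1/|A|$ and $q_1(x,a,x')=1/(|X_k||A||X_{k+1}|)$, and with all counters $n,m,N,M$ equal to $0$. After episode $t$, for each $k<L$ add $1$ to $n(x_k,a_k)$ and to $m(x_{k+1}\mid x_k,a_k)$, where the states and actions are those of $U_t$. Then, if $n(x,a)\ge N(x,a)$ for some $(x,a)\in X\times A$, start a new epoch: replace $N$ by $N+n$ and $M$ by $M+m$, and reset $n$ and $m$ to $0$. Put $$\bar P(x'\mid x,a)=\frac{M(x'\mid x,a)}{\max\{1,N(x,a)\}},\qquad \epsilon(x,a)=\sqrt{\frac{2|X_{k(x)+1}|\ln\frac{T|X||A|}{\delta}}{\max\{1,N(x,a)\}}}.$$ Let $\Delta$ be the set of all $q$ with values in $[0,1]$ such that - $\sum_{x\in X_k}\sum_{a}\sum_{x'}q(x,a,x')=1$ for every $0\le k<L$; - $\sum_{x'}\sum_a q(x,a,x')=\sum_{x'}\sum_a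 q(x',a,x)$ for every $x\in X_k$ with $0<k<L$; - $\big\|\tfrac{q(x,a,\cdot)}{\sum_y q(x,a,y)}-\bar P(\cdot\mid x,a)\big\|_1\le\epsilon(x,a)$ for every $(x,a)$ with $\sum_y q(x,a,y)>0$. Then set $$q_{t+1}=\arg\min_{q\in\Delta}\ \eta\langle q,\ell_t\rangle+\sum_{x,a,x'}\Big(q\ln\frac{q}{q_t}-q+q_t\Big)(x,a,x'),\qquad \pi_{t+1}(a\mid x)=\frac{\sum_{x'}q_{t+1}(x,a,x')}{\sum_b\sum_{x'}q_{t+1}(x,b,x')}.$$ **Claim.** With $\delta=\frac{|X||A|}{T}$ and $\eta=\sqrt{\frac1T\ln\frac{|X|^2|A|}{L^2}}$, the expected regret of UC-O-REPS, where the expectation is over the trajectories $U_1,\dots,U_T$, satisfies $$\mathbb E\big[\hat R_{1:T}\big]\le 25\,L\,|X|\sqrt{T|A|\ln T}.$$ -/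

import Mathlib

namespace UCOREPS

/-- A finite state space decomposed into layers `X_0, …, X_L`, where `X_0 = {start}` and
`X_L = {final}`; `layer x` is the index `k(x)` of the layer of `x`. -/
structure LayeredSpace (X : Type*) (L : ℕ) where
  layer : X → ℕ
  layer_le : ∀ x, layer x ≤ L
  start : X
  final : X
  layer_eq_zero_iff : ∀ x, layer x = 0 ↔ x = start
  layer_eq_top_iff : ∀ x, layer x = L ↔ x = final

/-- A loop-free transition function: `P x a x'` is the probability `P(x' | x, a)`, and transitions
go only from a layer to the next one (so there are none out of the final state). -/
structure TransitionFunction {X : Type*} [Fintype X] {L : ℕ} (S : LayeredSpace X L)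
    (A : Type*) where
  prob : X → A → X → ℝ
  nonneg : ∀ x a x', 0 ≤ prob x a x'
  sum_eq_one : ∀ x a, S.layer x < L → ∑ x', prob x a x' = 1
  eq_zero_of_layer_ne : ∀ x a x', S.layer x' ≠ S.layer x + 1 → prob x a x' = 0

/-- Stationary stochastic policies; `prob x a` is `π(a | x)`. -/
structure Policy (X A : Type*) [Fintype A] where
  prob : X → A → ℝ
  nonneg : ∀ x a, 0 ≤ prob x a
  sum_eq_one : ∀ x, ∑ a, prob x a = 1

/-- A trajectory `(x_0, a_0, x_1, …, x_{L-1}, a_{L-1}, x_L)`: its states and its actions. -/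
abbrev Trajectory (X A : Type*) (L : ℕ) := (Fin (L + 1) → X) × (Fin L → A)

section Interaction

variable {X A : Type*} [Fintype X] [Fintype A] {L : ℕ} {S : LayeredSpace X L}

open Classical in
/-- The probability of the trajectory `U` when the learner starts in the initial state, action
`a_k` is drawn from `π(· | x_k)` and state `x_{k+1}` is drawn from `P(· | x_k, a_k)`. -/
noncomputable def trajectoryProb (P : TransitionFunction S A) (π : X → A → ℝ)
    (U : Trajectory X A L) : ℝ :=
  (if U.1 0 = S.start then 1 else 0) *
    ∏ k : Fin L, π (U.1 k.castSucc) (U.2 k) *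
      P.prob (U.1 k.castSucc) (U.2 k) (U.1 k.succ)

/-- The sequence `E[ℓ(U) | P, π]` of expected losses, one for each step `k = 0, …, L-1`. -/
noncomputable def expectedLosses (P : TransitionFunction S A) (π : X → A → ℝ)
    (ℓ : X → A → X → ℝ) (k : Fin L) : ℝ :=
  ∑ U : Trajectory X A L, trajectoryProb P π U * ℓ (U.1 k.castSucc) (U.2 k) (U.1 k.succ)

/-- The total expected loss criterion `C^TEL`. -/
def totalExpectedLoss (v : Fin L → ℝ) : ℝ := ∑ k, v k

/-- The regret, with respect to the performance criterion `C`, of a learner that uses policy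
`π t` in episode `t`, against the best stationary stochastic policy in hindsight. -/
noncomputable def regret {T : ℕ} (C : (Fin L → ℝ) → ℝ) (P : TransitionFunction S A)
    (ℓ : Fin T → X → A → X → ℝ) (π : Fin T → X → A → ℝ) : ℝ :=
  ∑ t, C (expectedLosses P (π t) (ℓ t)) -
    ⨅ ρ : Policy X A, ∑ t, C (expectedLosses P ρ.prob (ℓ t))

/-- The probability that the trajectories of the `T` episodes are `H 0, …, H (T-1)`, when
`learner H t` is the policy that the learner plays in episode `t`. For a learner whose policy in
episode `t` depends only on the trajectories of the episodes before `t`, this is the law of the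
interaction of the learner with the environment. -/
noncomputable def historyProb {T : ℕ} (P : TransitionFunction S A)
    (learner : (Fin T → Trajectory X A L) → Fin T → X → A → ℝ)
    (H : Fin T → Trajectory X A L) : ℝ :=
  ∏ t, trajectoryProb P (learner H t) (H t)

/-- The expectation of the regret over the trajectories of the `T` episodes. -/
noncomputable def expectedRegret {T : ℕ} (C : (Fin L → ℝ) → ℝ) (P : TransitionFunction S A)
    (ℓ : Fin T → X → A → X → ℝ)
    (learner : (Fin T → Trajectory X A L) → Fin T → X → A → ℝ) : ℝ :=
  ∑ H : Fin T → Trajectory X A L, historyProb P learner H * regret C P ℓ (learner H)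

end Interaction

section OccupancyMeasures

variable {X A : Type*} [Fintype X] [Fintype A] {L : ℕ}

/-- The number `|X_k|` of states in layer `k`. -/
def LayeredSpace.layerCard (S : LayeredSpace X L) (k : ℕ) : ℕ :=
  (Finset.univ.filter fun x => S.layer x = k).card

/-- The inner product of two functions on `X × A × X`. -/
noncomputable def pairing (q z : X → A → X → ℝ) : ℝ := ∑ x, ∑ a, ∑ x', q x a x' * z x a x'

/-- The unnormalized Kullback-Leibler divergence `D(q ‖ q')`. -/
noncomputable def unnormalizedKL (q q' : X → A → X → ℝ) : ℝ :=
  ∑ x, ∑ a, ∑ x', (q x a x' * Real.log (q x a x' / q' x a x') - q x a x' + q' x a x')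

/-- The transition function `P^q` induced by `q`. -/
noncomputable def inducedTransition (q : X → A → X → ℝ) (x : X) (a : A) (x' : X) : ℝ :=
  q x a x' / ∑ y, q x a y

/-- The policy `π^q` induced by `q`. -/
noncomputable def inducedPolicy (q : X → A → X → ℝ) (x : X) (a : A) : ℝ :=
  (∑ x', q x a x') / ∑ b, ∑ x', q x b x'

/-- `q` satisfies the two basic properties of occupancy measures: it has total mass one on every
layer, and at every state of an inner layer the outgoing mass is the incoming mass. Functions on
the triples in `X_k × A × X_{k+1}` are extended by zero to `X × A × X`. -/
structure IsOccupancyLike (S : LayeredSpace X L) (q : X → A → X → ℝ) : Prop where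
  mem_Icc : ∀ x a x', q x a x' ∈ Set.Icc (0 : ℝ) 1
  eq_zero_of_layer_ne : ∀ x a x', S.layer x' ≠ S.layer x + 1 → q x a x' = 0
  sum_eq_one : ∀ k < L, ∑ x with S.layer x = k, ∑ a, ∑ x', q x a x' = 1
  flow : ∀ x, 0 < S.layer x → S.layer x < L → ∑ x', ∑ a, q x a x' = ∑ x', ∑ a, q x' a x

/-- The confidence radius `ε(x, a)`, where `N` counts the visits to state-action pairs. -/
noncomputable def confidenceRadius (S : LayeredSpace X L) (T : ℕ) (δ : ℝ) (N : X → A → ℕ)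
    (x : X) (a : A) : ℝ :=
  √(2 * (S.layerCard (S.layer x + 1) : ℝ) *
      Real.log ((T : ℝ) * (Fintype.card X : ℝ) * (Fintype.card A : ℝ) / δ) /
    ((max 1 (N x a) : ℕ) : ℝ))

/-- The empirical transition function `P̄(x' | x, a)`. -/
noncomputable def empiricalTransition (N : X → A → ℕ) (M : X → A → X → ℕ)
    (x : X) (a : A) (x' : X) : ℝ :=
  (M x a x' : ℝ) / ((max 1 (N x a) : ℕ) : ℝ)

/-- The confidence set: all `q` that satisfy the basic properties of occupancy measures and whose
induced transition function is `ε`-close to the empirical one in the `L¹` norm, at each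
state-action pair of positive mass (elsewhere the induced transition function is undefined). -/
def confidenceSet (S : LayeredSpace X L) (T : ℕ) (δ : ℝ) (N : X → A → ℕ) (M : X → A → X → ℕ) :
    Set (X → A → X → ℝ) :=
  {q | IsOccupancyLike S q ∧ ∀ x a, 0 < ∑ y, q x a y →
    ∑ x', |inducedTransition q x a x' - empiricalTransition N M x a x'| ≤
      confidenceRadius S T δ N x a}

end OccupancyMeasures

/-- A minimizer of `f` over `s` (an arbitrary element if there is none). -/
noncomputable def argminOn {α : Type*} [Nonempty α] (f : α → ℝ) (s : Set α) : α :=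
  Classical.epsilon fun q => q ∈ s ∧ IsMinOn f s q

section Algorithm

variable {X A : Type*} [Fintype X] [Fintype A] {L : ℕ}

/-- The variables of the algorithm at the start of an episode: the counters `n`, `m` of the current
epoch, the counters `N`, `M` of all the epochs before the current one, the occupancy measure `q`
and the policy `π` for the episode. -/
structure AlgState (X A : Type*) where
  n : X → A → ℕ
  m : X → A → X → ℕ
  N : X → A → ℕ
  M : X → A → X → ℕ
  q : X → A → X → ℝ
  π : X → A → ℝ

/-- The initialization: zero counters, the uniform policy, and the occupancy measure that is
uniform on each `X_k × A × X_{k+1}`. -/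
noncomputable def AlgState.init (A : Type*) [Fintype A] (S : LayeredSpace X L) :
    AlgState X A where
  n _ _ := 0
  m _ _ _ := 0
  N _ _ := 0
  M _ _ _ := 0
  q x _ x' :=
    if S.layer x' = S.layer x + 1 then
      1 / ((S.layerCard (S.layer x) : ℝ) * (Fintype.card A : ℝ) *
        (S.layerCard (S.layer x + 1) : ℝ))
    else 0
  π _ _ := 1 / (Fintype.card A : ℝ)

open Classical in
/-- The update of the epoch counters with the trajectory of the current episode. -/
noncomputable def AlgState.count (s : AlgState X A) (U : Trajectory X A L) : AlgState X A :=
  { s with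
    n := fun x a => s.n x a + ∑ k : Fin L, if U.1 k.castSucc = x ∧ U.2 k = a then 1 else 0
    m := fun x a x' => s.m x a x' +
      ∑ k : Fin L, if U.1 k.castSucc = x ∧ U.2 k = a ∧ U.1 k.succ = x' then 1 else 0 }

open Classical in
/-- If `n(x, a) ≥ N(x, a)` for some state-action pair, a new epoch starts: the counters of the
epoch that ends are added to the total counters and are reset. -/
noncomputable def AlgState.updateEpoch (s : AlgState X A) : AlgState X A :=
  if ∃ x a, s.N x a ≤ s.n x a then
    { s with
      n := fun _ _ => 0
      m := fun _ _ _ => 0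
      N := fun x a => s.N x a + s.n x a
      M := fun x a x' => s.M x a x' + s.m x a x' }
  else s

/-- The mirror descent step with sub-gradient `z`: the next occupancy measure minimizes
`η ⟨q, z⟩ + D(q ‖ q_t)` over the current confidence set, and the next policy is the one that it
induces. -/
noncomputable def AlgState.compPolicy (S : LayeredSpace X L) (T : ℕ) (η δ : ℝ)
    (z : X → A → X → ℝ) (s : AlgState X A) : AlgState X A :=
  let q' := argminOn (fun q => η * pairing q z + unnormalizedKL q s.q)
    (confidenceSet S T δ s.N s.M)
  { s with
    q := q'
    π := inducedPolicy q' }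

/-- The variables of UC-O-REPS after `t` episodes with trajectories `H` and loss functions `ℓ`.
The step after an episode uses only the trajectory and the loss function of that episode; it does
not use the transition function. The map `g` returns a sub-gradient `g q ℓ` at `q` of the criterion
function `f(·; ℓ)`. -/
noncomputable def algRun (S : LayeredSpace X L) {T : ℕ} (η δ : ℝ)
    (g : (X → A → X → ℝ) → (X → A → X → ℝ) → X → A → X → ℝ)
    (ℓ : Fin T → X → A → X → ℝ) (H : Fin T → Trajectory X A L) : ℕ → AlgState X A
  | 0 => AlgState.init A S
  | t + 1 =>
    let s := algRun S η δ g ℓ H t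
    if h : t < T then
      ((s.count (H ⟨t, h⟩)).updateEpoch).compPolicy S T η δ (g s.q (ℓ ⟨t, h⟩))
    else s

/-- The policy that UC-O-REPS plays in each episode, given the trajectories `H`. -/
noncomputable def ucOReps (S : LayeredSpace X L) {T : ℕ} (η δ : ℝ)
    (g : (X → A → X → ℝ) → (X → A → X → ℝ) → X → A → X → ℝ)
    (ℓ : Fin T → X → A → X → ℝ) (H : Fin T → Trajectory X A L) (t : Fin T) : X → A → ℝ :=
  (algRun S η δ g ℓ H t).π

/-- The criterion function `f(q; ℓ) = ⟨q, ℓ⟩` of the total expected loss is linear in `q`, and its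
gradient is `ℓ`. -/
def telGradient (_q ℓ : X → A → X → ℝ) : X → A → X → ℝ := ℓ

/-- `telGradient` is a sub-gradient of `q ↦ ⟨q, ℓ⟩`. -/
theorem telGradient_isSubgradient (q q' ℓ : X → A → X → ℝ) :
    pairing q ℓ + pairing (fun x a x' => q' x a x' - q x a x') (telGradient q ℓ) ≤
      pairing q' ℓ := by
  simp [pairing, telGradient, sub_mul, Finset.sum_sub_distrib]

end Algorithm

/-- The step size `η = √(ln(|X|²|A|/L²) / T)`, for a criterion function with Lipschitz
constant `1`. -/
noncomputable def stepSize (X A : Type*) [Fintype X] [Fintype A] (L T : ℕ) : ℝ :=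
  √(Real.log ((Fintype.card X : ℝ) ^ 2 * (Fintype.card A : ℝ) / (L : ℝ) ^ 2) / (T : ℝ))

end UCOREPS

/-!
The expected regret of UC-O-REPS is split along the occupancy measures. If `q_t` is the iterate of
episode `t`, `π_t` the policy that it induces and `u` the occupancy measure of a competing policy
under the true transition function `P`, the regret against `u` is the sum over `t` of
`⟨q^{P,π_t} - q_t, ℓ_t⟩` (the price of not knowing `P`) and of `⟨q_t - u, ℓ_t⟩` (the regret of
online mirror descent).

The second sum is bounded on the event `GoodHistory` that `P` lies in all the confidence regions,
since then `u` lies in all the confidence sets. The confidence sets are compact and convex and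
contain positive points, so the minimizers exist and are positive (`posExactlyOn_of_isMinOn`), and
the first-order condition gives the usual telescoping bound (`mirror_step_regret`,
`iterate_regret_le`). The relative entropy of `u` to the uniform start is at most
`L ln(|X|²|A|/L²)` by concavity of the logarithm.

For the first sum, the difference of the occupancy measures of one policy under two transition
functions propagates from layer to layer, and is at most `L` times the expected `L¹` distance of
the transition functions along a trajectory of the policy under `P`
(`pairing_occupancy_sub_le`). On the good event that distance is at most twice the confidence
radius. The radius is determined by the past, so by the tower property its expectation under `π_t`
may be replaced by its value along the trajectory that is drawn (`seqExp_sum_expectedRadii_le`);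
since the radius after `n` visits is of order `1/√n`, these values add up to
`O(|X|√(T|A| ln T))` on every history (`sum_confidenceRadius_le`).

The complement of the good event has probability at most `2|X||A|/T` (`seqExp_bad_le`). For each
state-action pair, each number `n` of visits and each `±1`-valued test function on the next layer,
the exponential of the deviation over the first `n` visits is a supermartingale by Hoeffding's
lemma; Markov's inequality and a union bound conclude. There the regret is at most `LT`.

All probabilities are finite sums: a history is a finite sequence of trajectories with the product
of conditional probabilities as its weight (`seqExp`). Trajectories that do not follow the layers
have probability zero, and only histories of the other ones are considered, because on these the
counters are consistent and the policies are stochastic.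
-/

set_option linter.unusedSectionVars false

namespace UCOREPS

/-! ### Sequences of dependent random variables with values in a finite type -/

section Sequences

variable {Ω : Type*} {T : ℕ}

theorem update_eq_of_dependsOn {F : (Fin T → Ω) → ℝ} {s : Set (Fin T)} (hF : DependsOn F s)
    {t : Fin T} (ht : t ∉ s) (H : Fin T → Ω) (u : Ω) : F (Function.update H t u) = F H := by
  apply hF
  intro i hi
  rw [Function.update_of_ne]
  rintro rfl
  exact ht hi

theorem dependsOn_prod_lt {w : Fin T → (Fin T → Ω) → ℝ}
    (hw : ∀ t, DependsOn (w t) (Set.Iic t)) (j : ℕ) :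
    DependsOn (fun H => ∏ s with s.val < j, w s H) {s : Fin T | s.val < j} := by
  intro H H' h
  refine Finset.prod_congr rfl fun s hs => hw s fun i hi => h i ?_
  simp only [Finset.mem_filter, Finset.mem_univ, true_and] at hs
  exact lt_of_le_of_lt hi hs

variable [Fintype Ω]

/-- `W t H` is the conditional probability of the outcome `H t` in round `t`, given the outcomes
of the rounds before `t`. -/
structure IsCausalKernel (W : Fin T → (Fin T → Ω) → ℝ) : Prop where
  dependsOn : ∀ t, DependsOn (W t) (Set.Iic t)
  nonneg : ∀ t H, 0 ≤ W t H
  sum_eq_one : ∀ t H, ∑ u, W t (Function.update H t u) = 1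

/-- The expectation of `F` when the outcomes are drawn one after the other according to `W`. -/
noncomputable def seqExp (W : Fin T → (Fin T → Ω) → ℝ) (F : (Fin T → Ω) → ℝ) : ℝ :=
  ∑ H, (∏ t, W t H) * F H

/-- Resampling one coordinate permutes the pairs of a sequence and a new value for it. -/
theorem sum_sum_update (t : Fin T) (G : (Fin T → Ω) → ℝ) :
    ∑ H, ∑ u, G (Function.update H t u) = Fintype.card Ω * ∑ H, G H := by
  have hinv : Function.Involutive
      (fun p : (Fin T → Ω) × Ω => (Function.update p.1 t p.2, p.1 t)) := by
    rintro ⟨H, u⟩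
    simp
  have h1 : ∑ p : (Fin T → Ω) × Ω, G (Function.update p.1 t p.2) =
      ∑ p : (Fin T → Ω) × Ω, G p.1 :=
    Fintype.sum_bijective _ hinv.bijective _ _ fun p => rfl
  rw [Fintype.sum_prod_type, Fintype.sum_prod_type] at h1
  simpa [Finset.mul_sum] using h1

@[to_additive]
theorem prod_lt_succ {R : Type*} [CommMonoid R] (j : ℕ) (hj : j < T) (w : Fin T → R) :
    ∏ s with s.val < j + 1, w s = (∏ s with s.val < j, w s) * w ⟨j, hj⟩ := by
  have : (Finset.univ.filter fun s : Fin T => s.val < j + 1) =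
      insert ⟨j, hj⟩ (Finset.univ.filter fun s : Fin T => s.val < j) := by
    ext s
    simp [Fin.ext_iff]
    omega
  rw [this, Finset.prod_insert (by simp), mul_comm]

variable {W : Fin T → (Fin T → Ω) → ℝ}

/-- Summing out the outcome of round `j`. -/
theorem card_mul_sum_prod_lt_succ (hW : ∀ t, DependsOn (W t) (Set.Iic t)) (j : ℕ) (hj : j < T)
    (F : (Fin T → Ω) → ℝ) :
    Fintype.card Ω * ∑ H, (∏ s with s.val < j + 1, W s H) * F H =
      ∑ H, (∏ s with s.val < j, W s H) *
        ∑ u, W ⟨j, hj⟩ (Function.update H ⟨j, hj⟩ u) * F (Function.update H ⟨j, hj⟩ u) := by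
  rw [← sum_sum_update ⟨j, hj⟩]
  refine Finset.sum_congr rfl fun H _ => ?_
  rw [Finset.mul_sum]
  refine Finset.sum_congr rfl fun u _ => ?_
  rw [prod_lt_succ j hj, update_eq_of_dependsOn (dependsOn_prod_lt hW j) (t := ⟨j, hj⟩) (by simp)]
  ring

/-- Summing out all the outcomes of the rounds from `j` on. -/
theorem IsCausalKernel.card_pow_mul_seqExp (hW : IsCausalKernel W) (i : ℕ) :
    ∀ j, j + i = T → ∀ F : (Fin T → Ω) → ℝ, DependsOn F {s : Fin T | s.val < j} →
    Fintype.card Ω ^ i * seqExp W F = ∑ H, (∏ s with s.val < j, W s H) * F H := by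
  induction i with
  | zero =>
    intro j hj F _
    have : (Finset.univ.filter fun s : Fin T => s.val < j) = Finset.univ := by
      ext s
      simp
      omega
    simp [seqExp, this]
  | succ i ih =>
    intro j hj F hF
    have h1 := ih (j + 1) (by omega) F (hF.mono fun s hs => by
      simp only [Set.mem_ofPred_eq] at hs ⊢
      omega)
    rw [pow_succ', mul_assoc, h1, card_mul_sum_prod_lt_succ hW.dependsOn j (by omega)]
    refine Finset.sum_congr rfl fun H _ => ?_
    congr 1
    simp_rw [update_eq_of_dependsOn hF (t := ⟨j, by omega⟩) (by simp)]
    rw [← Finset.sum_mul, hW.sum_eq_one, one_mul]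

/-- The tower property: a function of the outcomes up to round `t` may be replaced by its
conditional expectation given the outcomes before round `t`. -/
theorem IsCausalKernel.seqExp_tower (hW : IsCausalKernel W) (t : Fin T) (F : (Fin T → Ω) → ℝ)
    (hF : DependsOn F (Set.Iic t)) :
    seqExp W F = seqExp W fun H =>
      ∑ u, W t (Function.update H t u) * F (Function.update H t u) := by
  rcases isEmpty_or_nonempty Ω with hΩ | hΩ
  · have : IsEmpty (Fin T → Ω) := ⟨fun H => hΩ.false (H t)⟩
    simp [seqExp]
  have hcard : (Fintype.card Ω : ℝ) ≠ 0 := by exact_mod_cast Fintype.card_ne_zero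
  have ht := t.2
  have h1 := hW.card_pow_mul_seqExp (T - t - 1) (t + 1) (by omega) F
    (hF.mono fun s hs => by
      simp only [Set.mem_Iic, Set.mem_ofPred_eq, Fin.le_def] at hs ⊢
      omega)
  have h2 := hW.card_pow_mul_seqExp (T - t - 1 + 1) t (by omega)
    (fun H => ∑ u, W t (Function.update H t u) * F (Function.update H t u)) (by
      intro H H' h
      refine Finset.sum_congr rfl fun u _ => ?_
      have hu : ∀ i ∈ Set.Iic t, Function.update H t u i = Function.update H' t u i := by
        intro i hi
        rcases eq_or_ne i t with rfl | hne
        · simp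
        · rw [Function.update_of_ne hne, Function.update_of_ne hne]
          exact h i (lt_of_le_of_ne hi hne)
      rw [hW.dependsOn t hu, hF hu])
  rw [← card_mul_sum_prod_lt_succ hW.dependsOn t t.2 F, ← h1, pow_succ', mul_assoc] at h2
  exact (mul_left_cancel₀ (pow_ne_zero _ hcard) (mul_left_cancel₀ hcard h2)).symm

theorem IsCausalKernel.prod_nonneg (hW : IsCausalKernel W) (H : Fin T → Ω) :
    0 ≤ ∏ t, W t H := Finset.prod_nonneg fun t _ => hW.nonneg t H

theorem IsCausalKernel.seqExp_mono (hW : IsCausalKernel W) {F G : (Fin T → Ω) → ℝ}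
    (h : ∀ H, F H ≤ G H) : seqExp W F ≤ seqExp W G :=
  Finset.sum_le_sum fun H _ => mul_le_mul_of_nonneg_left (h H) (hW.prod_nonneg H)

theorem seqExp_add (F G : (Fin T → Ω) → ℝ) :
    seqExp W (fun H => F H + G H) = seqExp W F + seqExp W G := by
  simp [seqExp, mul_add, Finset.sum_add_distrib]

theorem seqExp_const_mul (c : ℝ) (F : (Fin T → Ω) → ℝ) :
    seqExp W (fun H => c * F H) = c * seqExp W F := by
  simp only [seqExp, Finset.mul_sum]
  exact Finset.sum_congr rfl fun H _ => by ring

theorem seqExp_sum {ι : Type*} (s : Finset ι) (F : ι → (Fin T → Ω) → ℝ) :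
    seqExp W (fun H => ∑ i ∈ s, F i H) = ∑ i ∈ s, seqExp W (F i) := by
  simp only [seqExp, Finset.mul_sum]
  exact Finset.sum_comm

/-- A product of factors with conditional expectations at most one has expectation at most one. -/
theorem IsCausalKernel.seqExp_prod_lt_le [Nonempty Ω] (hW : IsCausalKernel W)
    {w : Fin T → (Fin T → Ω) → ℝ}
    (hw : ∀ t, DependsOn (w t) (Set.Iic t)) (hw0 : ∀ t H, 0 ≤ w t H)
    (hw1 : ∀ t H, ∑ u, W t (Function.update H t u) * w t (Function.update H t u) ≤ 1)
    (j : ℕ) (hj : j ≤ T) :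
    seqExp W (fun H => ∏ s with s.val < j, w s H) ≤ seqExp W fun _ => 1 := by
  induction j with
  | zero => simp
  | succ j ih =>
    refine le_trans ?_ (ih (by omega))
    have hj' : j < T := hj
    simp_rw [prod_lt_succ j hj']
    rw [hW.seqExp_tower ⟨j, hj'⟩]
    · refine hW.seqExp_mono fun H => ?_
      have hupd : ∀ u, ∏ s with s.val < j, w s (Function.update H ⟨j, hj'⟩ u) =
          ∏ s with s.val < j, w s H :=
        update_eq_of_dependsOn (dependsOn_prod_lt hw j) (by simp) H
      refine le_of_eq_of_le ?_
        (mul_le_of_le_one_right (Finset.prod_nonneg fun s _ => hw0 s H) (hw1 ⟨j, hj'⟩ H))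
      rw [Finset.mul_sum]
      exact Finset.sum_congr rfl fun u _ => by rw [hupd]; ring
    · intro H H' h
      have h1 := dependsOn_prod_lt hw j fun s hs => h s (show s ≤ ⟨j, hj'⟩ from le_of_lt hs)
      simp only at h1 ⊢
      rw [hw _ h, h1]

theorem IsCausalKernel.seqExp_one [Nonempty Ω] (hW : IsCausalKernel W) :
    seqExp W (fun _ => 1) = 1 := by
  have h := hW.card_pow_mul_seqExp T 0 (by omega) (fun _ => 1) (fun _ _ _ => rfl)
  have hcard : (Fintype.card Ω : ℝ) ≠ 0 := by exact_mod_cast Fintype.card_ne_zero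
  simp at h
  simpa [hcard] using h

theorem IsCausalKernel.seqExp_const [Nonempty Ω] (hW : IsCausalKernel W) (c : ℝ) :
    seqExp W (fun _ => c) = c := by
  simpa [hW.seqExp_one] using seqExp_const_mul (W := W) c fun _ => 1

theorem IsCausalKernel.seqExp_prod_le_one [Nonempty Ω] (hW : IsCausalKernel W)
    {w : Fin T → (Fin T → Ω) → ℝ}
    (hw : ∀ t, DependsOn (w t) (Set.Iic t)) (hw0 : ∀ t H, 0 ≤ w t H)
    (hw1 : ∀ t H, ∑ u, W t (Function.update H t u) * w t (Function.update H t u) ≤ 1) :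
    seqExp W (fun H => ∏ s, w s H) ≤ 1 := by
  have h := hW.seqExp_prod_lt_le hw hw0 hw1 T le_rfl
  simpa [hW.seqExp_one] using h

end Sequences

/-! ### Trajectories and occupancy measures -/

section Trajectories

variable {X A : Type*} [Fintype X] [Fintype A]

/-- The weight `μ(x_0) ∏ K(x_k, a_k, x_{k+1})` of a trajectory. -/
def pathWeight (K : X → A → X → ℝ) (μ : X → ℝ) {n : ℕ} (U : Trajectory X A n) : ℝ :=
  μ (U.1 0) * ∏ k : Fin n, K (U.1 k.castSucc) (U.2 k) (U.1 k.succ)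

/-- The state distribution after one step from the state distribution `μ`. -/
def push (K : X → A → X → ℝ) (μ : X → ℝ) (x' : X) : ℝ := ∑ x, ∑ a, μ x * K x a x'

theorem sum_trajectory_succ {n : ℕ} (F : Trajectory X A (n + 1) → ℝ) :
    ∑ U, F U = ∑ x, ∑ a, ∑ V : Trajectory X A n,
      F (Fin.cons x V.1, Fin.cons a V.2) := by
  rw [Fintype.sum_prod_type, ← (Fin.consEquiv fun _ => X).sum_comp, Fintype.sum_prod_type]
  refine Finset.sum_congr rfl fun x _ => ?_
  simp_rw [← (Fin.consEquiv fun _ => A).sum_comp, Fintype.sum_prod_type]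
  rw [Finset.sum_comm]
  rfl

theorem pathWeight_cons (K : X → A → X → ℝ) (μ : X → ℝ) {n : ℕ} (V : Trajectory X A n)
    (x : X) (a : A) :
    pathWeight K μ (n := n + 1) (Fin.cons x V.1, Fin.cons a V.2) =
      μ x * K x a (V.1 0) * ∏ k : Fin n, K (V.1 k.castSucc) (V.2 k) (V.1 k.succ) := by
  simp only [pathWeight, Fin.prod_univ_succ, Fin.cons_zero, Fin.castSucc_zero, Fin.cons_succ,
    ← Fin.succ_castSucc, mul_assoc]

variable {L : ℕ} {S : LayeredSpace X L}

/-- `K` is a transition kernel from each layer to the next one. -/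
structure IsLayerKernel (S : LayeredSpace X L) (K : X → A → X → ℝ) : Prop where
  nonneg : ∀ x a x', 0 ≤ K x a x'
  layer : ∀ x a x', K x a x' ≠ 0 → S.layer x' = S.layer x + 1
  sum_eq_one : ∀ x, S.layer x < L → ∑ a, ∑ x', K x a x' = 1

variable {K : X → A → X → ℝ}

theorem IsLayerKernel.layer_push (hK : IsLayerKernel S K) {μ : X → ℝ} {k : ℕ}
    (hμ : ∀ x, μ x ≠ 0 → S.layer x = k) : ∀ x, push K μ x ≠ 0 → S.layer x = k + 1 := by
  intro x hx
  obtain ⟨y, -, hy⟩ := Finset.exists_ne_zero_of_sum_ne_zero hx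
  obtain ⟨a, -, ha⟩ := Finset.exists_ne_zero_of_sum_ne_zero hy
  rw [hK.layer y a x (right_ne_zero_of_mul ha), hμ y (left_ne_zero_of_mul ha)]

theorem IsLayerKernel.sum_push (hK : IsLayerKernel S K) {μ : X → ℝ} {k : ℕ} (hk : k < L)
    (hμ : ∀ x, μ x ≠ 0 → S.layer x = k) : ∑ x, push K μ x = ∑ x, μ x := by
  simp only [push]
  rw [Finset.sum_comm]
  refine Finset.sum_congr rfl fun x _ => ?_
  rw [Finset.sum_comm]
  by_cases hx : μ x = 0
  · simp [hx]
  · simp_rw [← Finset.mul_sum]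
    rw [hK.sum_eq_one x (by rw [hμ x hx]; exact hk), mul_one]

theorem sum_sum_pathWeight_cons (μ : X → A → X → ℝ) {n : ℕ} (V : Trajectory X A n) :
    ∑ x, ∑ a, μ x a (V.1 0) * ∏ k : Fin n, K (V.1 k.castSucc) (V.2 k) (V.1 k.succ) =
      pathWeight K (fun x' => ∑ x, ∑ a, μ x a x') V := by
  simp only [pathWeight, Finset.sum_mul]

/-- The total weight of the trajectories is the total mass of the initial distribution. -/
theorem IsLayerKernel.sum_pathWeight (hK : IsLayerKernel S K) (n : ℕ) :
    ∀ (k : ℕ) (μ : X → ℝ), k + n = L → (∀ x, μ x ≠ 0 → S.layer x = k) →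
    ∑ U : Trajectory X A n, pathWeight K μ U = ∑ x, μ x := by
  induction n with
  | zero =>
    intro k μ _ _
    simp only [pathWeight, Fintype.sum_prod_type, Finset.univ_eq_empty, Finset.prod_empty, mul_one,
      Finset.sum_const, Finset.card_univ]
    simp only [Fintype.card_unique, one_smul]
    exact Fintype.sum_equiv (Equiv.funUnique (Fin 1) X) _ _ fun f => rfl
  | succ n ih =>
    intro k μ hk hμ
    rw [sum_trajectory_succ]
    simp_rw [pathWeight_cons]
    rw [← hK.sum_push (by omega) hμ, ← ih (k + 1) (push K μ) (by omega) (hK.layer_push hμ)]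
    simp_rw [Finset.sum_comm (s := (Finset.univ : Finset A))
      (t := (Finset.univ : Finset (Trajectory X A n)))]
    rw [Finset.sum_comm]
    exact Finset.sum_congr rfl fun V _ => sum_sum_pathWeight_cons (fun x a x' => μ x * K x a x') V

/-- The law of the `k`-th step of a random trajectory. -/
theorem IsLayerKernel.sum_pathWeight_mul (hK : IsLayerKernel S K) (f : X → A → X → ℝ) (n : ℕ) :
    ∀ (j : ℕ) (μ : X → ℝ) (k : Fin n), j + n = L → (∀ x, μ x ≠ 0 → S.layer x = j) →
    ∑ U : Trajectory X A n, pathWeight K μ U * f (U.1 k.castSucc) (U.2 k) (U.1 k.succ) =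
      ∑ x, ∑ a, ∑ x', (push K)^[k] μ x * K x a x' * f x a x' := by
  induction n with
  | zero => intro _ _ k; exact k.elim0
  | succ n ih =>
    intro j μ k hj hμ
    rw [sum_trajectory_succ]
    simp_rw [pathWeight_cons]
    simp_rw [Finset.sum_comm (s := (Finset.univ : Finset A))
      (t := (Finset.univ : Finset (Trajectory X A n)))]
    rw [Finset.sum_comm]
    refine Fin.cases ?_ (fun k => ?_) k
    · have hsupp : ∀ x', (∑ x, ∑ a, μ x * K x a x' * f x a x') ≠ 0 → S.layer x' = j + 1 := by
        intro x' hx'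
        obtain ⟨y, -, hy⟩ := Finset.exists_ne_zero_of_sum_ne_zero hx'
        obtain ⟨a, -, ha⟩ := Finset.exists_ne_zero_of_sum_ne_zero hy
        have h1 := left_ne_zero_of_mul ha
        rw [hK.layer y a x' (right_ne_zero_of_mul h1), hμ y (left_ne_zero_of_mul h1)]
      have h := hK.sum_pathWeight n (j + 1) _ (by omega) hsupp
      simp_rw [← sum_sum_pathWeight_cons (fun x a x' => μ x * K x a x' * f x a x')] at h
      simp only [Fin.castSucc_zero, Fin.cons_zero, Fin.succ_zero_eq_one, Fin.cons_one, Fin.val_zero,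
        Function.iterate_zero, id]
      calc _ = ∑ V : Trajectory X A n, ∑ x, ∑ a, μ x * K x a (V.1 0) * f x a (V.1 0) *
            ∏ k : Fin n, K (V.1 k.castSucc) (V.2 k) (V.1 k.succ) :=
          Finset.sum_congr rfl fun V _ => Finset.sum_congr rfl fun x _ =>
            Finset.sum_congr rfl fun a _ => by ring
        _ = _ := by
          rw [h, Finset.sum_comm]
          exact Finset.sum_congr rfl fun x _ => Finset.sum_comm
    · rw [Fin.val_succ, Function.iterate_succ_apply,
        ← ih (j + 1) (push K μ) k (by omega) (hK.layer_push hμ)]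
      refine Finset.sum_congr rfl fun V _ => ?_
      rw [show pathWeight K (push K μ) V = pathWeight K (fun x' => ∑ x, ∑ a, μ x * K x a x') V
        from rfl, ← sum_sum_pathWeight_cons (fun x a x' => μ x * K x a x') V]
      simp only [Finset.sum_mul, ← Fin.succ_castSucc, Fin.cons_succ]

end Trajectories

section Occupancy

variable {X A : Type*} [Fintype X] [Fintype A] {L : ℕ} {S : LayeredSpace X L}

/-- `π` is a stochastic policy at the states at which an action is taken. -/
structure IsPolicy (S : LayeredSpace X L) (π : X → A → ℝ) : Prop where
  nonneg : ∀ x a, 0 ≤ π x a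
  sum_eq_one : ∀ x, S.layer x < L → ∑ a, π x a = 1

theorem Policy.isPolicy (ρ : Policy X A) : IsPolicy S ρ.prob :=
  ⟨ρ.nonneg, fun x _ => ρ.sum_eq_one x⟩

theorem IsPolicy.isLayerKernel {π : X → A → ℝ} (hπ : IsPolicy S π) (P : TransitionFunction S A) :
    IsLayerKernel S fun x a x' => π x a * P.prob x a x' where
  nonneg x a x' := mul_nonneg (hπ.nonneg x a) (P.nonneg x a x')
  layer x a x' h := by
    by_contra hne
    simp [P.eq_zero_of_layer_ne x a x' hne] at h
  sum_eq_one x hx := by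
    simp_rw [← Finset.mul_sum, P.sum_eq_one x _ hx, mul_one, hπ.sum_eq_one x hx]

open Classical in
/-- The distribution of the state `x_k` for the policy `π`. -/
noncomputable def stateDist (P : TransitionFunction S A) (π : X → A → ℝ) (k : ℕ) : X → ℝ :=
  (push fun x a x' => π x a * P.prob x a x')^[k] fun x => if x = S.start then 1 else 0

/-- The occupancy measure of the policy `π`. -/
noncomputable def occupancy (P : TransitionFunction S A) (π : X → A → ℝ) (x : X) (a : A)
    (x' : X) : ℝ :=
  stateDist P π (S.layer x) x * (π x a * P.prob x a x')

variable (P : TransitionFunction S A) {π : X → A → ℝ}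

theorem stateDist_succ (k : ℕ) (x' : X) :
    stateDist P π (k + 1) x' = ∑ x, ∑ a, stateDist P π k x * (π x a * P.prob x a x') := by
  rw [stateDist, Function.iterate_succ_apply']
  rfl

open Classical in
theorem stateDist_zero (x : X) : stateDist P π 0 x = if x = S.start then 1 else 0 := rfl

theorem stateDist_nonneg (hπ : IsPolicy S π) (k : ℕ) (x : X) : 0 ≤ stateDist P π k x := by
  induction k generalizing x with
  | zero => rw [stateDist_zero]; positivity
  | succ k ih =>
    rw [stateDist_succ]
    exact Finset.sum_nonneg fun y _ => Finset.sum_nonneg fun a _ =>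
      mul_nonneg (ih y) ((hπ.isLayerKernel P).nonneg y a x)

theorem layer_of_stateDist_ne_zero (hπ : IsPolicy S π) (k : ℕ) (x : X)
    (h : stateDist P π k x ≠ 0) : S.layer x = k := by
  induction k generalizing x with
  | zero =>
    rw [stateDist_zero] at h
    rw [S.layer_eq_zero_iff]
    by_contra hx
    simp [hx] at h
  | succ k ih =>
    rw [stateDist, Function.iterate_succ_apply'] at h
    exact (hπ.isLayerKernel P).layer_push ih x h

theorem sum_stateDist (hπ : IsPolicy S π) (k : ℕ) (hk : k ≤ L) : ∑ x, stateDist P π k x = 1 := by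
  induction k with
  | zero =>
    rw [Finset.sum_eq_single S.start (by simp +contextual [stateDist_zero]) (by simp)]
    simp [stateDist_zero]
  | succ k ih =>
    rw [← ih (by omega), stateDist, Function.iterate_succ_apply']
    exact (hπ.isLayerKernel P).sum_push (by omega) (layer_of_stateDist_ne_zero P hπ k)

/-- The step `k` of a random trajectory starts in a state with law `stateDist P π k`. -/
theorem sum_trajectoryProb_mul (hπ : IsPolicy S π) (f : X → A → X → ℝ) (k : Fin L) :
    ∑ U, trajectoryProb P π U * f (U.1 k.castSucc) (U.2 k) (U.1 k.succ) =
      ∑ x, ∑ a, ∑ x', stateDist P π k x * (π x a * P.prob x a x') * f x a x' :=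
  (hπ.isLayerKernel P).sum_pathWeight_mul f L 0 _ k (by omega)
    (layer_of_stateDist_ne_zero P hπ 0)

theorem sum_trajectoryProb (hπ : IsPolicy S π) : ∑ U, trajectoryProb P π U = 1 := by
  rw [← sum_stateDist P hπ 0 (by omega)]
  exact (hπ.isLayerKernel P).sum_pathWeight L 0 _ (by omega) (layer_of_stateDist_ne_zero P hπ 0)

theorem trajectoryProb_nonneg (hπ : IsPolicy S π) (U : Trajectory X A L) :
    0 ≤ trajectoryProb P π U :=
  mul_nonneg (by positivity) (Finset.prod_nonneg fun k _ => (hπ.isLayerKernel P).nonneg _ _ _)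

/-- A sum over all the states but the final one, split into layers. -/
theorem sum_layers (f : X → ℝ) (hf : ∀ x, S.layer x = L → f x = 0) :
    ∑ k : Fin L, ∑ x with S.layer x = k, f x = ∑ x, f x := by
  simp_rw [Finset.sum_filter]
  rw [Finset.sum_comm]
  refine Finset.sum_congr rfl fun x _ => ?_
  by_cases hx : S.layer x = L
  · simp [hf x hx]
  · have hlt : S.layer x < L := lt_of_le_of_ne (S.layer_le x) hx
    rw [Finset.sum_eq_single (⟨S.layer x, hlt⟩ : Fin L)]
    · simp
    · intro k _ hk
      rw [if_neg]
      rintro h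
      exact hk (Fin.ext h.symm)
    · simp

/-- The total expected loss is linear in the occupancy measure. -/
theorem totalExpectedLoss_expectedLosses (hπ : IsPolicy S π) (ℓ : X → A → X → ℝ) :
    totalExpectedLoss (expectedLosses P π ℓ) = pairing (occupancy P π) ℓ := by
  rw [totalExpectedLoss, pairing, ← sum_layers (S := S)]
  · refine Finset.sum_congr rfl fun k _ => ?_
    rw [expectedLosses, sum_trajectoryProb_mul P hπ, Finset.sum_filter]
    refine Finset.sum_congr rfl fun x _ => ?_
    split_ifs with hx
    · simp only [occupancy, hx]
    · have : stateDist P π k x = 0 := by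
        by_contra h
        exact hx (layer_of_stateDist_ne_zero P hπ k x h)
      simp [this]
  · intro x hx
    refine Finset.sum_eq_zero fun a _ => Finset.sum_eq_zero fun x' _ => ?_
    have h1 := S.layer_le x'
    rw [occupancy, P.eq_zero_of_layer_ne x a x' (by omega)]
    ring

theorem sum_occupancy (x : X) (hx : S.layer x < L) (a : A) :
    ∑ x', occupancy P π x a x' = stateDist P π (S.layer x) x * π x a := by
  simp only [occupancy, ← Finset.mul_sum, P.sum_eq_one x a hx, mul_one]

theorem sum_sum_occupancy (hπ : IsPolicy S π) (x : X) (hx : S.layer x < L) :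
    ∑ a, ∑ x', occupancy P π x a x' = stateDist P π (S.layer x) x := by
  simp_rw [sum_occupancy P x hx, ← Finset.mul_sum, hπ.sum_eq_one x hx, mul_one]

theorem occupancy_eq (x : X) (hx : S.layer x < L) (a : A) (x' : X) :
    occupancy P π x a x' = (∑ y, occupancy P π x a y) * P.prob x a x' := by
  rw [sum_occupancy P x hx, occupancy]
  ring

theorem occupancy_nonneg (hπ : IsPolicy S π) (x : X) (a : A) (x' : X) :
    0 ≤ occupancy P π x a x' :=
  mul_nonneg (stateDist_nonneg P hπ _ x) ((hπ.isLayerKernel P).nonneg x a x')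

theorem sum_stateDist_filter (hπ : IsPolicy S π) (k : ℕ) (hk : k ≤ L) :
    ∑ x with S.layer x = k, stateDist P π (S.layer x) x = 1 := by
  rw [← sum_stateDist P hπ k hk, Finset.sum_filter]
  refine Finset.sum_congr rfl fun x _ => ?_
  split_ifs with hx
  · rw [hx]
  · by_contra h
    exact hx (layer_of_stateDist_ne_zero P hπ k x (Ne.symm h))

theorem isOccupancyLike_occupancy (hπ : IsPolicy S π) : IsOccupancyLike S (occupancy P π) := by
  have hsum : ∀ k < L, ∑ x with S.layer x = k, ∑ a, ∑ x', occupancy P π x a x' = 1 := by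
    intro k hk
    rw [← sum_stateDist_filter P hπ k hk.le]
    refine Finset.sum_congr rfl fun x hx => sum_sum_occupancy P hπ x ?_
    rw [(Finset.mem_filter.1 hx).2]
    exact hk
  have h0 : ∀ x a x', S.layer x' ≠ S.layer x + 1 → occupancy P π x a x' = 0 := by
    intro x a x' h
    rw [occupancy, P.eq_zero_of_layer_ne x a x' h]
    ring
  refine ⟨fun x a x' => ⟨occupancy_nonneg P hπ x a x', ?_⟩, h0, hsum, ?_⟩
  · by_cases hx : S.layer x < L
    · rw [← hsum (S.layer x) hx]
      have hn := occupancy_nonneg P hπ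
      calc occupancy P π x a x' ≤ ∑ x', occupancy P π x a x' :=
            Finset.single_le_sum (fun y _ => hn x a y) (Finset.mem_univ x')
        _ ≤ ∑ a, ∑ x', occupancy P π x a x' :=
            Finset.single_le_sum (f := fun a => ∑ x', occupancy P π x a x')
              (fun b _ => Finset.sum_nonneg fun y _ => hn x b y) (Finset.mem_univ a)
        _ ≤ _ := Finset.single_le_sum (f := fun x => ∑ a, ∑ x', occupancy P π x a x')
              (fun z _ => Finset.sum_nonneg fun b _ => Finset.sum_nonneg fun y _ => hn z b y)
              (by simp)
    · have h1 := S.layer_le x'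
      rw [h0 x a x' (by omega)]
      exact zero_le_one
  · intro x hx0 hxL
    rw [Finset.sum_comm, sum_sum_occupancy P hπ x hxL]
    obtain ⟨k, hk⟩ := Nat.exists_eq_succ_of_ne_zero hx0.ne'
    rw [hk, Nat.succ_eq_add_one, stateDist_succ]
    refine Finset.sum_congr rfl fun y _ => Finset.sum_congr rfl fun a _ => ?_
    by_cases hy : S.layer y = k
    · rw [occupancy, hy]
    · rw [h0 y a x (by omega), P.eq_zero_of_layer_ne y a x (by omega)]
      ring

theorem stateDist_pos (hP : ∀ x a x', S.layer x' = S.layer x + 1 → 0 < P.prob x a x')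
    [Nonempty A] (hπ : IsPolicy S π) (hπ0 : ∀ x a, 0 < π x a) (k : ℕ) (x : X)
    (hx : S.layer x = k) : 0 < stateDist P π k x := by
  induction k generalizing x with
  | zero => simp [stateDist_zero, (S.layer_eq_zero_iff x).1 hx]
  | succ k ih =>
    have hkL : k ≤ L := by have := S.layer_le x; omega
    have h1 : ∑ x, stateDist P π k x ≠ 0 := by rw [sum_stateDist P hπ k hkL]; exact one_ne_zero
    obtain ⟨y, -, hy⟩ := Finset.exists_ne_zero_of_sum_ne_zero h1
    have hyk := layer_of_stateDist_ne_zero P hπ k y hy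
    have hnn : ∀ y a, 0 ≤ stateDist P π k y * (π y a * P.prob y a x) := fun y a =>
      mul_nonneg (stateDist_nonneg P hπ k y) ((hπ.isLayerKernel P).nonneg y a x)
    rw [stateDist_succ]
    refine Finset.sum_pos' (fun y _ => Finset.sum_nonneg fun a _ => hnn y a) ⟨y, by simp, ?_⟩
    refine Finset.sum_pos' (fun a _ => hnn y a) ⟨Classical.arbitrary A, by simp, ?_⟩
    exact mul_pos (ih y hyk) (mul_pos (hπ0 _ _) (hP y _ x (by omega)))

theorem occupancy_pos (hP : ∀ x a x', S.layer x' = S.layer x + 1 → 0 < P.prob x a x')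
    [Nonempty A] (hπ : IsPolicy S π) (hπ0 : ∀ x a, 0 < π x a) (x : X) (a : A) (x' : X)
    (hx : S.layer x' = S.layer x + 1) : 0 < occupancy P π x a x' :=
  mul_pos (stateDist_pos P hP hπ hπ0 _ x rfl) (mul_pos (hπ0 x a) (hP x a x' hx))

theorem exists_layer_eq [Nonempty A] (P : TransitionFunction S A) (k : ℕ) (hk : k ≤ L) :
    ∃ x, S.layer x = k := by
  have hπ : IsPolicy S fun (_ : X) (_ : A) => (1 : ℝ) / Fintype.card A :=
    ⟨fun _ _ => by positivity, fun _ _ => by simp⟩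
  have h1 := sum_stateDist P hπ k hk
  obtain ⟨y, -, hy⟩ := Finset.exists_ne_zero_of_sum_ne_zero (h1.trans_ne one_ne_zero)
  exact ⟨y, layer_of_stateDist_ne_zero P hπ k y hy⟩

/-- A trajectory that starts in the initial state and moves from each layer to the next one. -/
def IsLegal (S : LayeredSpace X L) (U : Trajectory X A L) : Prop :=
  U.1 0 = S.start ∧ ∀ k : Fin L, S.layer (U.1 k.succ) = S.layer (U.1 k.castSucc) + 1

theorem isLegal_of_trajectoryProb_ne_zero {U : Trajectory X A L}
    (h : trajectoryProb P π U ≠ 0) : IsLegal S U := by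
  constructor
  · by_contra h0
    simp [trajectoryProb, h0] at h
  · intro k
    by_contra hk
    apply h
    rw [trajectoryProb, Finset.prod_eq_zero (Finset.mem_univ k), mul_zero]
    rw [P.eq_zero_of_layer_ne _ _ _ hk, mul_zero]

end Occupancy

/-! ### Mirror descent with the unnormalized Kullback-Leibler divergence -/

section Scalar

/-- A summand of the unnormalized Kullback-Leibler divergence. -/
noncomputable def klTerm (p q : ℝ) : ℝ := p * Real.log (p / q) - p + q

@[simp] theorem klTerm_zero_left (q : ℝ) : klTerm 0 q = q := by simp [klTerm]

/-- The three-point identity of the Bregman divergence `klTerm`. -/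
theorem klTerm_three_point {p q r : ℝ} (hp : 0 ≤ p) (hq : 0 < q) (hr : 0 < r) :
    klTerm p r = klTerm q r + Real.log (q / r) * (p - q) + klTerm p q := by
  rcases hp.eq_or_lt with rfl | hp
  · simp only [klTerm]
    ring
  · simp only [klTerm, Real.log_div hp.ne' hr.ne', Real.log_div hq.ne' hr.ne',
      Real.log_div hp.ne' hq.ne']
    ring

theorem klTerm_le_sq_div {p q : ℝ} (hp : 0 ≤ p) (hq : 0 < q) : klTerm p q ≤ (p - q) ^ 2 / q := by
  have h1 : p * Real.log (p / q) ≤ p * (p / q - 1) := by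
    rcases hp.eq_or_lt with rfl | hp
    · simp
    · exact mul_le_mul_of_nonneg_left (Real.log_le_sub_one_of_pos (by positivity)) hp.le
  have h2 : (p - q) ^ 2 / q = p * (p / q - 1) - p + q := by
    field_simp
    ring
  rw [h2, klTerm]
  linarith

theorem klTerm_nonneg {p q : ℝ} (hp : 0 ≤ p) (hq : 0 < q) : 0 ≤ klTerm p q := by
  rcases hp.eq_or_lt with rfl | hp
  · simpa using hq.le
  · have h1 := Real.one_sub_inv_le_log_of_pos (div_pos hp hq)
    have h2 := mul_le_mul_of_nonneg_left h1 hp.le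
    have h3 : p * (1 - (p / q)⁻¹) = p - q := by field_simp
    rw [klTerm]
    linarith

theorem exp_neg_le {c : ℝ} (hc : 0 ≤ c) : Real.exp (-c) ≤ 1 - c + c ^ 2 := by
  rw [Real.exp_neg]
  have h1 := Real.add_one_le_exp c
  refine (inv_anti₀ (by linarith) h1).trans ?_
  rw [inv_le_iff_one_le_mul₀ (by linarith)]
  have : 0 ≤ c ^ 3 := by positivity
  linarith [show (1 - c + c ^ 2) * (c + 1) = 1 + c ^ 3 by ring]

/-- The stability bound of a multiplicative weights step, in one coordinate. -/
theorem mul_sub_klTerm_le {a b c : ℝ} (ha : 0 < a) (hb : 0 < b) (hc : 0 ≤ c) :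
    c * (a - b) - klTerm b a ≤ a * c ^ 2 := by
  have hy : 0 < b * Real.exp c / a := by positivity
  have h1 := mul_le_mul_of_nonneg_left (Real.one_sub_inv_le_log_of_pos hy) hb.le
  have h2 : b * (1 - (b * Real.exp c / a)⁻¹) = b - a * Real.exp (-c) := by
    rw [Real.exp_neg]
    have := (Real.exp_pos c).ne'
    field_simp
  have h3 : Real.log (b * Real.exp c / a) = Real.log (b / a) + c := by
    rw [mul_div_right_comm, Real.log_mul (by positivity) (Real.exp_pos c).ne', Real.log_exp]
  have h4 := mul_le_mul_of_nonneg_left (exp_neg_le hc) ha.le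
  rw [h2, h3] at h1
  rw [klTerm]
  linarith

theorem klTerm_convex {p q r s : ℝ} (hp : 0 ≤ p) (hq : 0 ≤ q) (hr : 0 < r) (hs : 0 ≤ s)
    (hs1 : s ≤ 1) :
    klTerm ((1 - s) * q + s * p) r ≤ (1 - s) * klTerm q r + s * klTerm p r := by
  have h := Real.convexOn_mul_log.2 (show q / r ∈ Set.Ici (0 : ℝ) from by
    simpa using by positivity) (show p / r ∈ Set.Ici (0 : ℝ) from by simpa using by positivity)
    (sub_nonneg.2 hs1) hs (by ring)
  have h2 := mul_le_mul_of_nonneg_left h hr.le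
  simp only [smul_eq_mul] at h2
  have e1 : (1 - s) * (q / r) + s * (p / r) = ((1 - s) * q + s * p) / r := by ring
  have e2 : ∀ y, y = r * (y / r) := fun y => by field_simp
  rw [e1] at h2
  have e3 := e2 ((1 - s) * q + s * p)
  have e4 := e2 q
  have e5 := e2 p
  simp only [klTerm]
  have h3 : ((1 - s) * q + s * p) * Real.log (((1 - s) * q + s * p) / r) ≤
      (1 - s) * (q * Real.log (q / r)) + s * (p * Real.log (p / r)) := by
    calc _ = r * (((1 - s) * q + s * p) / r * Real.log (((1 - s) * q + s * p) / r)) := by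
          rw [← mul_assoc, ← e3]
      _ ≤ _ := h2
      _ = (1 - s) * (r * (q / r) * Real.log (q / r)) + s * (r * (p / r) * Real.log (p / r)) := by
          ring
      _ = _ := by rw [← e4, ← e5]
  linarith

/-- At the boundary point `0` the derivative of `klTerm` is `-∞`. -/
theorem klTerm_mul_left {p r s : ℝ} (hp : 0 < p) (hr : 0 < r) (hs : 0 < s) :
    klTerm (s * p) r = (1 - s) * klTerm 0 r + s * klTerm p r + s * (p * Real.log s) := by
  rw [klTerm_zero_left, klTerm, klTerm, mul_div_assoc, Real.log_mul hs.ne' (by positivity)]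
  ring

theorem continuous_klTerm (r : ℝ) : Continuous fun p => klTerm p r := by
  simp only [klTerm]
  refine ((?_ : Continuous fun p => p * Real.log (p / r)).sub continuous_id).add continuous_const
  rcases eq_or_ne r 0 with rfl | hr
  · simp [continuous_const]
  · have h : Continuous fun p : ℝ => r * (p / r * Real.log (p / r)) :=
      continuous_const.mul (Real.continuous_mul_log.comp (continuous_id.div_const r))
    refine h.congr fun p => ?_
    field_simp

end Scalar

section Mirror

variable {X A : Type*} [Fintype X] [Fintype A]

/-- The sum of a function on `X × A × X`. -/
noncomputable def total (f : X → A → X → ℝ) : ℝ := ∑ x, ∑ a, ∑ x', f x a x'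

theorem total_mono {f g : X → A → X → ℝ} (h : ∀ x a x', f x a x' ≤ g x a x') :
    total f ≤ total g :=
  Finset.sum_le_sum fun x _ => Finset.sum_le_sum fun a _ => Finset.sum_le_sum fun x' _ => h x a x'

theorem total_add (f g : X → A → X → ℝ) :
    total (fun x a x' => f x a x' + g x a x') = total f + total g := by
  simp [total, Finset.sum_add_distrib]

theorem total_sub (f g : X → A → X → ℝ) :
    total (fun x a x' => f x a x' - g x a x') = total f - total g := by
  simp [total, Finset.sum_sub_distrib]

theorem total_const_mul (c : ℝ) (f : X → A → X → ℝ) :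
    total (fun x a x' => c * f x a x') = c * total f := by
  simp [total, Finset.mul_sum]

theorem total_nonneg {f : X → A → X → ℝ} (h : ∀ x a x', 0 ≤ f x a x') : 0 ≤ total f :=
  Finset.sum_nonneg fun x _ => Finset.sum_nonneg fun a _ => Finset.sum_nonneg fun x' _ => h x a x'

theorem le_total_of_nonpos {f : X → A → X → ℝ} (h : ∀ x a x', f x a x' ≤ 0) (x : X) (a : A)
    (x' : X) : total f ≤ f x a x' := by
  have h1 : -f x a x' ≤ total fun x a x' => -f x a x' := by
    have hn : ∀ x a x', 0 ≤ -f x a x' := fun x a x' => neg_nonneg.2 (h x a x')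
    calc -f x a x' ≤ ∑ x', -f x a x' :=
          Finset.single_le_sum (f := fun x' => -f x a x') (fun y _ => hn x a y)
            (Finset.mem_univ x')
      _ ≤ ∑ a, ∑ x', -f x a x' :=
          Finset.single_le_sum (f := fun a => ∑ x', -f x a x')
            (fun b _ => Finset.sum_nonneg fun y _ => hn x b y) (Finset.mem_univ a)
      _ ≤ _ := Finset.single_le_sum (f := fun x => ∑ a, ∑ x', -f x a x')
            (fun z _ => Finset.sum_nonneg fun b _ => Finset.sum_nonneg fun y _ => hn z b y)
            (Finset.mem_univ x)
  have h2 : (total fun x a x' => -f x a x') = -total f := by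
    simp [total, Finset.sum_neg_distrib]
  linarith

theorem unnormalizedKL_eq_total (q r : X → A → X → ℝ) :
    unnormalizedKL q r = total fun x a x' => klTerm (q x a x') (r x a x') := rfl

/-- `q` is positive on `Z` and vanishes elsewhere. -/
structure PosExactlyOn (Z : X → A → X → Prop) (q : X → A → X → ℝ) : Prop where
  pos : ∀ x a x', Z x a x' → 0 < q x a x'
  eq_zero : ∀ x a x', ¬ Z x a x' → q x a x' = 0

/-- `q` is nonnegative on `Z` and vanishes elsewhere. -/
structure NonnegOn (Z : X → A → X → Prop) (q : X → A → X → ℝ) : Prop where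
  nonneg : ∀ x a x', 0 ≤ q x a x'
  eq_zero : ∀ x a x', ¬ Z x a x' → q x a x' = 0

/-- The objective function of a mirror descent step. -/
noncomputable def objective (η : ℝ) (z r q : X → A → X → ℝ) : ℝ :=
  η * pairing q z + unnormalizedKL q r

theorem objective_eq_total (η : ℝ) (z r q : X → A → X → ℝ) :
    objective η z r q =
      total fun x a x' => η * (q x a x' * z x a x') + klTerm (q x a x') (r x a x') := by
  rw [total_add, total_const_mul, objective, unnormalizedKL_eq_total]
  rfl

theorem continuous_objective (η : ℝ) (z r : X → A → X → ℝ) : Continuous (objective η z r) := by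
  rw [show objective η z r = fun q => total fun x a x' =>
    η * (q x a x' * z x a x') + klTerm (q x a x') (r x a x') from
      funext fun q => objective_eq_total η z r q]
  refine continuous_finsetSum _ fun x _ => continuous_finsetSum _ fun a _ =>
    continuous_finsetSum _ fun x' _ => ?_
  have h : Continuous fun q : X → A → X → ℝ => q x a x' := by fun_prop
  exact (continuous_const.mul (h.mul continuous_const)).add ((continuous_klTerm _).comp h)

/-- The point that divides the segment from `q` to `p` in the ratio `s : 1 - s`. -/
def mix (s : ℝ) (q p : X → A → X → ℝ) (x : X) (a : A) (x' : X) : ℝ :=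
  (1 - s) * q x a x' + s * p x a x'

variable {Z : X → A → X → Prop} {Δ : Set (X → A → X → ℝ)} {η : ℝ} {z r q : X → A → X → ℝ}

/-- A minimizer of the objective function is positive, because the objective function has slope
`-∞` at the boundary in the direction of a positive point. -/
theorem posExactlyOn_of_isMinOn (hΔ : ∀ q ∈ Δ, NonnegOn Z q)
    (hconv : ∀ q ∈ Δ, ∀ p ∈ Δ, ∀ s, 0 ≤ s → s ≤ 1 → mix s q p ∈ Δ)
    (hr : PosExactlyOn Z r) (hq : q ∈ Δ) (hmin : IsMinOn (objective η z r) Δ q)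
    {p : X → A → X → ℝ} (hp : p ∈ Δ) (hpos : PosExactlyOn Z p) : PosExactlyOn Z q := by
  refine ⟨fun x₀ a₀ y₀ hZ₀ => ?_, (hΔ q hq).eq_zero⟩
  refine ((hΔ q hq).nonneg x₀ a₀ y₀).lt_of_ne' fun hq0 => ?_
  have hp0 := hpos.pos x₀ a₀ y₀ hZ₀
  set c := objective η z r p - objective η z r q with hc
  -- A step small enough that `p ln s` at the vanishing coordinate outweighs `c`.
  set s := Real.exp (-(|c| + 1) / p x₀ a₀ y₀) with hs
  have hs0 : 0 < s := Real.exp_pos _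
  have hs1 : s ≤ 1 := by
    rw [hs, Real.exp_le_one_iff]
    exact div_nonpos_of_nonpos_of_nonneg (by linarith [abs_nonneg c]) hp0.le
  have hlog : p x₀ a₀ y₀ * Real.log s = -(|c| + 1) := by
    rw [hs, Real.log_exp]
    field_simp
  have hlog0 : Real.log s ≤ 0 := Real.log_nonpos hs0.le hs1
  classical
  have hterm : objective η z r (mix s q p) ≤
      (1 - s) * objective η z r q + s * objective η z r p +
        s * total (fun x a x' => if q x a x' = 0 then p x a x' * Real.log s else 0) := by
    simp only [objective_eq_total, ← total_const_mul, ← total_add]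
    refine total_mono fun x a x' => ?_
    by_cases hZ : Z x a x'
    · have hr' := hr.pos x a x' hZ
      have hp' := hpos.pos x a x' hZ
      split_ifs with h0
      · simp only [mix, h0, mul_zero, zero_add]
        rw [klTerm_mul_left hp' hr' hs0]
        apply le_of_eq
        ring
      · have := klTerm_convex hp'.le ((hΔ q hq).nonneg x a x') hr' hs0.le hs1
        simp only [mix]
        linarith
    · simp [mix, (hΔ q hq).eq_zero x a x' hZ, hpos.eq_zero x a x' hZ, hr.eq_zero x a x' hZ]
  have hcorr : total (fun x a x' => if q x a x' = 0 then p x a x' * Real.log s else 0) ≤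
      p x₀ a₀ y₀ * Real.log s := by
    refine (le_total_of_nonpos (fun x a x' => ?_) x₀ a₀ y₀).trans_eq (if_pos hq0)
    split_ifs
    · exact mul_nonpos_of_nonneg_of_nonpos ((hΔ p hp).nonneg x a x') hlog0
    · exact le_rfl
  have hmin' : objective η z r q ≤ objective η z r (mix s q p) :=
    hmin (hconv q hq p hp s hs0.le hs1)
  rw [hlog] at hcorr
  have h1 := mul_le_mul_of_nonneg_left hcorr hs0.le
  have h2 : 0 ≤ s * (c - (|c| + 1)) := by
    rw [hc] at h1 ⊢
    linarith
  have h3 := nonneg_of_mul_nonneg_right h2 hs0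
  linarith [le_abs_self c]

/-- The first-order optimality condition at a positive minimizer. -/
theorem isMinOn_firstOrder (hΔ : ∀ q ∈ Δ, NonnegOn Z q)
    (hconv : ∀ q ∈ Δ, ∀ p ∈ Δ, ∀ s, 0 ≤ s → s ≤ 1 → mix s q p ∈ Δ)
    (hr : PosExactlyOn Z r) (hq : q ∈ Δ) (hmin : IsMinOn (objective η z r) Δ q)
    (hpos : PosExactlyOn Z q) {u : X → A → X → ℝ} (hu : u ∈ Δ) :
    0 ≤ total fun x a x' =>
      (η * z x a x' + Real.log (q x a x' / r x a x')) * (u x a x' - q x a x') := by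
  set G := total fun x a x' =>
    (η * z x a x' + Real.log (q x a x' / r x a x')) * (u x a x' - q x a x') with hG
  set C := total fun x a x' => (u x a x' - q x a x') ^ 2 / q x a x' with hC
  have hC0 : 0 ≤ C := total_nonneg fun x a x' => by
    have := (hΔ q hq).nonneg x a x'
    positivity
  have hstep : ∀ s, 0 < s → s ≤ 1 → 0 ≤ G + s * C := by
    intro s hs0 hs1
    have hmin' : objective η z r q ≤ objective η z r (mix s q u) :=
      hmin (hconv q hq u hu s hs0.le hs1)
    have hterm : objective η z r (mix s q u) ≤ objective η z r q + s * G + s * (s * C) := by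
      rw [hG, hC]
      simp only [objective_eq_total, ← total_const_mul, ← total_add]
      refine total_mono fun x a x' => ?_
      by_cases hZ : Z x a x'
      · have hmix : 0 ≤ mix s q u x a x' :=
          (hΔ _ (hconv q hq u hu s hs0.le hs1)).nonneg x a x'
        have hq' := hpos.pos x a x' hZ
        rw [klTerm_three_point hmix hq' (hr.pos x a x' hZ)]
        have h1 := klTerm_le_sq_div hmix hq'
        have h2 : mix s q u x a x' - q x a x' = s * (u x a x' - q x a x') := by
          simp only [mix]
          ring
        rw [h2, show (s * (u x a x' - q x a x')) ^ 2 / q x a x' =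
          s * (s * ((u x a x' - q x a x') ^ 2 / q x a x')) by ring] at h1
        rw [h2, show mix s q u x a x' = q x a x' + s * (u x a x' - q x a x') by linarith]
        rw [show mix s q u x a x' = q x a x' + s * (u x a x' - q x a x') by linarith] at h1
        linarith
      · simp [mix, (hΔ u hu).eq_zero x a x' hZ, hpos.eq_zero x a x' hZ, hr.eq_zero x a x' hZ]
    have h2 : 0 ≤ s * (G + s * C) := by linarith
    exact nonneg_of_mul_nonneg_right h2 hs0
  by_contra hneg
  push Not at hneg
  have h1 := hstep (min 1 (-G / (2 * (C + 1)))) (lt_min one_pos (div_pos (by linarith)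
    (by linarith))) (min_le_left _ _)
  have h2 : min 1 (-G / (2 * (C + 1))) * C ≤ -G / (2 * (C + 1)) * (C + 1) :=
    mul_le_mul (min_le_right _ _) (by linarith) hC0 (div_nonneg (by linarith) (by linarith))
  have h3 : -G / (2 * (C + 1)) * (C + 1) = -G / 2 := by field_simp
  linarith

/-- The regret of one step of mirror descent. -/
theorem mirror_step_regret (hη : 0 ≤ η) (hz : ∀ x a x', 0 ≤ z x a x')
    (hr : PosExactlyOn Z r) (hpos : PosExactlyOn Z q) {u : X → A → X → ℝ} (hu : NonnegOn Z u)
    (hopt : 0 ≤ total fun x a x' =>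
      (η * z x a x' + Real.log (q x a x' / r x a x')) * (u x a x' - q x a x')) :
    η * (pairing r z - pairing u z) ≤ unnormalizedKL u r - unnormalizedKL u q +
      η ^ 2 * total fun x a x' => r x a x' * z x a x' ^ 2 := by
  have key : η * (pairing r z - pairing u z) + (total fun x a x' =>
      (η * z x a x' + Real.log (q x a x' / r x a x')) * (u x a x' - q x a x')) ≤
      unnormalizedKL u r - unnormalizedKL u q +
      η ^ 2 * total fun x a x' => r x a x' * z x a x' ^ 2 := by
    rw [show pairing r z = total fun x a x' => r x a x' * z x a x' from rfl,
      show pairing u z = total fun x a x' => u x a x' * z x a x' from rfl]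
    simp only [unnormalizedKL_eq_total, ← total_sub, ← total_const_mul, ← total_add]
    refine total_mono fun x a x' => ?_
    by_cases hZ : Z x a x'
    · have hr' := hr.pos x a x' hZ
      have hq' := hpos.pos x a x' hZ
      rw [klTerm_three_point (hu.nonneg x a x') hq' hr']
      have h1 := mul_sub_klTerm_le hr' hq' (mul_nonneg hη (hz x a x'))
      rw [mul_pow] at h1
      linarith
    · simp [hu.eq_zero x a x' hZ, hpos.eq_zero x a x' hZ, hr.eq_zero x a x' hZ]
  linarith

theorem argminOn_spec {α : Type*} [TopologicalSpace α] [Nonempty α] {f : α → ℝ} {s : Set α}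
    (hs : IsCompact s) (hne : s.Nonempty) (hf : Continuous f) :
    argminOn f s ∈ s ∧ IsMinOn f s (argminOn f s) := by
  obtain ⟨q, hq, hmin⟩ := hs.exists_isMinOn hne hf.continuousOn
  exact Classical.epsilon_spec (p := fun q => q ∈ s ∧ IsMinOn f s q) ⟨q, hq, hmin⟩

end Mirror

/-! ### The geometry of the confidence sets -/

section ConfidenceSet

variable {X A : Type*} [Fintype X] [Fintype A] {L : ℕ} {S : LayeredSpace X L}

/-- The constraint on the induced transition function, multiplied by the mass of the state-action
pair; in this form it is closed and convex, and trivial where the mass vanishes. -/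
theorem mem_confidenceSet_iff {T : ℕ} {δ : ℝ} {N : X → A → ℕ} {M : X → A → X → ℕ}
    {q : X → A → X → ℝ} :
    q ∈ confidenceSet S T δ N M ↔ IsOccupancyLike S q ∧ ∀ x a,
      ∑ x', |q x a x' - (∑ y, q x a y) * empiricalTransition N M x a x'| ≤
        (∑ y, q x a y) * confidenceRadius S T δ N x a := by
  refine and_congr_right fun hq => forall_congr' fun x => forall_congr' fun a => ?_
  have hnn : ∀ y ∈ Finset.univ, 0 ≤ q x a y := fun y _ => (hq.mem_Icc x a y).1
  rcases (Finset.sum_nonneg hnn).eq_or_lt with h0 | hpos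
  · rw [← h0]
    have := (Finset.sum_eq_zero_iff_of_nonneg hnn).1 h0.symm
    simp only [lt_irrefl, false_imp_iff, zero_mul, sub_zero, true_iff]
    exact (Finset.sum_eq_zero fun y hy => by rw [this y hy, abs_zero]).le
  · simp only [hpos, forall_true_left]
    have : ∑ x', |q x a x' - (∑ y, q x a y) * empiricalTransition N M x a x'| =
        (∑ y, q x a y) * ∑ x', |inducedTransition q x a x' - empiricalTransition N M x a x'| := by
      rw [Finset.mul_sum]
      refine Finset.sum_congr rfl fun x' _ => ?_
      rw [← abs_of_pos hpos, ← abs_mul, abs_of_pos hpos, inducedTransition]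
      congr 1
      field_simp
    rw [this, mul_le_mul_iff_right₀ hpos]

/-- The triples `(x, a, x')` in `X_k × A × X_{k+1}` for some `k`. -/
def IsLayerTriple (S : LayeredSpace X L) (x : X) (_a : A) (x' : X) : Prop :=
  S.layer x' = S.layer x + 1

theorem IsOccupancyLike.nonnegOn {q : X → A → X → ℝ} (hq : IsOccupancyLike S q) :
    NonnegOn (IsLayerTriple S) q :=
  ⟨fun x a x' => (hq.mem_Icc x a x').1, hq.eq_zero_of_layer_ne⟩

variable (T : ℕ) (δ : ℝ) (N : X → A → ℕ) (M : X → A → X → ℕ)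

theorem mix_mem_confidenceSet {q p : X → A → X → ℝ} (hq : q ∈ confidenceSet S T δ N M)
    (hp : p ∈ confidenceSet S T δ N M) {s : ℝ} (hs : 0 ≤ s) (hs1 : s ≤ 1) :
    mix s q p ∈ confidenceSet S T δ N M := by
  rw [mem_confidenceSet_iff] at hq hp ⊢
  obtain ⟨hq, hq'⟩ := hq
  obtain ⟨hp, hp'⟩ := hp
  have hs' : 0 ≤ 1 - s := sub_nonneg.2 hs1
  refine ⟨⟨fun x a x' => ?_, fun x a x' h => ?_, fun k hk => ?_, fun x h0 hL => ?_⟩,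
    fun x a => ?_⟩
  · exact convex_Icc (0 : ℝ) 1 (hq.mem_Icc x a x') (hp.mem_Icc x a x') hs' hs (by ring)
  · simp [mix, hq.eq_zero_of_layer_ne x a x' h, hp.eq_zero_of_layer_ne x a x' h]
  · simp only [mix, Finset.sum_add_distrib, ← Finset.mul_sum, hq.sum_eq_one k hk,
      hp.sum_eq_one k hk]
    ring
  · simp only [mix, Finset.sum_add_distrib, ← Finset.mul_sum, hq.flow x h0 hL, hp.flow x h0 hL]
  · have h1 := mul_le_mul_of_nonneg_left (hq' x a) hs'
    have h2 := mul_le_mul_of_nonneg_left (hp' x a) hs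
    have h3 : ∑ y, mix s q p x a y = (1 - s) * ∑ y, q x a y + s * ∑ y, p x a y := by
      simp only [mix, Finset.sum_add_distrib, ← Finset.mul_sum]
    rw [h3]
    calc _ ≤ ∑ x', ((1 - s) * |q x a x' - (∑ y, q x a y) * empiricalTransition N M x a x'| +
          s * |p x a x' - (∑ y, p x a y) * empiricalTransition N M x a x'|) := by
          refine Finset.sum_le_sum fun x' _ => ?_
          rw [← abs_of_nonneg hs', ← abs_mul, abs_of_nonneg hs', ← abs_of_nonneg hs, ← abs_mul,
            abs_of_nonneg hs]
          refine le_trans (le_of_eq ?_) (abs_add_le _ _)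
          congr 1
          simp only [mix]
          ring
      _ ≤ _ := by
          rw [Finset.sum_add_distrib, ← Finset.mul_sum, ← Finset.mul_sum]
          linarith

theorem isCompact_confidenceSet : IsCompact (confidenceSet S T δ N M) := by
  have hK : IsCompact (Set.univ.pi fun _ : X => Set.univ.pi fun _ : A => Set.univ.pi fun _ : X =>
      Set.Icc (0 : ℝ) 1) :=
    isCompact_univ_pi fun _ => isCompact_univ_pi fun _ => isCompact_univ_pi fun _ => isCompact_Icc
  refine hK.of_isClosed_subset ?_ fun q hq x _ a _ x' _ => hq.1.mem_Icc x a x'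
  have : confidenceSet S T δ N M =
      {q : X → A → X → ℝ | (∀ x a x', q x a x' ∈ Set.Icc (0 : ℝ) 1) ∧
        (∀ x a x', S.layer x' ≠ S.layer x + 1 → q x a x' = 0) ∧
        (∀ k < L, ∑ x with S.layer x = k, ∑ a, ∑ x', q x a x' = 1) ∧
        (∀ x, 0 < S.layer x → S.layer x < L → ∑ x', ∑ a, q x a x' = ∑ x', ∑ a, q x' a x) ∧
        ∀ x a, ∑ x', |q x a x' - (∑ y, q x a y) * empiricalTransition N M x a x'| ≤
        (∑ y, q x a y) * confidenceRadius S T δ N x a} := by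
    ext q
    rw [mem_confidenceSet_iff]
    exact ⟨fun ⟨h, h'⟩ => ⟨h.1, h.2, h.3, h.4, h'⟩, fun ⟨h1, h2, h3, h4, h5⟩ =>
      ⟨⟨h1, h2, h3, h4⟩, h5⟩⟩
  rw [this]
  simp only [Set.ofPred_and, Set.ofPred_forall]
  refine IsClosed.inter ?_ (IsClosed.inter ?_ (IsClosed.inter ?_ (IsClosed.inter ?_ ?_)))
  · exact isClosed_iInter fun x => isClosed_iInter fun a => isClosed_iInter fun x' =>
      isClosed_Icc.preimage (by fun_prop : Continuous fun q : X → A → X → ℝ => q x a x')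
  · exact isClosed_iInter fun x => isClosed_iInter fun a => isClosed_iInter fun x' =>
      isClosed_iInter fun _ => isClosed_eq (by fun_prop) continuous_const
  · exact isClosed_iInter fun k => isClosed_iInter fun _ =>
      isClosed_eq (by fun_prop) continuous_const
  · exact isClosed_iInter fun x => isClosed_iInter fun _ => isClosed_iInter fun _ =>
      isClosed_eq (by fun_prop) (by fun_prop)
  · exact isClosed_iInter fun x => isClosed_iInter fun a =>
      isClosed_le (by fun_prop) (by fun_prop)

end ConfidenceSet

/-! ### Visit counts along legal trajectories -/

section Counts

variable {X A : Type*} {L : ℕ}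

open Classical in
/-- The number of visits of a trajectory to a state-action pair. -/
noncomputable def visits (U : Trajectory X A L) (x : X) (a : A) : ℕ :=
  ∑ k : Fin L, if U.1 k.castSucc = x ∧ U.2 k = a then 1 else 0

open Classical in
/-- The number of transitions of a trajectory from a state-action pair to a state. -/
noncomputable def transitions (U : Trajectory X A L) (x : X) (a : A) (x' : X) : ℕ :=
  ∑ k : Fin L, if U.1 k.castSucc = x ∧ U.2 k = a ∧ U.1 k.succ = x' then 1 else 0

/-- The number of visits to a state-action pair in the first `t` episodes. -/
noncomputable def totalVisits {T : ℕ} (H : Fin T → Trajectory X A L) (t : ℕ) (x : X) (a : A) : ℕ :=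
  ∑ s with s.val < t, visits (H s) x a

/-- The number of transitions from a state-action pair to a state in the first `t` episodes. -/
noncomputable def totalTransitions {T : ℕ} (H : Fin T → Trajectory X A L) (t : ℕ) (x : X) (a : A)
    (x' : X) : ℕ :=
  ∑ s with s.val < t, transitions (H s) x a x'

variable {S : LayeredSpace X L}

theorem IsLegal.layer_eq {U : Trajectory X A L} (hU : IsLegal S U) (k : Fin (L + 1)) :
    S.layer (U.1 k) = k := by
  induction k using Fin.induction with
  | zero => rw [hU.1, (S.layer_eq_zero_iff _).2 rfl]; rfl
  | succ k ih => rw [hU.2 k, ih]; simp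

open Classical in
theorem IsLegal.visits_eq {U : Trajectory X A L} (hU : IsLegal S U) {x : X}
    (hx : S.layer x < L) (a : A) :
    visits U x a = if U.1 (Fin.castSucc ⟨S.layer x, hx⟩) = x ∧ U.2 ⟨S.layer x, hx⟩ = a
      then 1 else 0 := by
  rw [visits, Finset.sum_eq_single (⟨S.layer x, hx⟩ : Fin L) _ (by simp)]
  intro k _ hk
  rw [if_neg]
  rintro ⟨h, -⟩
  have := hU.layer_eq k.castSucc
  rw [h] at this
  exact hk (Fin.ext (by simpa using this.symm))

open Classical in
theorem IsLegal.transitions_eq {U : Trajectory X A L} (hU : IsLegal S U) {x : X}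
    (hx : S.layer x < L) (a : A) (x' : X) :
    transitions U x a x' = if U.1 (Fin.castSucc ⟨S.layer x, hx⟩) = x ∧ U.2 ⟨S.layer x, hx⟩ = a ∧
      U.1 (Fin.succ ⟨S.layer x, hx⟩) = x' then 1 else 0 := by
  rw [transitions, Finset.sum_eq_single (⟨S.layer x, hx⟩ : Fin L) _ (by simp)]
  intro k _ hk
  rw [if_neg]
  rintro ⟨h, -⟩
  have := hU.layer_eq k.castSucc
  rw [h] at this
  exact hk (Fin.ext (by simpa using this.symm))

theorem IsLegal.visits_le_one {U : Trajectory X A L} (hU : IsLegal S U) {x : X}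
    (hx : S.layer x < L) (a : A) : visits U x a ≤ 1 := by
  rw [hU.visits_eq hx]
  split_ifs <;> simp

theorem IsLegal.visits_final {U : Trajectory X A L} (hU : IsLegal S U) {x : X}
    (hx : S.layer x = L) (a : A) : visits U x a = 0 := by
  refine Finset.sum_eq_zero fun k _ => if_neg ?_
  rintro ⟨h, -⟩
  have := hU.layer_eq k.castSucc
  rw [h, hx] at this
  simp only [Fin.val_castSucc] at this
  omega

theorem sum_transitions [Fintype X] (U : Trajectory X A L) (x : X) (a : A) :
    ∑ x', transitions U x a x' = visits U x a := by
  classical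
  simp only [transitions, visits]
  rw [Finset.sum_comm]
  refine Finset.sum_congr rfl fun k _ => ?_
  by_cases h : U.1 k.castSucc = x ∧ U.2 k = a
  · simp [h]
  · simp only [if_neg h]
    exact Finset.sum_eq_zero fun y _ => if_neg fun h' => h ⟨h'.1, h'.2.1⟩

theorem IsLegal.transitions_eq_zero {U : Trajectory X A L} (hU : IsLegal S U) {x : X} {a : A}
    {x' : X} (h : S.layer x' ≠ S.layer x + 1) : transitions U x a x' = 0 := by
  refine Finset.sum_eq_zero fun k _ => if_neg ?_
  rintro ⟨h1, -, h2⟩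
  have := hU.2 k
  rw [h1, h2] at this
  exact h this

theorem IsLegal.sum_visits [Fintype X] [Fintype A] {U : Trajectory X A L} (hU : IsLegal S U)
    (k : Fin L) : ∑ x with S.layer x = k, ∑ a, visits U x a = 1 := by
  classical
  have hk : S.layer (U.1 k.castSucc) = k := by simpa using hU.layer_eq k.castSucc
  rw [Finset.sum_eq_single (U.1 k.castSucc), Finset.sum_eq_single (U.2 k)]
  · rw [hU.visits_eq (by omega)]
    have : (⟨S.layer (U.1 k.castSucc), by omega⟩ : Fin L) = k := Fin.ext hk
    simp [this]
  · intro a _ ha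
    rw [hU.visits_eq (by omega)]
    have : (⟨S.layer (U.1 k.castSucc), by omega⟩ : Fin L) = k := Fin.ext hk
    simp [this, ha.symm]
  · simp
  · intro x hx hne
    have hx' := (Finset.mem_filter.1 hx).2
    refine Finset.sum_eq_zero fun a _ => ?_
    rw [hU.visits_eq (by omega)]
    have : (⟨S.layer x, by omega⟩ : Fin L) = k := Fin.ext hx'
    simp [this, hne.symm]
  · simp [hk]

variable {T : ℕ} {H : Fin T → Trajectory X A L}

theorem sum_totalTransitions [Fintype X] (t : ℕ) (x : X) (a : A) :
    ∑ x', totalTransitions H t x a x' = totalVisits H t x a := by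
  simp only [totalTransitions, totalVisits]
  rw [Finset.sum_comm]
  exact Finset.sum_congr rfl fun s _ => sum_transitions _ _ _

theorem totalTransitions_eq_zero (hH : ∀ t, IsLegal S (H t)) (t : ℕ) {x : X} {a : A} {x' : X}
    (h : S.layer x' ≠ S.layer x + 1) : totalTransitions H t x a x' = 0 :=
  Finset.sum_eq_zero fun s _ => (hH s).transitions_eq_zero h

theorem totalVisits_le (hH : ∀ t, IsLegal S (H t)) (t : ℕ) {x : X} (hx : S.layer x < L) (a : A) :
    totalVisits H t x a ≤ T := by
  calc totalVisits H t x a ≤ ∑ s : Fin T with s.val < t, 1 :=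
        Finset.sum_le_sum fun s _ => (hH s).visits_le_one hx a
    _ ≤ T := by simpa using Finset.card_filter_le (Finset.univ : Finset (Fin T)) _

end Counts

/-! ### Positive points of the confidence sets -/

section Feasible

variable {X A : Type*} [Fintype X] [Fintype A] [Nonempty A] {L : ℕ} {S : LayeredSpace X L}

theorem layerCard_pos (P : TransitionFunction S A) {k : ℕ} (hk : k ≤ L) : 0 < S.layerCard k := by
  obtain ⟨x, hx⟩ := exists_layer_eq P k hk
  exact Finset.card_pos.2 ⟨x, by simp [hx]⟩

theorem sum_layerCard : ∑ k ∈ Finset.range (L + 1), S.layerCard k = Fintype.card X := by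
  rw [← Finset.card_univ, Finset.card_eq_sum_card_fiberwise (f := S.layer)
    (t := Finset.range (L + 1))]
  · rfl
  · intro x _
    simpa [Nat.lt_succ_iff] using S.layer_le x

theorem sum_layerCard_le : ∑ k : Fin L, (S.layerCard k : ℝ) ≤ Fintype.card X := by
  rw [Fin.sum_univ_eq_sum_range fun k => (S.layerCard k : ℝ), ← sum_layerCard (S := S),
    Nat.cast_sum, Finset.sum_range_succ]
  linarith [Nat.cast_nonneg (α := ℝ) (S.layerCard L)]

theorem sum_layerCard_succ_le : ∑ k : Fin L, (S.layerCard (k + 1) : ℝ) ≤ Fintype.card X := by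
  rw [Fin.sum_univ_eq_sum_range fun k => (S.layerCard (k + 1) : ℝ), ← sum_layerCard (S := S),
    Nat.cast_sum, Finset.sum_range_succ']
  linarith [Nat.cast_nonneg (α := ℝ) (S.layerCard 0)]

/-- The transition function that mixes the empirical one (or the uniform one, at pairs without
visits) with the uniform one. -/
noncomputable def smoothedTransition (P : TransitionFunction S A) (N : X → A → ℕ)
    (M : X → A → X → ℕ) (hM : ∀ x a, ∑ x', M x a x' = N x a)
    (hM0 : ∀ x a x', S.layer x' ≠ S.layer x + 1 → M x a x' = 0)
    (lam : X → A → ℝ) (h0 : ∀ x a, 0 ≤ lam x a) (h1 : ∀ x a, lam x a ≤ 1) :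
    TransitionFunction S A where
  prob x a x' := if S.layer x' = S.layer x + 1 then
      (1 - lam x a) * (if N x a = 0 then 1 / (S.layerCard (S.layer x + 1) : ℝ)
        else (M x a x' : ℝ) / N x a) + lam x a * (1 / (S.layerCard (S.layer x + 1) : ℝ))
    else 0
  nonneg x a x' := by
    have h2 : 0 ≤ 1 - lam x a := sub_nonneg.2 (h1 x a)
    have h3 := h0 x a
    split_ifs <;> positivity
  sum_eq_one x a hx := by
    have hm : (S.layerCard (S.layer x + 1) : ℝ) ≠ 0 := by
      exact_mod_cast (layerCard_pos P hx).ne'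
    rw [← Finset.sum_filter, Finset.sum_add_distrib, ← Finset.mul_sum, ← Finset.mul_sum]
    have hu : ∑ x' with S.layer x' = S.layer x + 1, 1 / (S.layerCard (S.layer x + 1) : ℝ) = 1 := by
      rw [Finset.sum_const, nsmul_eq_mul, show (Finset.univ.filter fun x' =>
        S.layer x' = S.layer x + 1).card = S.layerCard (S.layer x + 1) from rfl]
      field_simp
    rw [hu]
    split_ifs with hN
    · rw [hu]
      ring
    · have : ∑ x' with S.layer x' = S.layer x + 1, (M x a x' : ℝ) / N x a = 1 := by
        rw [← Finset.sum_div, Finset.sum_filter_of_ne, ← Nat.cast_sum, hM, div_self]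
        · exact_mod_cast hN
        · intro y _ hy
          by_contra hne
          simp [hM0 x a y hne] at hy
      rw [this]
      ring
  eq_zero_of_layer_ne x a x' h := if_neg h

/-- The occupancy measures of a transition function in the confidence region, for all policies, lie
in the confidence set. -/
theorem occupancy_mem_confidenceSet (P : TransitionFunction S A) {π : X → A → ℝ}
    (hπ : IsPolicy S π) {T : ℕ} {δ : ℝ} {N : X → A → ℕ} {M : X → A → X → ℕ}
    (h : ∀ x a, S.layer x < L → ∑ x', |P.prob x a x' - empiricalTransition N M x a x'| ≤
      confidenceRadius S T δ N x a) :
    occupancy P π ∈ confidenceSet S T δ N M := by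
  have hocc := isOccupancyLike_occupancy P hπ
  rw [mem_confidenceSet_iff]
  refine ⟨hocc, fun x a => ?_⟩
  by_cases hx : S.layer x < L
  · have hnn : 0 ≤ ∑ y, occupancy P π x a y :=
      Finset.sum_nonneg fun y _ => occupancy_nonneg P hπ x a y
    refine le_trans (le_of_eq ?_) (mul_le_mul_of_nonneg_left (h x a hx) hnn)
    rw [Finset.mul_sum]
    refine Finset.sum_congr rfl fun x' _ => ?_
    rw [occupancy_eq P x hx a x', ← mul_sub, abs_mul, abs_of_nonneg hnn]
  · have h0 : ∀ y, occupancy P π x a y = 0 := fun y =>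
      hocc.eq_zero_of_layer_ne x a y (by have := S.layer_le y; omega)
    simp [h0]

/-- The confidence parameter `δ = |X||A|/T`. -/
noncomputable def confParam (X A : Type*) [Fintype X] [Fintype A] (T : ℕ) : ℝ :=
  (Fintype.card X : ℝ) * (Fintype.card A : ℝ) / (T : ℝ)

theorem confidenceRadius_eq {T : ℕ} (hT : 2 ≤ T) (N : X → A → ℕ) (x : X) (a : A) :
    confidenceRadius S T (confParam X A T) N x a =
      √(4 * (S.layerCard (S.layer x + 1) : ℝ) * Real.log T / ((max 1 (N x a) : ℕ) : ℝ)) := by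
  have hX : (Fintype.card X : ℝ) ≠ 0 := by
    exact_mod_cast (Fintype.card_pos_iff.2 ⟨x⟩).ne'
  have hA : (Fintype.card A : ℝ) ≠ 0 := by exact_mod_cast Fintype.card_ne_zero
  have hT0 : (T : ℝ) ≠ 0 := by
    have : T ≠ 0 := by omega
    exact_mod_cast this
  have : (T : ℝ) * (Fintype.card X : ℝ) * (Fintype.card A : ℝ) / confParam X A T = (T : ℝ) ^ 2 := by
    rw [confParam]
    field_simp
  rw [confidenceRadius, this, Real.log_pow]
  congr 1
  push_cast
  ring

theorem half_le_log {T : ℕ} (hT : 2 ≤ T) : 1 / 2 < Real.log T := by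
  have h1 : Real.log 2 ≤ Real.log T := Real.log_le_log two_pos (by exact_mod_cast hT)
  linarith [Real.log_two_gt_d9]

theorem confidenceRadius_pos (P : TransitionFunction S A) {T : ℕ} (hT : 2 ≤ T) (N : X → A → ℕ)
    {x : X} (hx : S.layer x < L) (a : A) :
    0 < confidenceRadius S T (confParam X A T) N x a := by
  have hm : (0 : ℝ) < S.layerCard (S.layer x + 1) := by exact_mod_cast layerCard_pos P hx
  have hlog := half_le_log hT
  have hN : (0 : ℝ) < (max 1 (N x a) : ℕ) := by
    exact_mod_cast lt_of_lt_of_le one_pos (le_max_left 1 (N x a))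
  rw [confidenceRadius_eq hT]
  exact Real.sqrt_pos.2 (div_pos (mul_pos (by positivity) (by linarith)) hN)

theorem one_le_confidenceRadius (P : TransitionFunction S A) {T : ℕ} (hT : 2 ≤ T) (N : X → A → ℕ)
    {x : X} (hx : S.layer x < L) (a : A) (hN : N x a = 0) :
    1 ≤ confidenceRadius S T (confParam X A T) N x a := by
  have hm : (1 : ℝ) ≤ S.layerCard (S.layer x + 1) := by exact_mod_cast layerCard_pos P hx
  have hlog := half_le_log hT
  rw [confidenceRadius_eq hT, hN, Real.one_le_sqrt]
  simp only [max_eq_left, zero_le, Nat.cast_one, div_one]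
  nlinarith

/-- At a pair without visits the empirical transition function is zero and the radius is at least
one, so every transition function lies in the confidence region. -/
theorem sum_abs_sub_le_of_unvisited (P P₀ : TransitionFunction S A) {T : ℕ} (hT : 2 ≤ T)
    {N : X → A → ℕ} {M : X → A → X → ℕ} (hM : ∀ x a, ∑ x', M x a x' = N x a)
    {x : X} (hx : S.layer x < L) (a : A) (hN : N x a = 0) :
    ∑ x', |P.prob x a x' - empiricalTransition N M x a x'| ≤
      confidenceRadius S T (confParam X A T) N x a := by
  have hM0 : ∀ x', M x a x' = 0 := fun x' => by
    have := (Finset.sum_eq_zero_iff.1 ((hM x a).trans hN)) x' (Finset.mem_univ _)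
    exact this
  refine le_trans (le_of_eq ?_) (one_le_confidenceRadius P₀ hT N hx a hN)
  rw [← P.sum_eq_one x a hx]
  refine Finset.sum_congr rfl fun x' _ => ?_
  simp [empiricalTransition, hM0, abs_of_nonneg (P.nonneg x a x')]

/-- The uniform policy. -/
noncomputable def uniformPolicy (X A : Type*) [Fintype A] (_ : X) (_ : A) : ℝ :=
  1 / (Fintype.card A : ℝ)

theorem isPolicy_uniformPolicy : IsPolicy S (uniformPolicy X A) :=
  ⟨fun _ _ => by rw [uniformPolicy]; positivity, fun _ _ => by simp [uniformPolicy]⟩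

theorem uniformPolicy_pos (x : X) (a : A) : 0 < uniformPolicy X A x a := by
  rw [uniformPolicy]
  exact one_div_pos.2 (by exact_mod_cast Fintype.card_pos)

theorem posExactlyOn_occupancy {P : TransitionFunction S A}
    (hP : ∀ x a x', S.layer x' = S.layer x + 1 → 0 < P.prob x a x') :
    PosExactlyOn (IsLayerTriple S) (occupancy P (uniformPolicy X A)) :=
  ⟨fun x a x' h => occupancy_pos P hP isPolicy_uniformPolicy uniformPolicy_pos x a x' h,
    (isOccupancyLike_occupancy P isPolicy_uniformPolicy).eq_zero_of_layer_ne⟩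

/-- The confidence set of consistent counters contains a positive occupancy measure. -/
theorem exists_pos_mem_confidenceSet (P : TransitionFunction S A) {T : ℕ} (hT : 2 ≤ T)
    {N : X → A → ℕ} {M : X → A → X → ℕ} (hM : ∀ x a, ∑ x', M x a x' = N x a)
    (hM0 : ∀ x a x', S.layer x' ≠ S.layer x + 1 → M x a x' = 0) :
    ∃ p ∈ confidenceSet S T (confParam X A T) N M, PosExactlyOn (IsLayerTriple S) p := by
  have hr0 : ∀ x a, 0 ≤ confidenceRadius S T (confParam X A T) N x a := fun x a =>
    Real.sqrt_nonneg _
  set lam : X → A → ℝ := fun x a => min 1 (confidenceRadius S T (confParam X A T) N x a / 2)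
    with hlam
  have h0 : ∀ x a, 0 ≤ lam x a := fun x a => le_min zero_le_one (div_nonneg (hr0 x a) two_pos.le)
  have h1 : ∀ x a, lam x a ≤ 1 := fun x a => min_le_left _ _
  set Q := smoothedTransition P N M hM hM0 lam h0 h1 with hQ
  refine ⟨occupancy Q (uniformPolicy X A),
    occupancy_mem_confidenceSet Q isPolicy_uniformPolicy fun x a hx => ?_,
    posExactlyOn_occupancy fun x a x' h => ?_⟩
  · by_cases hN : N x a = 0
    · exact sum_abs_sub_le_of_unvisited Q P hT hM hx a hN
    have hNpos : (0 : ℝ) < N x a := by exact_mod_cast Nat.pos_of_ne_zero hN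
    have hmax : max 1 (N x a) = N x a := max_eq_right (Nat.pos_of_ne_zero hN)
    have hm : (S.layerCard (S.layer x + 1) : ℝ) ≠ 0 := by
      exact_mod_cast (layerCard_pos P hx).ne'
    have hterm : ∀ x', |Q.prob x a x' - empiricalTransition N M x a x'| ≤
        lam x a * ((if S.layer x' = S.layer x + 1 then 1 / (S.layerCard (S.layer x + 1) : ℝ) else 0)
          + (M x a x' : ℝ) / N x a) := by
      intro x'
      by_cases hl : S.layer x' = S.layer x + 1
      · simp only [hQ, smoothedTransition, empiricalTransition, if_pos hl, if_neg hN, hmax]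
        rw [show (1 - lam x a) * ((M x a x' : ℝ) / N x a) +
          lam x a * (1 / (S.layerCard (S.layer x + 1) : ℝ)) - (M x a x' : ℝ) / N x a =
          lam x a * (1 / (S.layerCard (S.layer x + 1) : ℝ) - (M x a x' : ℝ) / N x a) by ring,
          abs_mul, abs_of_nonneg (h0 x a)]
        refine mul_le_mul_of_nonneg_left ((abs_sub _ _).trans ?_) (h0 x a)
        rw [abs_of_nonneg (by positivity), abs_of_nonneg (by positivity)]
      · rw [Q.eq_zero_of_layer_ne x a x' hl, empiricalTransition, hM0 x a x' hl]
        simp [if_neg hl]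
    calc _ ≤ ∑ x', lam x a * ((if S.layer x' = S.layer x + 1 then
            1 / (S.layerCard (S.layer x + 1) : ℝ) else 0) + (M x a x' : ℝ) / N x a) :=
          Finset.sum_le_sum fun x' _ => hterm x'
      _ = lam x a * (1 + 1) := by
          rw [← Finset.mul_sum, Finset.sum_add_distrib, ← Finset.sum_filter, Finset.sum_const,
            nsmul_eq_mul, show (Finset.univ.filter fun x' =>
            S.layer x' = S.layer x + 1).card = S.layerCard (S.layer x + 1) from rfl,
            ← Finset.sum_div, ← Nat.cast_sum, hM, div_self hNpos.ne', mul_one_div_cancel hm]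
      _ ≤ _ := by
          have : lam x a ≤ confidenceRadius S T (confParam X A T) N x a / 2 := min_le_right _ _
          linarith
  · have hx : S.layer x < L := by have := S.layer_le x'; omega
    have hm : (0 : ℝ) < S.layerCard (S.layer x + 1) := by exact_mod_cast layerCard_pos P hx
    have hlpos : 0 < lam x a := lt_min one_pos (half_pos (confidenceRadius_pos P hT N hx a))
    simp only [hQ, smoothedTransition, if_pos h]
    have h2 : 0 ≤ 1 - lam x a := sub_nonneg.2 (h1 x a)
    have h3 : 0 < lam x a * (1 / (S.layerCard (S.layer x + 1) : ℝ)) := by positivity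
    refine add_pos_of_nonneg_of_pos (mul_nonneg h2 ?_) h3
    split_ifs <;> positivity

theorem isPolicy_inducedPolicy {q : X → A → X → ℝ} (P : TransitionFunction S A)
    (hq : PosExactlyOn (IsLayerTriple S) q) (hq0 : ∀ x a x', 0 ≤ q x a x') :
    IsPolicy S (inducedPolicy q) := by
  refine ⟨fun x a => div_nonneg (Finset.sum_nonneg fun y _ => hq0 x a y)
    (Finset.sum_nonneg fun b _ => Finset.sum_nonneg fun y _ => hq0 x b y), fun x hx => ?_⟩
  obtain ⟨x', hx'⟩ := exists_layer_eq P (S.layer x + 1) hx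
  simp only [inducedPolicy]
  rw [← Finset.sum_div, div_self]
  refine (Finset.sum_pos' (fun b _ => Finset.sum_nonneg fun y _ => hq0 x b y)
    ⟨Classical.arbitrary A, by simp, ?_⟩).ne'
  exact Finset.sum_pos' (fun y _ => hq0 x _ y) ⟨x', by simp, hq.pos x _ x' hx'⟩

end Feasible

/-! ### The iterates and policies of the algorithm -/

section Run

variable {X A : Type*} [Fintype X] [Fintype A] [Nonempty A] {L : ℕ} {S : LayeredSpace X L}

/-- The transition function that moves to a uniformly random state of the next layer. -/
noncomputable def uniformTransition (P : TransitionFunction S A) : TransitionFunction S A :=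
  smoothedTransition P (fun _ _ => 0) (fun _ _ _ => 0) (fun _ _ => by simp) (fun _ _ _ _ => rfl)
    (fun _ _ => 1) (fun _ _ => zero_le_one) (fun _ _ => le_rfl)

theorem uniformTransition_prob (P : TransitionFunction S A) (x : X) (a : A) (x' : X) :
    (uniformTransition P).prob x a x' =
      if S.layer x' = S.layer x + 1 then 1 / (S.layerCard (S.layer x + 1) : ℝ) else 0 := by
  simp [uniformTransition, smoothedTransition]

/-- The uniform policy and uniform transitions reach the states of a layer with equal
probabilities, so the initial iterate is an occupancy measure. -/
theorem stateDist_uniform (P : TransitionFunction S A) (k : ℕ) (x : X) (hx : S.layer x = k) :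
    stateDist (uniformTransition P) (uniformPolicy X A) k x = 1 / (S.layerCard k : ℝ) := by
  have hA : (Fintype.card A : ℝ) ≠ 0 := by exact_mod_cast Fintype.card_ne_zero
  cases k with
  | zero =>
    have h1 : S.layerCard 0 = 1 := by
      rw [LayeredSpace.layerCard, Finset.card_eq_one]
      exact ⟨S.start, by ext y; simp [S.layer_eq_zero_iff]⟩
    simp [stateDist_zero, (S.layer_eq_zero_iff x).1 hx, h1]
  | succ k =>
    have hkL : k ≤ L := by have := S.layer_le x; omega
    rw [stateDist_succ]
    have h1 : ∀ y : X, ∑ a : A, stateDist (uniformTransition P) (uniformPolicy X A) k y *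
        (uniformPolicy X A y a * (uniformTransition P).prob y a x) =
        stateDist (uniformTransition P) (uniformPolicy X A) k y *
          (1 / (S.layerCard (k + 1) : ℝ)) := by
      intro y
      by_cases hy : stateDist (uniformTransition P) (uniformPolicy X A) k y = 0
      · simp [hy]
      · have hyk := layer_of_stateDist_ne_zero _ isPolicy_uniformPolicy k y hy
        simp only [uniformTransition_prob, hyk, hx, if_true, uniformPolicy, Finset.sum_const,
          Finset.card_univ, nsmul_eq_mul]
        field_simp
    simp_rw [h1]
    rw [← Finset.sum_mul, sum_stateDist _ isPolicy_uniformPolicy k hkL, one_mul]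

theorem init_q_eq_occupancy (P : TransitionFunction S A) :
    (AlgState.init A S).q = occupancy (uniformTransition P) (uniformPolicy X A) := by
  funext x a x'
  rw [occupancy, stateDist_uniform P _ x rfl, uniformTransition_prob]
  simp only [AlgState.init, uniformPolicy]
  split_ifs
  · rw [one_div_mul_one_div, one_div_mul_one_div, mul_assoc]
  · simp

theorem init_q_posExactlyOn (P : TransitionFunction S A) :
    PosExactlyOn (IsLayerTriple S) (AlgState.init A S).q := by
  rw [init_q_eq_occupancy P]
  refine posExactlyOn_occupancy fun x a x' h => ?_
  rw [uniformTransition_prob, if_pos h]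
  have hx : S.layer x + 1 ≤ L := h ▸ S.layer_le x'
  exact one_div_pos.2 (by exact_mod_cast layerCard_pos P hx)

theorem inducedPolicy_init_q (P : TransitionFunction S A) {x : X} (hx : S.layer x < L) (a : A) :
    inducedPolicy (AlgState.init A S).q x a = (AlgState.init A S).π x a := by
  have hm : (S.layerCard (S.layer x) : ℝ) ≠ 0 := by exact_mod_cast (layerCard_pos P hx.le).ne'
  rw [inducedPolicy, init_q_eq_occupancy P, sum_occupancy _ x hx,
    sum_sum_occupancy _ isPolicy_uniformPolicy x hx, stateDist_uniform P _ x rfl]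
  simp only [uniformPolicy, AlgState.init]
  field_simp

variable {T : ℕ} (η δ : ℝ) (ℓ : Fin T → X → A → X → ℝ)

theorem algRun_succ (H : Fin T → Trajectory X A L) {t : ℕ} (h : t < T) :
    algRun S η δ telGradient ℓ H (t + 1) =
      (((algRun S η δ telGradient ℓ H t).count (H ⟨t, h⟩)).updateEpoch).compPolicy S T η δ
        (ℓ ⟨t, h⟩) := by
  rw [algRun]
  simp only [dif_pos h, telGradient]

/-- The algorithm is causal: its state depends only on the past trajectories. -/
theorem algRun_congr {H H' : Fin T → Trajectory X A L} (t : ℕ)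
    (h : ∀ s : Fin T, s.val < t → H s = H' s) :
    algRun S η δ telGradient ℓ H t = algRun S η δ telGradient ℓ H' t := by
  induction t with
  | zero => rfl
  | succ t ih =>
    have ih' := ih fun s hs => h s (by omega)
    by_cases ht : t < T
    · rw [algRun_succ η δ ℓ H ht, algRun_succ η δ ℓ H' ht, ih', h ⟨t, ht⟩ (Nat.lt_succ_self t)]
    · rw [algRun, algRun, dif_neg ht, dif_neg ht, ih']

variable {H : Fin T → Trajectory X A L}

/-- No trajectory visits the final state in one of its first `L` steps, so the counters `n` and `N`
of the final state stay equal to zero, and the criterion `N ≤ n` holds there after every episode.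
Hence an epoch consists of one episode, and `N` and `M` count all the past episodes. -/
theorem algRun_counters (hH : ∀ t, IsLegal S (H t)) (t : ℕ) (ht : t ≤ T) :
    (algRun S η δ telGradient ℓ H t).n = (fun _ _ => 0) ∧
    (algRun S η δ telGradient ℓ H t).m = (fun _ _ _ => 0) ∧
    (algRun S η δ telGradient ℓ H t).N = totalVisits H t ∧
    (algRun S η δ telGradient ℓ H t).M = totalTransitions H t := by
  induction t with
  | zero =>
    refine ⟨rfl, rfl, ?_, ?_⟩
    · funext x a; simp [totalVisits, algRun, AlgState.init]
    · funext x a x'; simp [totalTransitions, algRun, AlgState.init]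
  | succ t ih =>
    obtain ⟨hn, hm, hN, hM⟩ := ih (by omega)
    have htT : t < T := ht
    rw [algRun_succ η δ ℓ H htT]
    set s := algRun S η δ telGradient ℓ H t
    have hepoch : ∃ x a, (s.count (H ⟨t, htT⟩)).N x a ≤ (s.count (H ⟨t, htT⟩)).n x a := by
      refine ⟨S.final, Classical.arbitrary A, ?_⟩
      have : s.N S.final (Classical.arbitrary A) = 0 := by
        rw [hN]
        exact Finset.sum_eq_zero fun s _ =>
          (hH s).visits_final ((S.layer_eq_top_iff _).2 rfl) _
      exact this.le.trans (Nat.zero_le _)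
    have hup : (s.count (H ⟨t, htT⟩)).updateEpoch =
        { s.count (H ⟨t, htT⟩) with
          n := fun _ _ => 0
          m := fun _ _ _ => 0
          N := fun x a => (s.count (H ⟨t, htT⟩)).N x a + (s.count (H ⟨t, htT⟩)).n x a
          M := fun x a x' => (s.count (H ⟨t, htT⟩)).M x a x' +
            (s.count (H ⟨t, htT⟩)).m x a x' } := if_pos hepoch
    rw [hup]
    refine ⟨rfl, rfl, ?_, ?_⟩
    · funext x a
      simp only [AlgState.compPolicy, AlgState.count, hN, hn, zero_add, totalVisits,
        sum_lt_succ t htT]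
      rfl
    · funext x a x'
      simp only [AlgState.compPolicy, AlgState.count, hM, hm, zero_add, totalTransitions,
        sum_lt_succ t htT]
      rfl

/-- The confidence set in force after `t` episodes. -/
def currentSet (S : LayeredSpace X L) (H : Fin T → Trajectory X A L) (t : ℕ) :
    Set (X → A → X → ℝ) :=
  confidenceSet S T (confParam X A T) (totalVisits H t) (totalTransitions H t)

theorem exists_pos_mem_currentSet (P : TransitionFunction S A) (hT : 2 ≤ T)
    (hH : ∀ t, IsLegal S (H t)) (t : ℕ) :
    ∃ p ∈ currentSet S H t, PosExactlyOn (IsLayerTriple S) p :=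
  exists_pos_mem_confidenceSet P hT (sum_totalTransitions t)
    fun _ _ _ h => totalTransitions_eq_zero hH t h

/-- The occupancy measure that the algorithm holds in the `t`-th episode. -/
noncomputable def iterate (S : LayeredSpace X L) (η : ℝ) (ℓ : Fin T → X → A → X → ℝ)
    (H : Fin T → Trajectory X A L) (t : ℕ) : X → A → X → ℝ :=
  (algRun S η (confParam X A T) telGradient ℓ H t).q

theorem algRun_succ_q_π (hH : ∀ t, IsLegal S (H t)) {t : ℕ} (ht : t < T) :
    iterate S η ℓ H (t + 1) =
      argminOn (objective η (ℓ ⟨t, ht⟩) (iterate S η ℓ H t)) (currentSet S H (t + 1)) ∧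
    (algRun S η (confParam X A T) telGradient ℓ H (t + 1)).π =
      inducedPolicy (iterate S η ℓ H (t + 1)) := by
  have hc := algRun_counters η (confParam X A T) ℓ hH (t + 1) ht
  rw [currentSet, ← hc.2.2.1, ← hc.2.2.2, iterate, iterate, algRun_succ η _ ℓ H ht]
  refine ⟨?_, rfl⟩
  have hq : ((((algRun S η (confParam X A T) telGradient ℓ H t).count
      (H ⟨t, ht⟩)).updateEpoch)).q = (algRun S η (confParam X A T) telGradient ℓ H t).q := by
    rw [AlgState.updateEpoch]
    split_ifs <;> rfl
  simp only [AlgState.compPolicy, hq]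
  rfl

/-- The iterates are positive elements of their confidence sets. In particular the induced policies
are defined at every state. -/
theorem iterate_spec (P : TransitionFunction S A) (hT : 2 ≤ T) (hH : ∀ t, IsLegal S (H t))
    (t : ℕ) (ht : t ≤ T) :
    iterate S η ℓ H t ∈ currentSet S H t ∧
      PosExactlyOn (IsLayerTriple S) (iterate S η ℓ H t) := by
  induction t with
  | zero =>
    refine ⟨?_, init_q_posExactlyOn P⟩
    have h0 : iterate S η ℓ H 0 = occupancy (uniformTransition P) (uniformPolicy X A) :=
      init_q_eq_occupancy P
    rw [h0]
    refine occupancy_mem_confidenceSet _ isPolicy_uniformPolicy fun x a hx => ?_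
    exact sum_abs_sub_le_of_unvisited _ P hT (sum_totalTransitions 0) hx a
      (by simp [totalVisits])
  | succ t ih =>
    obtain ⟨-, hpos⟩ := ih (by omega)
    obtain ⟨p, hp, hppos⟩ := exists_pos_mem_currentSet P hT hH (t + 1)
    rw [(algRun_succ_q_π η ℓ hH ht).1]
    obtain ⟨hmem, hmin⟩ := argminOn_spec
      (f := objective η (ℓ ⟨t, ht⟩) (iterate S η ℓ H t)) (s := currentSet S H (t + 1))
      (isCompact_confidenceSet _ _ _ _) ⟨p, hp⟩ (continuous_objective _ _ _)
    exact ⟨hmem, posExactlyOn_of_isMinOn (fun q hq => hq.1.nonnegOn)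
      (fun q hq p hp s hs hs1 => mix_mem_confidenceSet _ _ _ _ hq hp hs hs1) hpos hmem hmin hp
      hppos⟩

theorem iterate_step_regret (P : TransitionFunction S A) (hT : 2 ≤ T)
    (hH : ∀ t, IsLegal S (H t)) (hη : 0 ≤ η) (hℓ : ∀ t x a x', ℓ t x a x' ∈ Set.Icc (0 : ℝ) 1)
    (t : Fin T) {u : X → A → X → ℝ} (hu : u ∈ currentSet S H (t + 1)) :
    η * (pairing (iterate S η ℓ H t) (ℓ t) - pairing u (ℓ t)) ≤
      unnormalizedKL u (iterate S η ℓ H t) - unnormalizedKL u (iterate S η ℓ H (t + 1)) +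
      η ^ 2 * total fun x a x' => iterate S η ℓ H t x a x' * ℓ t x a x' ^ 2 := by
  obtain ⟨-, hpos⟩ := iterate_spec η ℓ P hT hH t t.2.le
  obtain ⟨-, hpos'⟩ := iterate_spec η ℓ P hT hH (t + 1) t.2
  have heq := (algRun_succ_q_π η ℓ hH t.2).1
  obtain ⟨hmem, hmin⟩ := argminOn_spec
    (f := objective η (ℓ t) (iterate S η ℓ H t)) (s := currentSet S H (t + 1))
    (isCompact_confidenceSet _ _ _ _) ⟨u, hu⟩ (continuous_objective _ _ _)
  rw [show argminOn (objective η (ℓ t) (iterate S η ℓ H t)) (currentSet S H (t + 1)) =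
    iterate S η ℓ H (t + 1) from heq.symm] at hmem hmin
  exact mirror_step_regret hη (fun x a x' => (hℓ t x a x').1) hpos hpos' hu.1.nonnegOn
    (isMinOn_firstOrder (fun q hq => hq.1.nonnegOn)
      (fun q hq p hp s hs hs1 => mix_mem_confidenceSet _ _ _ _ hq hp hs hs1) hpos hmem hmin
      hpos' hu)

/-- The policy of the algorithm in each episode. -/
noncomputable def learner (S : LayeredSpace X L) (η : ℝ) (ℓ : Fin T → X → A → X → ℝ)
    (H : Fin T → Trajectory X A L) (t : Fin T) : X → A → ℝ :=
  ucOReps S η (confParam X A T) telGradient ℓ H t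

theorem learner_eq_inducedPolicy (P : TransitionFunction S A) (hH : ∀ t, IsLegal S (H t))
    (t : Fin T) {x : X} (hx : S.layer x < L) (a : A) :
    learner S η ℓ H t x a = inducedPolicy (iterate S η ℓ H t) x a := by
  obtain ⟨t, ht⟩ := t
  cases t with
  | zero => exact (inducedPolicy_init_q P hx a).symm
  | succ t => exact congrFun (congrFun (algRun_succ_q_π η ℓ hH (t := t) (by omega)).2 x) a

theorem isPolicy_learner (P : TransitionFunction S A) (hT : 2 ≤ T) (hH : ∀ t, IsLegal S (H t))
    (t : Fin T) : IsPolicy S (learner S η ℓ H t) := by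
  obtain ⟨t, ht⟩ := t
  cases t with
  | zero => exact isPolicy_uniformPolicy
  | succ t =>
    have h := iterate_spec η ℓ P hT hH (t + 1) ht.le
    rw [learner, ucOReps, (algRun_succ_q_π η ℓ hH (t := t) (by omega)).2]
    exact isPolicy_inducedPolicy P h.2 h.1.1.nonnegOn.nonneg

theorem learner_congr {H' : Fin T → Trajectory X A L} (t : Fin T) (h : ∀ s < t, H s = H' s) :
    learner S η ℓ H t = learner S η ℓ H' t := by
  rw [learner, learner, ucOReps, ucOReps, algRun_congr η _ ℓ t fun s hs => h s hs]

end Run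

/-! ### The regret of the iterates -/

section IterateRegret

variable {X A : Type*} [Fintype X] [Fintype A] [Nonempty A] {L : ℕ} {S : LayeredSpace X L}

theorem IsOccupancyLike.eq_zero_of_layer_eq {q : X → A → X → ℝ} (hq : IsOccupancyLike S q)
    {x : X} (hx : S.layer x = L) (a : A) (x' : X) : q x a x' = 0 :=
  hq.eq_zero_of_layer_ne x a x' (by have := S.layer_le x'; omega)

theorem IsOccupancyLike.total_mul {q : X → A → X → ℝ} (hq : IsOccupancyLike S q) (g : ℕ → ℝ) :
    (total fun x a x' => q x a x' * g (S.layer x)) = ∑ k : Fin L, g k := by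
  rw [total, ← sum_layers (S := S)]
  · refine Finset.sum_congr rfl fun k _ => ?_
    calc _ = (∑ x with S.layer x = k, ∑ a, ∑ x', q x a x') * g k := by
          rw [Finset.sum_mul]
          refine Finset.sum_congr rfl fun x hx => ?_
          simp_rw [(Finset.mem_filter.1 hx).2, ← Finset.sum_mul]
      _ = _ := by rw [hq.sum_eq_one k k.2, one_mul]
  · intro x hx
    simp [hq.eq_zero_of_layer_eq hx]

theorem IsOccupancyLike.total_eq {q : X → A → X → ℝ} (hq : IsOccupancyLike S q) :
    total q = L := by
  simpa using hq.total_mul fun _ => 1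

/-- The logarithm `ln(|X|²|A|/L²)`, which bounds the relative entropy to the initial iterate per
layer. -/
noncomputable def logFactor (X A : Type*) [Fintype X] [Fintype A] (L : ℕ) : ℝ :=
  Real.log ((Fintype.card X : ℝ) ^ 2 * (Fintype.card A : ℝ) / (L : ℝ) ^ 2)

theorem lt_card (P : TransitionFunction S A) : L < Fintype.card X := by
  have h : L + 1 ≤ ∑ k ∈ Finset.range (L + 1), S.layerCard k := by
    calc L + 1 = ∑ k ∈ Finset.range (L + 1), 1 := by simp
      _ ≤ _ := Finset.sum_le_sum fun k hk =>
        layerCard_pos P (Nat.lt_succ_iff.1 (Finset.mem_range.1 hk))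
  rw [sum_layerCard] at h
  omega

theorem sum_log_layerCard_le (P : TransitionFunction S A) (hL : 1 ≤ L) :
    ∑ k : Fin L, (Real.log (S.layerCard k) + Real.log (Fintype.card A) +
      Real.log (S.layerCard (k + 1))) ≤ L * logFactor X A L := by
  have hL0 : (0 : ℝ) < L := by exact_mod_cast hL
  have hX0 : (0 : ℝ) < Fintype.card X := by exact_mod_cast (Nat.zero_le L).trans_lt (lt_card P)
  have hA0 : (0 : ℝ) < Fintype.card A := by exact_mod_cast Fintype.card_pos
  set c : ℝ := Fintype.card X / L with hc
  have hc0 : 0 < c := div_pos hX0 hL0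
  -- The tangent line of the logarithm at the average size `|X|/L` of a layer.
  have htan : ∀ k, k ≤ L → Real.log (S.layerCard k) ≤ Real.log c + S.layerCard k / c - 1 := by
    intro k hk
    have hm : (0 : ℝ) < S.layerCard k := by exact_mod_cast layerCard_pos P hk
    have h1 := Real.log_le_sub_one_of_pos (div_pos hm hc0)
    rw [Real.log_div hm.ne' hc0.ne'] at h1
    linarith
  have hs1 := sum_layerCard_le (S := S)
  have hs2 := sum_layerCard_succ_le (S := S)
  have hfac : logFactor X A L = 2 * Real.log c + Real.log (Fintype.card A) := by
    rw [logFactor, hc, show (Fintype.card X : ℝ) ^ 2 * (Fintype.card A : ℝ) / (L : ℝ) ^ 2 =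
      (Fintype.card X / L : ℝ) ^ 2 * Fintype.card A by ring,
      Real.log_mul (by positivity) hA0.ne', Real.log_pow]
    push_cast
    ring
  calc _ ≤ ∑ k : Fin L, (logFactor X A L - 2 + S.layerCard k / c + S.layerCard (k + 1) / c) := by
        refine Finset.sum_le_sum fun k _ => ?_
        have h1 := htan k k.2.le
        have h2 := htan (k + 1) k.2
        rw [hfac]
        linarith
    _ = L * (logFactor X A L - 2) + ((∑ k : Fin L, (S.layerCard k : ℝ)) / c +
        (∑ k : Fin L, (S.layerCard (k + 1) : ℝ)) / c) := by
        rw [Finset.sum_div, Finset.sum_div, Finset.sum_add_distrib, Finset.sum_add_distrib,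
          Finset.sum_const, Finset.card_univ, Fintype.card_fin, nsmul_eq_mul]
        ring
    _ ≤ L * (logFactor X A L - 2) + (Fintype.card X / c + Fintype.card X / c) := by gcongr
    _ = L * logFactor X A L := by
        rw [hc]
        field_simp
        ring

/-- The relative entropy of an occupancy measure with respect to the initial iterate. -/
theorem unnormalizedKL_init_le (P : TransitionFunction S A) (hL : 1 ≤ L) {u : X → A → X → ℝ}
    (hu : IsOccupancyLike S u) :
    unnormalizedKL u (AlgState.init A S).q ≤ L * logFactor X A L := by
  have hinit : IsOccupancyLike S (AlgState.init A S).q := by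
    rw [init_q_eq_occupancy P]
    exact isOccupancyLike_occupancy _ isPolicy_uniformPolicy
  refine le_trans ?_ (sum_log_layerCard_le P hL)
  rw [← hu.total_mul fun k => Real.log (S.layerCard k) + Real.log (Fintype.card A) +
      Real.log (S.layerCard (k + 1)), unnormalizedKL_eq_total]
  have h1 : (total fun x a x' => klTerm (u x a x') ((AlgState.init A S).q x a x')) ≤
      total fun x a x' => u x a x' * (Real.log (S.layerCard (S.layer x)) +
        Real.log (Fintype.card A) + Real.log (S.layerCard (S.layer x + 1))) +
        ((AlgState.init A S).q x a x' - u x a x') := by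
    refine total_mono fun x a x' => ?_
    by_cases hZ : S.layer x' = S.layer x + 1
    · have hx : S.layer x + 1 ≤ L := hZ ▸ S.layer_le x'
      have hm : (0 : ℝ) < S.layerCard (S.layer x) := by
        exact_mod_cast layerCard_pos P (by omega)
      have hm' : (0 : ℝ) < S.layerCard (S.layer x + 1) := by exact_mod_cast layerCard_pos P hx
      have hA0 : (0 : ℝ) < Fintype.card A := by exact_mod_cast Fintype.card_pos
      have hq : (AlgState.init A S).q x a x' = 1 / ((S.layerCard (S.layer x) : ℝ) *
        (Fintype.card A : ℝ) * (S.layerCard (S.layer x + 1) : ℝ)) := if_pos hZ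
      obtain ⟨hu0, hu1⟩ := hu.mem_Icc x a x'
      rcases hu0.eq_or_lt with h0 | hpos
      · rw [← h0]
        simp
      · have hlog : Real.log (u x a x' / (AlgState.init A S).q x a x') =
            Real.log (u x a x') + (Real.log (S.layerCard (S.layer x)) +
            Real.log (Fintype.card A) + Real.log (S.layerCard (S.layer x + 1))) := by
          rw [hq, div_div_eq_mul_div, div_one, Real.log_mul hpos.ne' (by positivity),
            Real.log_mul (by positivity) hm'.ne', Real.log_mul hm.ne' hA0.ne']
        have h2 := mul_nonpos_of_nonneg_of_nonpos hu0 (Real.log_nonpos hu0 hu1)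
        rw [klTerm, hlog]
        linarith
    · have hq : (AlgState.init A S).q x a x' = 0 := if_neg hZ
      rw [hu.eq_zero_of_layer_ne x a x' hZ, hq]
      simp
  rw [total_add, total_sub, hinit.total_eq, hu.total_eq, sub_self, add_zero] at h1
  exact h1

variable {T : ℕ} {ℓ : Fin T → X → A → X → ℝ} {H : Fin T → Trajectory X A L}

theorem stepSize_eq : stepSize X A L T = √(logFactor X A L / T) := rfl

theorem logFactor_pos (P : TransitionFunction S A) (hL : 1 ≤ L) : 0 < logFactor X A L := by
  have hL0 : (0 : ℝ) < L := by exact_mod_cast hL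
  have hX : (L : ℝ) < Fintype.card X := by exact_mod_cast lt_card P
  have hA : (1 : ℝ) ≤ Fintype.card A := by exact_mod_cast Fintype.card_pos
  apply Real.log_pos
  rw [one_lt_div (by positivity)]
  have h1 : (L : ℝ) ^ 2 < (Fintype.card X : ℝ) ^ 2 := by gcongr
  nlinarith

/-- The regret of the iterates against an occupancy measure that lies in all the confidence
sets. -/
theorem iterate_regret_le (P : TransitionFunction S A) (hL : 1 ≤ L) (hT : 2 ≤ T)
    (hH : ∀ t, IsLegal S (H t)) (hℓ : ∀ t x a x', ℓ t x a x' ∈ Set.Icc (0 : ℝ) 1)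
    {u : X → A → X → ℝ} (hu : ∀ t ≤ T, u ∈ currentSet S H t) :
    ∑ t : Fin T, (pairing (iterate S (stepSize X A L T) ℓ H t) (ℓ t) - pairing u (ℓ t)) ≤
      2 * L * √(T * logFactor X A L) := by
  have hT0 : (0 : ℝ) < T := by
    have : 0 < T := by omega
    exact_mod_cast this
  have hlf := logFactor_pos P hL
  set η := stepSize X A L T with hη
  have hη0 : 0 < η := Real.sqrt_pos.2 (div_pos hlf hT0)
  have hη2 : η ^ 2 * T = logFactor X A L := by
    rw [hη, stepSize_eq, Real.sq_sqrt (div_pos hlf hT0).le]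
    field_simp
  have hηs : η * √(T * logFactor X A L) = logFactor X A L := by
    rw [hη, stepSize_eq, ← Real.sqrt_mul (div_pos hlf hT0).le,
      show logFactor X A L / T * (T * logFactor X A L) = logFactor X A L ^ 2 by field_simp,
      Real.sqrt_sq hlf.le]
  have hstep : ∀ t : Fin T, η * (pairing (iterate S η ℓ H t) (ℓ t) - pairing u (ℓ t)) ≤
      unnormalizedKL u (iterate S η ℓ H t) - unnormalizedKL u (iterate S η ℓ H (t + 1)) +
        η ^ 2 * L := by
    intro t
    refine (iterate_step_regret η ℓ P hT hH hη0.le hℓ t (hu (t + 1) t.2)).trans ?_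
    have hocc := (iterate_spec η ℓ P hT hH t t.2.le).1.1
    gcongr
    rw [← hocc.total_eq]
    refine total_mono fun x a x' => mul_le_of_le_one_right (hocc.mem_Icc x a x').1 ?_
    exact pow_le_one₀ (hℓ t x a x').1 (hℓ t x a x').2
  have hsum := Finset.sum_le_sum fun t (_ : t ∈ Finset.univ) => hstep t
  rw [← Finset.mul_sum, Finset.sum_add_distrib, Finset.sum_const, Finset.card_univ,
    Fintype.card_fin, nsmul_eq_mul, Fin.sum_univ_eq_sum_range
      (fun t => unnormalizedKL u (iterate S η ℓ H t) - unnormalizedKL u (iterate S η ℓ H (t + 1))),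
    Finset.sum_range_sub'] at hsum
  have hKL0 : unnormalizedKL u (iterate S η ℓ H 0) ≤ L * logFactor X A L :=
    unnormalizedKL_init_le P hL (hu 0 (by omega)).1
  have hKLT : 0 ≤ unnormalizedKL u (iterate S η ℓ H T) := by
    have hpos := (iterate_spec η ℓ P hT hH T le_rfl).2
    rw [unnormalizedKL_eq_total]
    refine total_nonneg fun x a x' => ?_
    by_cases hZ : IsLayerTriple S x a x'
    · exact klTerm_nonneg ((hu 0 (by omega)).1.mem_Icc x a x').1 (hpos.pos x a x' hZ)
    · rw [(hu 0 (by omega)).1.eq_zero_of_layer_ne x a x' hZ, klTerm_zero_left,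
        hpos.eq_zero x a x' hZ]
  refine le_of_mul_le_mul_left ?_ hη0
  calc _ ≤ L * logFactor X A L - 0 + T * (η ^ 2 * L) := by linarith
    _ = L * logFactor X A L + L * (η ^ 2 * T) := by ring
    _ = 2 * L * (η * √(T * logFactor X A L)) := by rw [hη2, hηs]; ring
    _ = _ := by ring

end IterateRegret

/-! ### Occupancy measures of similar transition functions -/

section Difference

variable {X A : Type*} [Fintype X] [Fintype A] [Nonempty A] {L : ℕ} {S : LayeredSpace X L}
  (P : TransitionFunction S A) {π : X → A → ℝ} {q : X → A → X → ℝ}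

theorem PosExactlyOn.sum_pos (P : TransitionFunction S A)
    (hq : PosExactlyOn (IsLayerTriple S) q) (hq0 : ∀ x a x', 0 ≤ q x a x') {x : X}
    (hx : S.layer x < L) (a : A) : 0 < ∑ y, q x a y := by
  obtain ⟨x', hx'⟩ := exists_layer_eq P (S.layer x + 1) hx
  exact Finset.sum_pos' (fun y _ => hq0 x a y) ⟨x', by simp, hq.pos x a x' hx'⟩

/-- At one state, the occupancy measures differ by the difference of the state probabilities and
the difference of the transition functions. -/
theorem sum_abs_occupancy_sub_le (hπ : IsPolicy S π) (hq : IsOccupancyLike S q)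
    (hpos : PosExactlyOn (IsLayerTriple S) q)
    (hπq : ∀ x a, S.layer x < L → π x a = inducedPolicy q x a) {x : X} (hx : S.layer x < L) :
    ∑ a, ∑ x', |occupancy P π x a x' - q x a x'| ≤
      |stateDist P π (S.layer x) x - ∑ a, ∑ x', q x a x'| +
      stateDist P π (S.layer x) x *
        ∑ a, π x a * ∑ x', |P.prob x a x' - inducedTransition q x a x'| := by
  set D := ∑ a, ∑ x', q x a x' with hD
  set f := stateDist P π (S.layer x) x with hf
  have hf0 : 0 ≤ f := stateDist_nonneg P hπ _ _
  have hqpos := fun a => hpos.sum_pos P (fun x a x' => (hq.mem_Icc x a x').1) hx a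
  have hDpos : 0 < D := Finset.sum_pos (fun a _ => hqpos a) Finset.univ_nonempty
  have hqe : ∀ a x', q x a x' = D * π x a * inducedTransition q x a x' := by
    intro a x'
    have h1 := (hqpos a).ne'
    rw [hπq x a hx, inducedPolicy, inducedTransition, ← hD]
    field_simp
  have hRsum : ∀ a, ∑ x', inducedTransition q x a x' = 1 := fun a => by
    simp only [inducedTransition]
    rw [← Finset.sum_div, div_self (hqpos a).ne']
  have hR0 : ∀ a x', 0 ≤ inducedTransition q x a x' := fun a x' =>
    div_nonneg (hq.mem_Icc x a x').1 (hqpos a).le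
  have key : ∀ a, ∑ x', |occupancy P π x a x' - q x a x'| ≤
      π x a * |f - D| + f * (π x a * ∑ x', |P.prob x a x' - inducedTransition q x a x'|) := by
    intro a
    have hπ0 := hπ.nonneg x a
    calc _ ≤ ∑ x', (π x a * |f - D| * inducedTransition q x a x' +
          f * (π x a * |P.prob x a x' - inducedTransition q x a x'|)) := by
          refine Finset.sum_le_sum fun x' _ => ?_
          have e : occupancy P π x a x' - q x a x' =
              π x a * (f - D) * inducedTransition q x a x' +
              f * (π x a * (P.prob x a x' - inducedTransition q x a x')) := by
            rw [hqe, occupancy]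
            ring
          rw [e]
          refine (abs_add_le _ _).trans (le_of_eq ?_)
          simp only [abs_mul, abs_of_nonneg hπ0, abs_of_nonneg hf0, abs_of_nonneg (hR0 a x')]
      _ = _ := by
          rw [Finset.sum_add_distrib, ← Finset.mul_sum, hRsum, mul_one, ← Finset.mul_sum,
            ← Finset.mul_sum]
  refine (Finset.sum_le_sum fun a _ => key a).trans (le_of_eq ?_)
  rw [Finset.sum_add_distrib, ← Finset.sum_mul, hπ.sum_eq_one x hx, one_mul, ← Finset.mul_sum]

/-- On one layer, the state probabilities differ by at most the difference of the occupancy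
measures on the layer before it. -/
theorem sum_abs_stateDist_sub_le (hπ : IsPolicy S π) (hq : IsOccupancyLike S q) (k : ℕ)
    (hk : k + 1 < L) :
    ∑ x with S.layer x = k + 1, |stateDist P π (S.layer x) x - ∑ a, ∑ x', q x a x'| ≤
      ∑ x with S.layer x = k, ∑ a, ∑ x', |occupancy P π x a x' - q x a x'| := by
  have hocc := isOccupancyLike_occupancy P hπ
  have h1 : ∀ x ∈ Finset.univ.filter fun x => S.layer x = k + 1,
      |stateDist P π (S.layer x) x - ∑ a, ∑ x', q x a x'| ≤
        ∑ y with S.layer y = k, ∑ a, |occupancy P π y a x - q y a x| := by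
    intro x hx
    have hx := (Finset.mem_filter.1 hx).2
    rw [← sum_sum_occupancy P hπ x (by omega), Finset.sum_comm,
      hocc.flow x (by omega) (by omega), Finset.sum_comm (f := fun a x' => q x a x'),
      hq.flow x (by omega) (by omega)]
    have e : ∀ f : X → A → X → ℝ, IsOccupancyLike S f →
        ∑ y, ∑ a, f y a x = ∑ y with S.layer y = k, ∑ a, f y a x := by
      intro f hf
      rw [Finset.sum_filter_of_ne]
      intro y _ hy
      by_contra hne
      exact hy (Finset.sum_eq_zero fun a _ => hf.eq_zero_of_layer_ne y a x (by omega))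
    rw [e _ hocc, e _ hq, ← Finset.sum_sub_distrib]
    refine (Finset.abs_sum_le_sum_abs _ _).trans (Finset.sum_le_sum fun y _ => ?_)
    rw [← Finset.sum_sub_distrib]
    exact Finset.abs_sum_le_sum_abs _ _
  refine (Finset.sum_le_sum h1).trans ?_
  rw [Finset.sum_comm]
  refine Finset.sum_le_sum fun y _ => ?_
  rw [Finset.sum_comm]
  exact Finset.sum_le_sum fun a _ =>
    Finset.sum_le_univ_sum_of_nonneg fun x => abs_nonneg _

theorem sum_abs_stateDist_sub_zero (hL : 1 ≤ L) (hq : IsOccupancyLike S q) :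
    ∑ x with S.layer x = 0, |stateDist P π (S.layer x) x - ∑ a, ∑ x', q x a x'| = 0 := by
  have hfil : (Finset.univ.filter fun x => S.layer x = 0) = {S.start} := by
    ext x
    simp [S.layer_eq_zero_iff]
  have h1 := hq.sum_eq_one 0 (by omega)
  rw [hfil, Finset.sum_singleton] at h1 ⊢
  rw [h1, (S.layer_eq_zero_iff _).2 rfl, stateDist_zero, if_pos rfl, sub_self, abs_zero]

/-- The expected losses of a policy under two transition functions differ by at most `L` times
the expected difference of the transition functions along a trajectory. -/
theorem pairing_occupancy_sub_le (hL : 1 ≤ L) (hπ : IsPolicy S π) (hq : IsOccupancyLike S q)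
    (hpos : PosExactlyOn (IsLayerTriple S) q)
    (hπq : ∀ x a, S.layer x < L → π x a = inducedPolicy q x a)
    {ℓ : X → A → X → ℝ} (hℓ : ∀ x a x', ℓ x a x' ∈ Set.Icc (0 : ℝ) 1)
    {ξ : X → A → ℝ} (hξ : ∀ x a, S.layer x < L →
      ∑ x', |P.prob x a x' - inducedTransition q x a x'| ≤ ξ x a) :
    pairing (occupancy P π) ℓ - pairing q ℓ ≤
      L * ∑ U, trajectoryProb P π U * ∑ k : Fin L, ξ (U.1 k.castSucc) (U.2 k) := by
  set c : ℕ → ℝ := fun k => ∑ x with S.layer x = k,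
    stateDist P π (S.layer x) x * ∑ a, π x a * ξ x a with hc
  set b : ℕ → ℝ := fun k => ∑ x with S.layer x = k, ∑ a, ∑ x',
    |occupancy P π x a x' - q x a x'| with hb
  set e : ℕ → ℝ := fun k => ∑ x with S.layer x = k,
    |stateDist P π (S.layer x) x - ∑ a, ∑ x', q x a x'| with he
  have hc0 : ∀ k < L, 0 ≤ c k := fun k hk => Finset.sum_nonneg fun x hx =>
    mul_nonneg (stateDist_nonneg P hπ _ x) (Finset.sum_nonneg fun a _ =>
      mul_nonneg (hπ.nonneg x a) ((Finset.sum_nonneg fun _ _ => abs_nonneg _).trans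
        (hξ x a (by rw [(Finset.mem_filter.1 hx).2]; exact hk))))
  have hbe : ∀ k < L, b k ≤ e k + c k := by
    intro k hk
    rw [hb, he, hc]
    simp only
    rw [← Finset.sum_add_distrib]
    refine Finset.sum_le_sum fun x hx => ?_
    have hx : S.layer x < L := by rw [(Finset.mem_filter.1 hx).2]; exact hk
    refine (sum_abs_occupancy_sub_le P hπ hq hpos hπq hx).trans ?_
    gcongr with a
    · exact stateDist_nonneg P hπ _ x
    · exact hπ.nonneg x a
    · exact hξ x a hx
  -- The layer-wise differences accumulate the transition errors of the earlier layers.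
  have hbk : ∀ k < L, b k ≤ ∑ j ∈ Finset.range (k + 1), c j := by
    intro k
    induction k with
    | zero =>
      intro hk
      have h0 : e 0 = 0 := sum_abs_stateDist_sub_zero P hL hq
      have := hbe 0 hk
      simpa [h0] using this
    | succ k ih =>
      intro hk
      have h1 : e (k + 1) ≤ b k := sum_abs_stateDist_sub_le P hπ hq k hk
      have := hbe (k + 1) hk
      rw [Finset.sum_range_succ]
      linarith [ih (by omega)]
  have hbk' : ∀ k < L, b k ≤ ∑ j : Fin L, c j := by
    intro k hk
    refine (hbk k hk).trans ?_
    rw [Fin.sum_univ_eq_sum_range c]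
    exact Finset.sum_le_sum_of_subset_of_nonneg
      (Finset.range_subset_range.2 hk) fun j hj _ => hc0 j (Finset.mem_range.1 hj)
  have hcU : ∑ j : Fin L, c j =
      ∑ U, trajectoryProb P π U * ∑ k : Fin L, ξ (U.1 k.castSucc) (U.2 k) := by
    simp_rw [Finset.mul_sum]
    rw [Finset.sum_comm]
    refine Finset.sum_congr rfl fun k _ => ?_
    rw [sum_trajectoryProb_mul P hπ (fun x a _ => ξ x a) k]
    rw [hc]
    simp only
    rw [Finset.sum_filter]
    refine Finset.sum_congr rfl fun x _ => ?_
    split_ifs with hx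
    · rw [hx, Finset.mul_sum]
      refine Finset.sum_congr rfl fun a _ => ?_
      rw [← Finset.sum_mul, ← Finset.mul_sum, ← Finset.mul_sum,
        P.sum_eq_one x a (by rw [hx]; exact k.2)]
      ring
    · have : stateDist P π k x = 0 := by
        by_contra h
        exact hx (layer_of_stateDist_ne_zero P hπ k x h)
      simp [this]
  have hpair : pairing (occupancy P π) ℓ - pairing q ℓ ≤ ∑ k : Fin L, b k := by
    have hocc := isOccupancyLike_occupancy P hπ
    rw [hb]
    simp only
    rw [sum_layers (S := S) (fun x => ∑ a, ∑ x', |occupancy P π x a x' - q x a x'|)]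
    · rw [show pairing (occupancy P π) ℓ - pairing q ℓ =
        total fun x a x' => occupancy P π x a x' * ℓ x a x' - q x a x' * ℓ x a x' from
          (total_sub _ _).symm]
      refine total_mono fun x a x' => ?_
      obtain ⟨h0, h1⟩ := hℓ x a x'
      rw [← sub_mul]
      calc _ ≤ |occupancy P π x a x' - q x a x'| * ℓ x a x' :=
            mul_le_mul_of_nonneg_right (le_abs_self _) h0
        _ ≤ _ := mul_le_of_le_one_right (abs_nonneg _) h1
    · intro x hx
      simp [hocc.eq_zero_of_layer_eq hx, hq.eq_zero_of_layer_eq hx]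
  rw [← hcU]
  have hbk'' : ∀ k : Fin L, b k ≤ ∑ j : Fin L, c j := fun k => hbk' k k.2
  refine hpair.trans ((Finset.sum_le_sum fun k _ => hbk'' k).trans (le_of_eq ?_))
  simp

end Difference

/-! ### Concentration of the empirical transition function -/

/-- Hoeffding's lemma on a finite probability space. -/
theorem sum_mul_exp_le {X : Type*} [Fintype X] {p : X → ℝ} (hp : ∀ x, 0 ≤ p x)
    (hp1 : ∑ x, p x = 1) {f : X → ℝ} (hf : ∀ x, f x ∈ Set.Icc (-1 : ℝ) 1) (c : ℝ) :
    ∑ x, p x * Real.exp (c * (f x - ∑ y, p y * f y)) ≤ Real.exp (c ^ 2 / 2) := by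
  let _ : MeasurableSpace X := ⊤
  let μ : PMF X := PMF.ofFintype (fun x => ENNReal.ofReal (p x)) (by
    rw [← ENNReal.ofReal_sum_of_nonneg fun x _ => hp x, hp1, ENNReal.ofReal_one])
  have hint : ∀ g : X → ℝ, ∫ x, g x ∂μ.toMeasure = ∑ x, p x * g x := by
    intro g
    rw [PMF.integral_eq_sum]
    refine Finset.sum_congr rfl fun x _ => ?_
    rw [smul_eq_mul, PMF.ofFintype_apply, ENNReal.toReal_ofReal (hp x)]
  have h := (ProbabilityTheory.hasSubgaussianMGF_of_mem_Icc (μ := μ.toMeasure) (X := f)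
    (a := -1) (b := 1) (measurable_of_finite f).aemeasurable
    (Filter.Eventually.of_forall hf)).mgf_le c
  rw [ProbabilityTheory.mgf, hint, hint] at h
  refine h.trans (le_of_eq ?_)
  congr 1
  have : ((‖(1 : ℝ) - -1‖₊ / 2) ^ 2 : NNReal) = 1 := by
    rw [← NNReal.coe_inj]
    push_cast
    norm_num
  rw [this]
  simp

section Legal

variable {X A : Type*} [Fintype X] [Fintype A] {L : ℕ}

/-- The trajectories that start in the initial state and move from each layer to the next one.
All the other trajectories have probability zero. -/
def LegalTrajectory (A : Type*) (S : LayeredSpace X L) := {U : Trajectory X A L // IsLegal S U}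

open Classical in
noncomputable instance (S : LayeredSpace X L) : Fintype (LegalTrajectory A S) :=
  Subtype.fintype fun U : Trajectory X A L => IsLegal S U

variable {S : LayeredSpace X L}

theorem sum_legalTrajectory {f : Trajectory X A L → ℝ} (hf : ∀ U, ¬ IsLegal S U → f U = 0) :
    ∑ U : LegalTrajectory A S, f U.1 = ∑ U, f U :=
  Fintype.sum_of_injective (fun U : LegalTrajectory A S => U.1) Subtype.val_injective _ _
    (fun U hU => hf U fun h => hU ⟨⟨U, h⟩, rfl⟩) fun _ => rfl

theorem sum_legalTrajectory_trajectoryProb (P : TransitionFunction S A) (π : X → A → ℝ)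
    (g : Trajectory X A L → ℝ) :
    ∑ U : LegalTrajectory A S, trajectoryProb P π U.1 * g U.1 =
      ∑ U, trajectoryProb P π U * g U := by
  refine sum_legalTrajectory (f := fun U => trajectoryProb P π U * g U) fun U hU => ?_
  have : trajectoryProb P π U = 0 := by
    by_contra h
    exact hU (isLegal_of_trajectoryProb_ne_zero P h)
  rw [this, zero_mul]

/-- The underlying sequence of trajectories. -/
def history {T : ℕ} (H : Fin T → LegalTrajectory A S) (t : Fin T) : Trajectory X A L := (H t).1

theorem isLegal_history {T : ℕ} (H : Fin T → LegalTrajectory A S) (t : Fin T) :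
    IsLegal S (history H t) := (H t).2

variable [Nonempty A] {T : ℕ} (η : ℝ) (ℓ : Fin T → X → A → X → ℝ)

/-- The conditional probabilities of the trajectories in the interaction of the algorithm with
the environment. -/
noncomputable def episodeKernel (P : TransitionFunction S A) (t : Fin T)
    (H : Fin T → LegalTrajectory A S) : ℝ :=
  trajectoryProb P (learner S η ℓ (history H) t) (history H t)

theorem nonempty_legalTrajectory (P : TransitionFunction S A) :
    Nonempty (LegalTrajectory A S) := by
  have h := sum_trajectoryProb P (isPolicy_uniformPolicy (S := S) (A := A))
  obtain ⟨U, -, hU⟩ := Finset.exists_ne_zero_of_sum_ne_zero (h.trans_ne one_ne_zero)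
  exact ⟨⟨U, isLegal_of_trajectoryProb_ne_zero P hU⟩⟩

theorem episodeKernel_update (P : TransitionFunction S A) (t : Fin T)
    (H : Fin T → LegalTrajectory A S) (u : LegalTrajectory A S) :
    episodeKernel η ℓ P t (Function.update H t u) =
      trajectoryProb P (learner S η ℓ (history H) t) u.1 := by
  rw [episodeKernel, learner_congr η ℓ (H' := history H) t]
  · simp [history]
  · intro s hs
    simp [history, Function.update_of_ne hs.ne]

theorem isCausalKernel_episodeKernel (P : TransitionFunction S A) (hT : 2 ≤ T) :
    IsCausalKernel (episodeKernel η ℓ P) where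
  dependsOn t H H' h := by
    rw [episodeKernel, episodeKernel, learner_congr η ℓ (H' := history H') t]
    · rw [history, history, h t (Set.mem_Iic.2 le_rfl)]
    · intro s hs
      rw [history, history, h s (Set.mem_Iic.2 hs.le)]
  nonneg t H := trajectoryProb_nonneg P (isPolicy_learner η ℓ P hT (isLegal_history H) t) _
  sum_eq_one t H := by
    have h := sum_legalTrajectory_trajectoryProb P (learner S η ℓ (history H) t) fun _ => 1
    simp_rw [episodeKernel_update]
    simp_rw [mul_one] at h
    rw [h, sum_trajectoryProb P (isPolicy_learner η ℓ P hT (isLegal_history H) t)]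

theorem expectedRegret_eq_seqExp (P : TransitionFunction S A) :
    expectedRegret totalExpectedLoss P ℓ (learner S η ℓ) =
      seqExp (episodeKernel η ℓ P) fun H =>
        regret totalExpectedLoss P ℓ (learner S η ℓ (history H)) := by
  symm
  refine Fintype.sum_of_injective (fun H => history H) ?_ _ _ ?_ fun H => rfl
  · intro H H' h
    exact funext fun t => Subtype.ext (congrFun h t)
  · intro H hH
    have : ∃ t, ¬ IsLegal S (H t) := by
      by_contra! hall
      exact hH ⟨fun t => ⟨H t, hall t⟩, rfl⟩
    obtain ⟨t, ht⟩ := this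
    rw [historyProb, Finset.prod_eq_zero (Finset.mem_univ t), zero_mul]
    by_contra h
    exact ht (isLegal_of_trajectoryProb_ne_zero P h)

end Legal

section Concentration

variable {X A : Type*} [Fintype X] [Fintype A] [Nonempty A] {L : ℕ} {S : LayeredSpace X L}

open Classical in
/-- The function that is `1` on `B` and `-1` elsewhere. -/
noncomputable def signOn (B : Finset X) (x : X) : ℝ := if x ∈ B then 1 else -1

theorem signOn_mem_Icc (B : Finset X) (x : X) : signOn B x ∈ Set.Icc (-1 : ℝ) 1 := by
  rw [signOn]
  split_ifs <;> simp

/-- The deviation, tested against `f`, of the transitions of a trajectory out of a state-action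
pair from their expectation given the visits. -/
noncomputable def deviation (P : TransitionFunction S A) (f : X → ℝ) (x : X) (a : A)
    (U : Trajectory X A L) : ℝ :=
  ∑ x', f x' * ((transitions U x a x' : ℝ) - visits U x a * P.prob x a x')

theorem deviation_eq_zero (P : TransitionFunction S A) (f : X → ℝ) {x : X} {a : A}
    {U : Trajectory X A L} (h : visits U x a = 0) : deviation P f x a U = 0 := by
  refine Finset.sum_eq_zero fun x' _ => ?_
  have h1 := sum_transitions U x a
  rw [h, Finset.sum_eq_zero_iff] at h1
  rw [h, h1 x' (Finset.mem_univ _)]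
  simp

/-- In one episode, the exponential moment of the deviation is controlled by Hoeffding's lemma at
the only step at which the pair can be visited. -/
theorem sum_trajectoryProb_mul_exp_le (P : TransitionFunction S A) {π : X → A → ℝ}
    (hπ : IsPolicy S π) {f : X → ℝ} (hf : ∀ x, f x ∈ Set.Icc (-1 : ℝ) 1) {x : X}
    (hx : S.layer x < L) (a : A) (c : ℝ) :
    ∑ U, trajectoryProb P π U *
      Real.exp (c * deviation P f x a U - visits U x a * (c ^ 2 / 2)) ≤ 1 := by
  classical
  set μ := ∑ y, P.prob x a y * f y with hμ
  set h : X → A → X → ℝ := fun y b x' =>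
    if y = x ∧ b = a then Real.exp (c * (f x' - μ) - c ^ 2 / 2) else 1 with hh
  set k : Fin L := ⟨S.layer x, hx⟩ with hk
  have h1 : ∀ U, trajectoryProb P π U *
      Real.exp (c * deviation P f x a U - visits U x a * (c ^ 2 / 2)) =
      trajectoryProb P π U * h (U.1 k.castSucc) (U.2 k) (U.1 k.succ) := by
    intro U
    by_cases h0 : trajectoryProb P π U = 0
    · rw [h0, zero_mul, zero_mul]
    congr 1
    have hU := isLegal_of_trajectoryProb_ne_zero P h0
    rw [hh]
    simp only
    split_ifs with hv
    · have hv1 : visits U x a = 1 := by rw [hU.visits_eq hx, if_pos hv]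
      have hd : deviation P f x a U = f (U.1 k.succ) - μ := by
        rw [deviation, hv1, hμ]
        simp only [mul_sub, Finset.sum_sub_distrib]
        congr 1
        · rw [Finset.sum_eq_single (U.1 k.succ)]
          · rw [hU.transitions_eq hx, if_pos ⟨hv.1, hv.2, rfl⟩]
            simp
          · intro y _ hy
            rw [hU.transitions_eq hx, if_neg fun h' => hy h'.2.2.symm]
            simp
          · simp
        · refine Finset.sum_congr rfl fun y _ => ?_
          push_cast
          ring
      rw [hd, hv1]
      simp
    · have hv0 : visits U x a = 0 := by rw [hU.visits_eq hx, if_neg hv]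
      rw [deviation_eq_zero P f hv0, hv0]
      simp
  simp_rw [h1]
  rw [sum_trajectoryProb_mul P hπ h k]
  have hone : ∑ y, ∑ b, ∑ x', stateDist P π k y * (π y b * P.prob y b x') = 1 := by
    have h2 := sum_trajectoryProb_mul P hπ (fun _ _ _ => 1) k
    simp only [mul_one] at h2
    rw [← h2, sum_trajectoryProb P hπ]
  rw [← hone]
  refine Finset.sum_le_sum fun y _ => Finset.sum_le_sum fun b _ => ?_
  by_cases hyb : y = x ∧ b = a
  · obtain ⟨rfl, rfl⟩ := hyb
    have hhoef := sum_mul_exp_le (fun x' => P.nonneg y b x') (P.sum_eq_one y b hx) hf c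
    have h3 : ∑ x', P.prob y b x' * Real.exp (c * (f x' - μ) - c ^ 2 / 2) ≤ 1 := by
      simp_rw [Real.exp_sub, ← mul_div_assoc]
      rw [← Finset.sum_div, div_le_one (Real.exp_pos _)]
      exact hhoef
    have hnn : 0 ≤ stateDist P π k y * π y b :=
      mul_nonneg (stateDist_nonneg P hπ k y) (hπ.nonneg y b)
    simp only [hh, and_self, if_true]
    calc _ = stateDist P π k y * π y b *
          ∑ x', P.prob y b x' * Real.exp (c * (f x' - μ) - c ^ 2 / 2) := by
          rw [Finset.mul_sum]
          exact Finset.sum_congr rfl fun x' _ => by ring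
      _ ≤ stateDist P π k y * π y b * 1 := mul_le_mul_of_nonneg_left h3 hnn
      _ = _ := by
          rw [← P.sum_eq_one y b hx, Finset.mul_sum]
          exact Finset.sum_congr rfl fun x' _ => by ring
  · simp only [hh, if_neg hyb, mul_one, le_refl]

variable {T : ℕ}

open Classical in
/-- The factor that episode `t` contributes to the exponential supermartingale for the first `n`
visits to a state-action pair. -/
noncomputable def expFactor (P : TransitionFunction S A) (f : X → ℝ) (x : X) (a : A) (c : ℝ)
    (n : ℕ) (t : Fin T) (H : Fin T → Trajectory X A L) : ℝ :=
  if totalVisits H t x a < n then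
    Real.exp (c * deviation P f x a (H t) - visits (H t) x a * (c ^ 2 / 2)) else 1

theorem totalVisits_congr {H H' : Fin T → Trajectory X A L} (t : ℕ)
    (h : ∀ s : Fin T, s.val < t → H s = H' s) : totalVisits H t = totalVisits H' t := by
  funext x a
  refine Finset.sum_congr rfl fun s hs => ?_
  rw [h s (Finset.mem_filter.1 hs).2]

theorem seqExp_prod_expFactor_le (P : TransitionFunction S A) (hT : 2 ≤ T) (η : ℝ)
    (ℓ : Fin T → X → A → X → ℝ) {f : X → ℝ} (hf : ∀ x, f x ∈ Set.Icc (-1 : ℝ) 1) {x : X}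
    (hx : S.layer x < L) (a : A) (c : ℝ) (n : ℕ) :
    seqExp (episodeKernel η ℓ P) (fun H => ∏ t, expFactor P f x a c n t (history H)) ≤ 1 := by
  have hne := nonempty_legalTrajectory P
  refine (isCausalKernel_episodeKernel η ℓ P hT).seqExp_prod_le_one
    (w := fun t H => expFactor P f x a c n t (history H)) ?_ ?_ ?_
  · intro t H H' h
    have h1 : totalVisits (history H) t = totalVisits (history H') t :=
      totalVisits_congr _ fun s hs => by
        rw [history, history, h s (Set.mem_Iic.2 (le_of_lt hs))]
    have h2 : history H t = history H' t := by
      rw [history, history, h t (Set.mem_Iic.2 le_rfl)]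
    simp only [expFactor, h1, h2]
  · intro t H
    rw [expFactor]
    split_ifs
    · exact (Real.exp_pos _).le
    · exact zero_le_one
  · intro t H
    have hπ := isPolicy_learner η ℓ P hT (isLegal_history H) t
    have h1 : ∀ u, totalVisits (history (Function.update H t u)) t = totalVisits (history H) t :=
      fun u => totalVisits_congr _ fun s hs => by
        rw [history, history, Function.update_of_ne (Fin.ne_of_lt hs)]
    have h2 : ∀ u, history (Function.update H t u) t = u.1 := fun u => by
      rw [history, Function.update_self]
    simp only [expFactor, h1, h2, episodeKernel_update]
    split_ifs
    · rw [sum_legalTrajectory_trajectoryProb P _ fun U =>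
        Real.exp (c * deviation P f x a U - visits U x a * (c ^ 2 / 2))]
      exact sum_trajectoryProb_mul_exp_le P hπ hf hx a c
    · rw [sum_legalTrajectory_trajectoryProb P _ fun _ => 1]
      simp [sum_trajectoryProb P hπ]

/-- The transition function lies in all the confidence regions. -/
def GoodHistory (P : TransitionFunction S A) (H : Fin T → Trajectory X A L) : Prop :=
  ∀ t ≤ T, ∀ x a, S.layer x < L →
    ∑ x', |P.prob x a x' - empiricalTransition (totalVisits H t) (totalTransitions H t) x a x'| ≤
      confidenceRadius S T (confParam X A T) (totalVisits H t) x a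

theorem totalVisits_mono (H : Fin T → Trajectory X A L) {s t : ℕ} (h : s ≤ t) (x : X) (a : A) :
    totalVisits H s x a ≤ totalVisits H t x a := by
  refine Finset.sum_le_sum_of_subset fun i hi => ?_
  simp only [Finset.mem_filter, Finset.mem_univ, true_and] at hi ⊢
  omega

/-- The factors of the supermartingale stop when the number of visits reaches `n`. -/
theorem prod_expFactor_eq (P : TransitionFunction S A) (H : Fin T → Trajectory X A L) (f : X → ℝ)
    (x : X) (a : A) (c : ℝ) (t : ℕ) :
    ∏ s, expFactor P f x a c (totalVisits H t x a) s H =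
      Real.exp (c * (∑ x', f x' * ((totalTransitions H t x a x' : ℝ) -
        totalVisits H t x a * P.prob x a x')) - totalVisits H t x a * (c ^ 2 / 2)) := by
  have h1 : ∀ s : Fin T, expFactor P f x a c (totalVisits H t x a) s H =
      Real.exp (if s.val < t then
        c * deviation P f x a (H s) - visits (H s) x a * (c ^ 2 / 2) else 0) := by
    intro s
    rw [expFactor]
    by_cases hst : s.val < t
    · rw [if_pos hst]
      split_ifs with hlt
      · rfl
      · have h2 := totalVisits_mono H (Nat.succ_le_of_lt hst) x a
        rw [Nat.succ_eq_add_one, totalVisits, sum_lt_succ s.val s.2] at h2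
        have h3 : visits (H s) x a = 0 := by
          have : totalVisits H s x a + visits (H s) x a ≤ totalVisits H t x a := h2
          omega
        rw [deviation_eq_zero P f h3, h3]
        simp
    · rw [if_neg hst, if_neg (not_lt.2 (totalVisits_mono H (not_lt.1 hst) x a)), Real.exp_zero]
  simp_rw [h1]
  rw [← Real.exp_sum, ← Finset.sum_filter, Finset.sum_sub_distrib, ← Finset.mul_sum,
    ← Finset.sum_mul]
  have h2 : ∑ s : Fin T with s.val < t, deviation P f x a (H s) =
      ∑ x', f x' * ((totalTransitions H t x a x' : ℝ) -
        totalVisits H t x a * P.prob x a x') := by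
    simp only [deviation]
    rw [Finset.sum_comm]
    refine Finset.sum_congr rfl fun x' _ => ?_
    rw [← Finset.mul_sum, Finset.sum_sub_distrib, ← Finset.sum_mul, totalTransitions,
      totalVisits]
    push_cast
    rfl
  rw [h2, totalVisits]
  push_cast
  rfl

/-- The radius of the confidence region after `n` visits. -/
noncomputable def radiusAt (S : LayeredSpace X L) (T : ℕ) (x : X) (n : ℕ) : ℝ :=
  √(4 * (S.layerCard (S.layer x + 1) : ℝ) * Real.log T / (n : ℝ))

/-- The exponent of the Chernoff bound at the boundary of the confidence region. -/
theorem exp_radiusAt (hT : 2 ≤ T) (x : X) {n : ℕ} (hn : 1 ≤ n) :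
    Real.exp (n * (radiusAt S T x n ^ 2 / 2)) = (T : ℝ) ^ (2 * S.layerCard (S.layer x + 1)) := by
  have hT0 : (0 : ℝ) < T := by
    have : 0 < T := by omega
    exact_mod_cast this
  have hn0 : (0 : ℝ) < n := by exact_mod_cast hn
  have hlog := half_le_log hT
  rw [radiusAt, Real.sq_sqrt (by positivity), show (n : ℝ) *
    (4 * (S.layerCard (S.layer x + 1) : ℝ) * Real.log T / n / 2) =
    (2 * S.layerCard (S.layer x + 1) : ℕ) * Real.log T by
      push_cast
      field_simp
      ring, Real.exp_nat_mul, Real.exp_log hT0]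

/-- If the transition function leaves a confidence region, then one of the exponential
supermartingales is large: the `L¹` distance is attained by the test function that is `1` where
the empirical frequency exceeds the probability and `-1` elsewhere. -/
theorem exists_prod_expFactor_ge (P : TransitionFunction S A) (hT : 2 ≤ T)
    {H : Fin T → Trajectory X A L} (hH : ∀ t, IsLegal S (H t)) (hbad : ¬ GoodHistory P H) :
    ∃ x, S.layer x < L ∧ ∃ a : A, ∃ n ∈ Finset.Icc 1 T,
      ∃ B ∈ (Finset.univ.filter fun x' => S.layer x' = S.layer x + 1).powerset,
      (T : ℝ) ^ (2 * S.layerCard (S.layer x + 1)) ≤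
        ∏ t, expFactor P (signOn B) x a (radiusAt S T x n) n t H := by
  classical
  simp only [GoodHistory, not_forall, not_le] at hbad
  obtain ⟨t, ht, x, a, hx, hdev⟩ := hbad
  set n := totalVisits H t x a with hn
  have hn0 : n ≠ 0 := by
    intro h0
    have := sum_abs_sub_le_of_unvisited P P hT (sum_totalTransitions (H := H) t) hx a h0
    linarith
  have hn1 : 1 ≤ n := Nat.one_le_iff_ne_zero.2 hn0
  have hnR : (0 : ℝ) < n := by exact_mod_cast hn1
  have hmax : max 1 n = n := max_eq_right hn1
  set D : X → ℝ := fun x' => (totalTransitions H t x a x' : ℝ) - n * P.prob x a x' with hD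
  have hDn : ∀ x', P.prob x a x' -
      empiricalTransition (totalVisits H t) (totalTransitions H t) x a x' = -(D x' / n) := by
    intro x'
    rw [empiricalTransition, ← hn, hmax, hD]
    field_simp
    ring
  refine ⟨x, hx, a, n, Finset.mem_Icc.2 ⟨hn1, totalVisits_le hH t hx a⟩,
    Finset.univ.filter fun x' => S.layer x' = S.layer x + 1 ∧ 0 ≤ D x', ?_, ?_⟩
  · rw [Finset.mem_powerset]
    intro y hy
    simp only [Finset.mem_filter, Finset.mem_univ, true_and] at hy ⊢
    exact hy.1
  set B := Finset.univ.filter fun x' => S.layer x' = S.layer x + 1 ∧ 0 ≤ D x' with hB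
  have hsign : ∀ x', signOn B x' * D x' = |D x'| := by
    intro x'
    by_cases hl : S.layer x' = S.layer x + 1
    · rw [signOn]
      by_cases h0 : 0 ≤ D x'
      · rw [if_pos (by simp [hB, hl, h0]), one_mul, abs_of_nonneg h0]
      · rw [if_neg (by simp only [hB, Finset.mem_filter, not_and]; exact fun _ _ => h0),
          abs_of_neg (not_le.1 h0)]
        ring
    · have : D x' = 0 := by
        rw [hD]
        simp [totalTransitions_eq_zero hH t hl, P.eq_zero_of_layer_ne x a x' hl]
      simp [this]
  have hrad : confidenceRadius S T (confParam X A T) (totalVisits H t) x a =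
      radiusAt S T x n := by
    rw [confidenceRadius_eq hT, ← hn, hmax, radiusAt]
  have hsum : n * radiusAt S T x n ≤ ∑ x', |D x'| := by
    rw [hrad] at hdev
    simp_rw [hDn, abs_neg, abs_div, abs_of_pos hnR] at hdev
    rw [← Finset.sum_div, lt_div_iff₀ hnR] at hdev
    linarith
  have hr0 : 0 ≤ radiusAt S T x n := Real.sqrt_nonneg _
  rw [hn, prod_expFactor_eq, ← hn, ← exp_radiusAt hT x hn1, Real.exp_le_exp]
  change _ ≤ radiusAt S T x n * ∑ x', signOn B x' * D x' - _
  simp_rw [hsign]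
  nlinarith [mul_le_mul_of_nonneg_left hsum hr0]

theorem two_pow_mul_inv_le (hT : 2 ≤ T) {m : ℕ} (hm : 1 ≤ m) :
    (2 : ℝ) ^ m * ((T : ℝ) ^ (2 * m))⁻¹ ≤ 2 / (T : ℝ) ^ 2 := by
  have hT' : (2 : ℝ) ≤ T := by exact_mod_cast hT
  have h0 : (0 : ℝ) ≤ 2 / (T : ℝ) ^ 2 := by positivity
  have h1 : 2 / (T : ℝ) ^ 2 ≤ 1 := by
    rw [div_le_one (by positivity)]
    nlinarith
  rw [pow_mul, ← div_eq_mul_inv, ← div_pow]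
  exact pow_le_of_le_one h0 h1 (by omega)

open Classical in
/-- The probability that the transition function leaves some confidence region. -/
theorem seqExp_bad_le (P : TransitionFunction S A) (hT : 2 ≤ T) (η : ℝ)
    (ℓ : Fin T → X → A → X → ℝ) :
    seqExp (episodeKernel η ℓ P) (fun H => if GoodHistory P (history H) then 0 else 1) ≤
      2 * Fintype.card X * Fintype.card A / T := by
  have hT0 : (0 : ℝ) < T := by
    have : 0 < T := by omega
    exact_mod_cast this
  have hcaus := isCausalKernel_episodeKernel η ℓ P hT
  set w : X → A → ℕ → Finset X → (Fin T → LegalTrajectory A S) → ℝ := fun x a n B H =>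
    ((T : ℝ) ^ (2 * S.layerCard (S.layer x + 1)))⁻¹ *
      ∏ t, expFactor P (signOn B) x a (radiusAt S T x n) n t (history H) with hw
  have hw0 : ∀ x a n B H, 0 ≤ w x a n B H := fun x a n B H =>
    mul_nonneg (by positivity) (Finset.prod_nonneg fun t _ => by
      rw [expFactor]
      split_ifs
      · exact (Real.exp_pos _).le
      · exact zero_le_one)
  have hpt : ∀ H : Fin T → LegalTrajectory A S,
      (if GoodHistory P (history H) then (0 : ℝ) else 1) ≤
      ∑ x with S.layer x < L, ∑ a : A, ∑ n ∈ Finset.Icc 1 T,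
        ∑ B ∈ (Finset.univ.filter fun x' => S.layer x' = S.layer x + 1).powerset,
          w x a n B H := by
    intro H
    have hB0 : ∀ x a n, 0 ≤ ∑ B ∈ (Finset.univ.filter fun x' =>
        S.layer x' = S.layer x + 1).powerset, w x a n B H := fun x a n =>
      Finset.sum_nonneg fun B _ => hw0 x a n B H
    have hn0 : ∀ x a, 0 ≤ ∑ n ∈ Finset.Icc 1 T, ∑ B ∈ (Finset.univ.filter fun x' =>
        S.layer x' = S.layer x + 1).powerset, w x a n B H := fun x a =>
      Finset.sum_nonneg fun n _ => hB0 x a n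
    have ha0 : ∀ x, 0 ≤ ∑ a : A, ∑ n ∈ Finset.Icc 1 T, ∑ B ∈ (Finset.univ.filter fun x' =>
        S.layer x' = S.layer x + 1).powerset, w x a n B H := fun x =>
      Finset.sum_nonneg fun a _ => hn0 x a
    split_ifs with hgood
    · exact Finset.sum_nonneg fun x _ => ha0 x
    · obtain ⟨x, hx, a, n, hn, B, hB, hge⟩ :=
        exists_prod_expFactor_ge P hT (isLegal_history H) hgood
      calc (1 : ℝ) ≤ w x a n B H := by
            rw [hw]
            simp only
            rw [inv_mul_eq_div, one_le_div (by positivity)]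
            exact hge
        _ ≤ _ := Finset.single_le_sum (fun B _ => hw0 x a n B H) hB
        _ ≤ _ := Finset.single_le_sum (fun n _ => hB0 x a n) hn
        _ ≤ _ := Finset.single_le_sum (fun a _ => hn0 x a) (Finset.mem_univ a)
        _ ≤ _ := Finset.single_le_sum (fun x _ => ha0 x)
            (Finset.mem_filter.2 ⟨Finset.mem_univ x, hx⟩)
  refine (hcaus.seqExp_mono hpt).trans ?_
  simp_rw [seqExp_sum]
  have hE : ∀ x, S.layer x < L → ∀ a n B, seqExp (episodeKernel η ℓ P) (w x a n B) ≤
      ((T : ℝ) ^ (2 * S.layerCard (S.layer x + 1)))⁻¹ := by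
    intro x hx a n B
    rw [hw]
    simp only
    rw [seqExp_const_mul]
    exact mul_le_of_le_one_right (by positivity)
      (seqExp_prod_expFactor_le P hT η ℓ (signOn_mem_Icc B) hx a _ n)
  calc _ ≤ ∑ x with S.layer x < L, ∑ a : A, 2 / (T : ℝ) := by
        refine Finset.sum_le_sum fun x hx => Finset.sum_le_sum fun a _ => ?_
        have hx := (Finset.mem_filter.1 hx).2
        calc _ ≤ ∑ n ∈ Finset.Icc 1 T,
              ∑ B ∈ (Finset.univ.filter fun x' => S.layer x' = S.layer x + 1).powerset,
                ((T : ℝ) ^ (2 * S.layerCard (S.layer x + 1)))⁻¹ :=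
              Finset.sum_le_sum fun n _ => Finset.sum_le_sum fun B _ => hE x hx a n B
          _ = T * ((2 : ℝ) ^ S.layerCard (S.layer x + 1) *
                ((T : ℝ) ^ (2 * S.layerCard (S.layer x + 1)))⁻¹) := by
              rw [Finset.sum_const, Finset.sum_const, Finset.card_powerset, nsmul_eq_mul,
                nsmul_eq_mul, Nat.card_Icc, Nat.add_sub_cancel, Nat.cast_pow, Nat.cast_ofNat]
              rfl
          _ ≤ T * (2 / (T : ℝ) ^ 2) :=
              mul_le_mul_of_nonneg_left (two_pow_mul_inv_le hT (layerCard_pos P hx)) hT0.le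
          _ = 2 / T := by field_simp
    _ ≤ ∑ x : X, ∑ a : A, 2 / (T : ℝ) :=
        Finset.sum_le_univ_sum_of_nonneg fun x => Finset.sum_nonneg fun a _ => by positivity
    _ = _ := by
        simp only [Finset.sum_const, Finset.card_univ, nsmul_eq_mul]
        ring

end Concentration

/-! ### The confidence radii along the trajectories -/

section Radii

variable {X A : Type*} [Fintype X] [Fintype A] [Nonempty A] {L T : ℕ} {S : LayeredSpace X L}

/-- A sum along a trajectory, grouped by state-action pairs. -/
theorem sum_steps_eq (U : Trajectory X A L) (g : X → A → ℝ) :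
    ∑ k : Fin L, g (U.1 k.castSucc) (U.2 k) = ∑ x, ∑ a, (visits U x a : ℝ) * g x a := by
  classical
  simp only [visits, Nat.cast_sum, Finset.sum_mul]
  have h1 : ∀ x, ∑ a, ∑ k : Fin L, ((if U.1 k.castSucc = x ∧ U.2 k = a then 1 else 0 : ℕ) : ℝ) *
      g x a = ∑ k : Fin L, if U.1 k.castSucc = x then g x (U.2 k) else 0 := by
    intro x
    rw [Finset.sum_comm]
    refine Finset.sum_congr rfl fun k _ => ?_
    by_cases hx : U.1 k.castSucc = x <;> simp [hx]
  simp_rw [h1]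
  rw [Finset.sum_comm]
  exact Finset.sum_congr rfl fun k _ => by simp

/-- The increments of `3√n` dominate `1/√max(1, n)`. -/
theorem inv_sqrt_add_le (n : ℕ) :
    3 * √(n : ℝ) + 1 / √((max 1 n : ℕ) : ℝ) ≤ 3 * √((n + 1 : ℕ) : ℝ) := by
  rcases Nat.eq_zero_or_pos n with rfl | hn
  · norm_num
  · have hn' : (1 : ℝ) ≤ n := by exact_mod_cast hn
    have hs : 1 ≤ √(n : ℝ) := Real.one_le_sqrt.2 hn'
    have h1 := Real.sq_sqrt (show (0 : ℝ) ≤ n by linarith)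
    have h2 := Real.sq_sqrt (show (0 : ℝ) ≤ ((n + 1 : ℕ) : ℝ) by positivity)
    push_cast at h2
    rw [max_eq_right hn, ← le_sub_iff_add_le', div_le_iff₀ (by linarith)]
    push_cast
    -- It suffices that `√(n + 1) ≤ 2√n`.
    have h3 : √((n : ℝ) + 1) ≤ 2 * √(n : ℝ) := by
      rw [Real.sqrt_le_left (by linarith)]
      nlinarith
    have h4 : √(n : ℝ) ≤ √((n : ℝ) + 1) := Real.sqrt_le_sqrt (by linarith)
    nlinarith

theorem sum_visits_div_sqrt_le {H : Fin T → Trajectory X A L} (hH : ∀ t, IsLegal S (H t)) {x : X}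
    (hx : S.layer x < L) (a : A) (j : ℕ) (hj : j ≤ T) :
    ∑ t : Fin T with t.val < j,
      (visits (H t) x a : ℝ) / √((max 1 (totalVisits H t x a) : ℕ) : ℝ) ≤
      3 * √(totalVisits H j x a : ℝ) := by
  induction j with
  | zero => simp
  | succ j ih =>
    have hj' : j < T := hj
    have hsucc : totalVisits H (j + 1) x a = totalVisits H j x a + visits (H ⟨j, hj'⟩) x a :=
      sum_lt_succ j hj' _
    rw [sum_lt_succ j hj', hsucc]
    have ih := ih hj'.le
    have hv := (hH ⟨j, hj'⟩).visits_le_one hx a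
    interval_cases h : visits (H ⟨j, hj'⟩) x a
    · simpa using ih
    · have := inv_sqrt_add_le (totalVisits H j x a)
      simp only [Nat.cast_one]
      linarith

theorem confidenceRadius_eq_div (hT : 2 ≤ T) (N : X → A → ℕ) (x : X) (a : A) :
    confidenceRadius S T (confParam X A T) N x a =
      2 * √(S.layerCard (S.layer x + 1) : ℝ) * √(Real.log T) / √((max 1 (N x a) : ℕ) : ℝ) := by
  have hlog := half_le_log hT
  rw [confidenceRadius_eq hT, Real.sqrt_div (by positivity), Real.sqrt_mul (by positivity),
    Real.sqrt_mul (by norm_num), show (4 : ℝ) = 2 ^ 2 by norm_num, Real.sqrt_sq two_pos.le]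

theorem sum_totalVisits {H : Fin T → Trajectory X A L} (hH : ∀ t, IsLegal S (H t)) (k : Fin L) :
    ∑ x with S.layer x = k, ∑ a, totalVisits H T x a = T := by
  have h1 : ∀ x a, totalVisits H T x a = ∑ t, visits (H t) x a := fun x a => by
    rw [totalVisits, Finset.filter_true_of_mem fun t _ => t.2]
  simp_rw [h1]
  have h2 : ∀ x, ∑ a : A, ∑ t, visits (H t) x a = ∑ t, ∑ a : A, visits (H t) x a :=
    fun x => Finset.sum_comm
  simp_rw [h2]
  rw [Finset.sum_comm]
  simp_rw [(hH _).sum_visits k]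
  simp

/-- By the Cauchy-Schwarz inequality on each layer. -/
theorem sum_sqrt_totalVisits_le {H : Fin T → Trajectory X A L} (hH : ∀ t, IsLegal S (H t))
    (k : Fin L) :
    ∑ x with S.layer x = k, ∑ a, √(totalVisits H T x a : ℝ) ≤
      √(S.layerCard k : ℝ) * √((T : ℝ) * Fintype.card A) := by
  rw [← Finset.sum_product', ← Real.sqrt_mul (by positivity)]
  apply Real.le_sqrt_of_sq_le
  refine sq_sum_le_card_mul_sum_sq.trans (le_of_eq ?_)
  simp_rw [Real.sq_sqrt (Nat.cast_nonneg _)]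
  rw [Finset.sum_product' (f := fun x a => (totalVisits H T x a : ℝ)), Finset.card_product]
  have h := sum_totalVisits hH k
  have h' : ∑ x with S.layer x = k, ∑ a, (totalVisits H T x a : ℝ) = T := by exact_mod_cast h
  rw [h', Finset.card_univ, LayeredSpace.layerCard]
  push_cast
  ring

theorem sum_confidenceRadius_le (hT : 2 ≤ T) {H : Fin T → Trajectory X A L}
    (hH : ∀ t, IsLegal S (H t)) :
    ∑ t : Fin T, ∑ k : Fin L,
      confidenceRadius S T (confParam X A T) (totalVisits H t) ((H t).1 k.castSucc) ((H t).2 k) ≤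
      6 * Fintype.card X * √((T : ℝ) * Fintype.card A * Real.log T) := by
  have hlog := half_le_log hT
  simp_rw [fun t : Fin T => sum_steps_eq (H t) fun x a =>
    confidenceRadius S T (confParam X A T) (totalVisits H t) x a]
  rw [Finset.sum_comm, ← sum_layers (S := S)]
  · calc _ ≤ ∑ k : Fin L, ∑ x with S.layer x = k, ∑ a : A,
          6 * √(S.layerCard (k + 1) : ℝ) * √(Real.log T) * √(totalVisits H T x a : ℝ) := by
          refine Finset.sum_le_sum fun k _ => Finset.sum_le_sum fun x hx => ?_
          have hx := (Finset.mem_filter.1 hx).2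
          rw [Finset.sum_comm]
          refine Finset.sum_le_sum fun a _ => ?_
          simp_rw [confidenceRadius_eq_div hT, hx]
          have h1 := sum_visits_div_sqrt_le hH (x := x) (by omega) a T le_rfl
          rw [Finset.filter_true_of_mem fun t _ => t.2] at h1
          have h2 := mul_le_mul_of_nonneg_left h1 (show
            0 ≤ 2 * √(S.layerCard (k + 1) : ℝ) * √(Real.log T) by positivity)
          rw [Finset.mul_sum] at h2
          refine le_trans (le_of_eq ?_) (h2.trans (le_of_eq ?_))
          · exact Finset.sum_congr rfl fun t _ => by ring
          · ring
      _ ≤ ∑ k : Fin L, 6 * √(S.layerCard (k + 1) : ℝ) * √(Real.log T) *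
            (√(S.layerCard k : ℝ) * √((T : ℝ) * Fintype.card A)) := by
          refine Finset.sum_le_sum fun k _ => ?_
          simp_rw [← Finset.mul_sum]
          exact mul_le_mul_of_nonneg_left (sum_sqrt_totalVisits_le hH k) (by positivity)
      _ = 6 * √((T : ℝ) * Fintype.card A * Real.log T) *
            ∑ k : Fin L, √(S.layerCard k : ℝ) * √(S.layerCard (k + 1) : ℝ) := by
          rw [Real.sqrt_mul (by positivity) (Real.log T), Finset.mul_sum]
          exact Finset.sum_congr rfl fun k _ => by ring
      _ ≤ 6 * √((T : ℝ) * Fintype.card A * Real.log T) * Fintype.card X := by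
          refine mul_le_mul_of_nonneg_left ?_ (by positivity)
          have h1 : ∀ k : Fin L, √(S.layerCard k : ℝ) * √(S.layerCard (k + 1) : ℝ) ≤
              (S.layerCard k + S.layerCard (k + 1) : ℝ) / 2 := by
            intro k
            have e1 := Real.sq_sqrt (Nat.cast_nonneg (α := ℝ) (S.layerCard k))
            have e2 := Real.sq_sqrt (Nat.cast_nonneg (α := ℝ) (S.layerCard (k + 1)))
            nlinarith [sq_nonneg (√(S.layerCard k : ℝ) - √(S.layerCard (k + 1) : ℝ))]
          refine (Finset.sum_le_sum fun k _ => h1 k).trans ?_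
          have hs1 := sum_layerCard_le (S := S)
          have hs2 := sum_layerCard_succ_le (S := S)
          rw [← Finset.sum_div, Finset.sum_add_distrib]
          linarith
      _ = _ := by ring
  · intro x hx
    exact Finset.sum_eq_zero fun t _ => Finset.sum_eq_zero fun a _ => by
      rw [(hH t).visits_final hx]
      simp

end Radii

/-! ### The expected regret -/

section Regret

variable {X A : Type*} [Fintype X] [Fintype A] [Nonempty A] {L T : ℕ} {S : LayeredSpace X L}

theorem pairing_occupancy_mem_Icc (P : TransitionFunction S A) {π : X → A → ℝ}
    (hπ : IsPolicy S π) {ℓ : X → A → X → ℝ} (hℓ : ∀ x a x', ℓ x a x' ∈ Set.Icc (0 : ℝ) 1) :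
    pairing (occupancy P π) ℓ ∈ Set.Icc (0 : ℝ) L := by
  have hocc := isOccupancyLike_occupancy P hπ
  refine ⟨total_nonneg fun x a x' => mul_nonneg (hocc.mem_Icc x a x').1 (hℓ x a x').1, ?_⟩
  rw [← hocc.total_eq]
  exact total_mono fun x a x' => mul_le_of_le_one_right (hocc.mem_Icc x a x').1 (hℓ x a x').2

instance : Nonempty (Policy X A) :=
  ⟨⟨uniformPolicy X A, fun x a => (uniformPolicy_pos x a).le, fun _ => by simp [uniformPolicy]⟩⟩

/-- The expected sum of the confidence radii along a trajectory of the policy of episode `t`. -/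
noncomputable def expectedRadii (P : TransitionFunction S A) (π : X → A → ℝ)
    (H : Fin T → Trajectory X A L) (t : Fin T) : ℝ :=
  ∑ U, trajectoryProb P π U * ∑ k : Fin L,
    confidenceRadius S T (confParam X A T) (totalVisits H t) (U.1 k.castSucc) (U.2 k)

theorem expectedRadii_nonneg (P : TransitionFunction S A) {π : X → A → ℝ} (hπ : IsPolicy S π)
    (H : Fin T → Trajectory X A L) (t : Fin T) : 0 ≤ expectedRadii P π H t :=
  Finset.sum_nonneg fun U _ => mul_nonneg (trajectoryProb_nonneg P hπ U)
    (Finset.sum_nonneg fun _ _ => Real.sqrt_nonneg _)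

variable {ℓ : Fin T → X → A → X → ℝ} {H : Fin T → Trajectory X A L}

/-- While the true transition function lies in the confidence regions, the regret is the regret of
the iterates plus the error of the estimated transition functions. -/
theorem regret_le_of_goodHistory (P : TransitionFunction S A) (hL : 1 ≤ L) (hT : 2 ≤ T)
    (hH : ∀ t, IsLegal S (H t)) (hℓ : ∀ t x a x', ℓ t x a x' ∈ Set.Icc (0 : ℝ) 1)
    (hgood : GoodHistory P H) :
    regret totalExpectedLoss P ℓ (learner S (stepSize X A L T) ℓ H) ≤
      2 * L * √(T * logFactor X A L) +
        2 * L * ∑ t, expectedRadii P (learner S (stepSize X A L T) ℓ H t) H t := by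
  set η := stepSize X A L T with hη
  have hest : ∀ t : Fin T, pairing (occupancy P (learner S η ℓ H t)) (ℓ t) -
      pairing (iterate S η ℓ H t) (ℓ t) ≤ 2 * L * expectedRadii P (learner S η ℓ H t) H t := by
    intro t
    obtain ⟨hmem, hpos⟩ := iterate_spec η ℓ P hT hH t t.2.le
    have hξ : ∀ x a, S.layer x < L →
        ∑ x', |P.prob x a x' - inducedTransition (iterate S η ℓ H t) x a x'| ≤
          2 * confidenceRadius S T (confParam X A T) (totalVisits H t) x a := by
      intro x a hx
      have h1 := hgood t t.2.le x a hx
      have h2 := hmem.2 x a (hpos.sum_pos P hmem.1.nonnegOn.nonneg hx a)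
      rw [two_mul]
      refine le_trans ?_ (add_le_add h1 h2)
      rw [← Finset.sum_add_distrib]
      refine Finset.sum_le_sum fun x' _ => (abs_sub_le _
        (empiricalTransition (totalVisits H t) (totalTransitions H t) x a x') _).trans_eq ?_
      rw [abs_sub_comm (inducedTransition (iterate S η ℓ H t) x a x')]
    refine (pairing_occupancy_sub_le P hL (isPolicy_learner η ℓ P hT hH t) hmem.1 hpos
      (fun x a hx => learner_eq_inducedPolicy η ℓ P hH t hx a) (hℓ t) hξ).trans (le_of_eq ?_)
    simp_rw [← Finset.mul_sum, mul_left_comm _ (2 : ℝ), ← Finset.mul_sum]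
    rw [expectedRadii]
    ring
  rw [regret, sub_le_comm]
  refine le_ciInf fun ρ => ?_
  have hu : ∀ t ≤ T, occupancy P ρ.prob ∈ currentSet S H t := fun t ht =>
    occupancy_mem_confidenceSet P ρ.isPolicy fun x a hx => hgood t ht x a hx
  have hiter := iterate_regret_le P hL hT hH hℓ hu
  have hsum := Finset.sum_le_sum fun t (_ : t ∈ Finset.univ) => hest t
  simp_rw [totalExpectedLoss_expectedLosses P ρ.isPolicy,
    fun t => totalExpectedLoss_expectedLosses P (isPolicy_learner η ℓ P hT hH t)]
  rw [← Finset.mul_sum, Finset.sum_sub_distrib] at hsum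
  rw [Finset.sum_sub_distrib] at hiter
  linarith

/-- The trivial bound on the regret. -/
theorem regret_le_mul (P : TransitionFunction S A) (hT : 2 ≤ T)
    (hH : ∀ t, IsLegal S (H t)) (hℓ : ∀ t x a x', ℓ t x a x' ∈ Set.Icc (0 : ℝ) 1) (η : ℝ) :
    regret totalExpectedLoss P ℓ (learner S η ℓ H) ≤ L * T := by
  have h1 : ∑ t, totalExpectedLoss (expectedLosses P (learner S η ℓ H t) (ℓ t)) ≤
      ∑ _t : Fin T, (L : ℝ) := Finset.sum_le_sum fun t _ => by
    have hπ := isPolicy_learner η ℓ P hT hH t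
    rw [totalExpectedLoss_expectedLosses P hπ]
    exact (pairing_occupancy_mem_Icc P hπ (hℓ t)).2
  have h2 : 0 ≤ ⨅ ρ : Policy X A, ∑ t, totalExpectedLoss (expectedLosses P ρ.prob (ℓ t)) :=
    Real.iInf_nonneg fun ρ => Finset.sum_nonneg fun t _ => by
      rw [totalExpectedLoss_expectedLosses P ρ.isPolicy]
      exact (pairing_occupancy_mem_Icc P ρ.isPolicy (hℓ t)).1
  rw [Finset.sum_const, Finset.card_univ, Fintype.card_fin, nsmul_eq_mul] at h1
  rw [regret]
  linarith

/-- The expected radii of episode `t` may be replaced by the radii along its trajectory, whose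
sum is bounded along every history. -/
theorem seqExp_sum_expectedRadii_le (P : TransitionFunction S A) (hT : 2 ≤ T) (η : ℝ)
    (ℓ : Fin T → X → A → X → ℝ) :
    seqExp (episodeKernel η ℓ P)
      (fun H => ∑ t, expectedRadii P (learner S η ℓ (history H) t) (history H) t) ≤
      6 * Fintype.card X * √((T : ℝ) * Fintype.card A * Real.log T) := by
  have hne := nonempty_legalTrajectory P
  have hcaus := isCausalKernel_episodeKernel η ℓ P hT
  set F : Fin T → (Fin T → LegalTrajectory A S) → ℝ := fun t H => ∑ k : Fin L,
    confidenceRadius S T (confParam X A T) (totalVisits (history H) t)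
      ((history H t).1 k.castSucc) ((history H t).2 k) with hF
  have htower : ∀ t, seqExp (episodeKernel η ℓ P)
      (fun H => expectedRadii P (learner S η ℓ (history H) t) (history H) t) =
      seqExp (episodeKernel η ℓ P) (F t) := by
    intro t
    rw [hcaus.seqExp_tower t (F t)]
    · congr 1
      funext H
      have h1 : ∀ u, totalVisits (history (Function.update H t u)) t =
          totalVisits (history H) t := fun u => totalVisits_congr _ fun s hs => by
        rw [history, history, Function.update_of_ne (Fin.ne_of_lt hs)]
      have h2 : ∀ u, history (Function.update H t u) t = u.1 := fun u => by
        rw [history, Function.update_self]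
      simp only [hF, h1, h2, episodeKernel_update]
      exact (sum_legalTrajectory_trajectoryProb P _ fun U => ∑ k : Fin L,
        confidenceRadius S T (confParam X A T) (totalVisits (history H) t)
          (U.1 k.castSucc) (U.2 k)).symm
    · intro H H' h
      have h1 : totalVisits (history H) t = totalVisits (history H') t :=
        totalVisits_congr _ fun s hs => by
          rw [history, history, h s (Set.mem_Iic.2 (le_of_lt hs))]
      have h2 : history H t = history H' t := by
        rw [history, history, h t (Set.mem_Iic.2 le_rfl)]
      simp only [hF, h1, h2]
  rw [seqExp_sum]
  simp_rw [htower]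
  rw [← seqExp_sum, ← hcaus.seqExp_const (6 * (Fintype.card X : ℝ) *
    √((T : ℝ) * Fintype.card A * Real.log T))]
  exact hcaus.seqExp_mono fun H => sum_confidenceRadius_le hT (isLegal_history H)

/-- The bound on the expected regret in terms of the probability `p` that the transition function
leaves some confidence region. -/
theorem expectedRegret_learner_le (P : TransitionFunction S A) (hL : 1 ≤ L) (hT : 2 ≤ T)
    (hℓ : ∀ t x a x', ℓ t x a x' ∈ Set.Icc (0 : ℝ) 1) :
    ∃ p : ℝ, 0 ≤ p ∧ p ≤ 1 ∧ p ≤ 2 * Fintype.card X * Fintype.card A / T ∧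
    expectedRegret totalExpectedLoss P ℓ (learner S (stepSize X A L T) ℓ) ≤
      2 * L * √(T * logFactor X A L) +
        12 * L * Fintype.card X * √((T : ℝ) * Fintype.card A * Real.log T) + L * T * p := by
  classical
  have hne := nonempty_legalTrajectory P
  set η := stepSize X A L T with hη
  have hcaus := isCausalKernel_episodeKernel η ℓ P hT
  refine ⟨seqExp (episodeKernel η ℓ P) (fun H => if GoodHistory P (history H) then 0 else 1),
    ?_, ?_, seqExp_bad_le P hT η ℓ, ?_⟩
  · exact (hcaus.seqExp_const 0).symm.trans_le
      (hcaus.seqExp_mono fun H => by split_ifs <;> norm_num)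
  · exact (hcaus.seqExp_mono fun H => by split_ifs <;> norm_num).trans_eq hcaus.seqExp_one
  · have hpt : ∀ H : Fin T → LegalTrajectory A S,
        regret totalExpectedLoss P ℓ (learner S η ℓ (history H)) ≤
          (2 * L * √(T * logFactor X A L) +
          2 * L * ∑ t, expectedRadii P (learner S η ℓ (history H) t) (history H) t) +
          L * T * (if GoodHistory P (history H) then 0 else 1) := by
      intro H
      split_ifs with hgood
      · rw [mul_zero, add_zero]
        exact regret_le_of_goodHistory P hL hT (isLegal_history H) hℓ hgood
      · have h1 := regret_le_mul P hT (isLegal_history H) hℓ η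
        have h2 : 0 ≤ ∑ t, expectedRadii P (learner S η ℓ (history H) t) (history H) t :=
          Finset.sum_nonneg fun t _ => expectedRadii_nonneg P
            (isPolicy_learner η ℓ P hT (isLegal_history H) t) _ _
        have h3 : 0 ≤ 2 * L * √(T * logFactor X A L) := by positivity
        have h4 : 0 ≤ 2 * L *
            ∑ t, expectedRadii P (learner S η ℓ (history H) t) (history H) t := by positivity
        linarith
    rw [expectedRegret_eq_seqExp]
    refine (hcaus.seqExp_mono hpt).trans ?_
    rw [seqExp_add, seqExp_add, hcaus.seqExp_const, seqExp_const_mul, seqExp_const_mul]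
    have := mul_le_mul_of_nonneg_left (seqExp_sum_expectedRadii_le P hT η ℓ)
      (show (0 : ℝ) ≤ 2 * L by positivity)
    linarith

end Regret

end UCOREPS

theorem mainTheorem2 {X A : Type*} [Fintype X] [Fintype A] [Nonempty A] {L T : ℕ}
    (hL : 1 ≤ L) (hT : 2 ≤ T)
    (S : UCOREPS.LayeredSpace X L) (P : UCOREPS.TransitionFunction S A)
    (ℓ : Fin T → X → A → X → ℝ) (hℓ : ∀ t x a x', ℓ t x a x' ∈ Set.Icc (0 : ℝ) 1) :
    UCOREPS.expectedRegret UCOREPS.totalExpectedLoss P ℓ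
        (UCOREPS.ucOReps S (UCOREPS.stepSize X A L T)
          ((Fintype.card X : ℝ) * (Fintype.card A : ℝ) / (T : ℝ)) UCOREPS.telGradient ℓ) ≤
      25 * (L : ℝ) * (Fintype.card X : ℝ) *
        √((T : ℝ) * (Fintype.card A : ℝ) * Real.log (T : ℝ)) := by
  obtain ⟨p, hp0, hp1, hp, hreg⟩ := UCOREPS.expectedRegret_learner_le P hL hT hℓ
  refine hreg.trans ?_
  have hL1 : (1 : ℝ) ≤ L := by exact_mod_cast hL
  have hT0 : (0 : ℝ) < T := by
    have : 0 < T := by omega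
    exact_mod_cast this
  have hX : (1 : ℝ) ≤ Fintype.card X := by
    exact_mod_cast (Nat.succ_le_of_lt ((Nat.zero_le L).trans_lt (UCOREPS.lt_card P)))
  have hA : (0 : ℝ) < Fintype.card A := by exact_mod_cast Fintype.card_pos
  have hlog := UCOREPS.half_le_log hT
  set x : ℝ := (Fintype.card X : ℝ)
  set α : ℝ := (Fintype.card A : ℝ)
  set Y := √((T : ℝ) * α * Real.log T) with hY
  have hY0 : 0 ≤ Y := Real.sqrt_nonneg _
  have hYsq : Y ^ 2 = T * α * Real.log T := Real.sq_sqrt (by positivity)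
  have hTα : 0 < T * α := by positivity
  have hTY : T * α ≤ 2 * Y ^ 2 := by
    rw [hYsq]
    nlinarith
  have h1 : 2 * L * √(T * UCOREPS.logFactor X A L) ≤ 3 * L * x * Y := by
    have hle : UCOREPS.logFactor X A L ≤ x ^ 2 * α / (L : ℝ) ^ 2 := by
      have := Real.log_le_sub_one_of_pos (show 0 < x ^ 2 * α / (L : ℝ) ^ 2 by positivity)
      rw [UCOREPS.logFactor]
      linarith
    have hsq : L * √(T * UCOREPS.logFactor X A L) ≤ 3 / 2 * x * Y := by
      refine abs_le_of_sq_le_sq' ?_ (by positivity) |>.2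
      rw [mul_pow, Real.sq_sqrt (mul_nonneg hT0.le (UCOREPS.logFactor_pos P hL).le)]
      calc (L : ℝ) ^ 2 * (T * UCOREPS.logFactor X A L) ≤
            (L : ℝ) ^ 2 * (T * (x ^ 2 * α / (L : ℝ) ^ 2)) := by gcongr
        _ = x ^ 2 * (T * α) := by field_simp
        _ ≤ x ^ 2 * (2 * Y ^ 2) := by gcongr
        _ ≤ (3 / 2 * x * Y) ^ 2 := by nlinarith [sq_nonneg (x * Y)]
    have hxY : x * Y ≤ L * (x * Y) := le_mul_of_one_le_left (by positivity) hL1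
    linarith
  have h2 : L * T * p ≤ 2 * L * x * Y := by
    have hsq : T * p ≤ 2 * x * Y := by
      refine abs_le_of_sq_le_sq' ?_ (by positivity) |>.2
      -- `p² ≤ p`, because `p` is a probability.
      calc (T * p) ^ 2 = T ^ 2 * (p * p) := by ring
        _ ≤ T ^ 2 * (1 * (2 * x * α / T)) := by gcongr
        _ = 2 * x * (T * α) := by field_simp
        _ ≤ 2 * x * (2 * Y ^ 2) := by gcongr
        _ ≤ 2 * x * (2 * Y ^ 2) * x := le_mul_of_one_le_right (by positivity) hX
        _ = (2 * x * Y) ^ 2 := by ring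
    nlinarith
  have h3 : 0 ≤ L * x * Y := by positivity
  linarith
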